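/- Let $n,N\ge 0$ be integers, let $(w_{ij})$ be an $n\times N$ matrix with integer entries and columns $\mathbf w_1,\dots,\mathbf w_N$, and let $\boldsymbol\gamma=(\gamma_1,\dots,\gamma_n)\in\mathbb C^n$. Write $\mathbf t^{\mathbf w_j}=t_1^{w_{1j}}\cdots t_n^{w_{nj}}$, let $\pi_1,\pi_2$ be the projections of $X=\mathbb G_m^n\times\mathbb A^N$ (over $\mathbb C$) to $\mathbb G_m^n$ and to $Y=\mathbb A^N$, and let $F:X\to\mathbb A^1$, $F(\mathbf t,\mathbf x)=\sum_{j=1}^N x_j\mathbf t^{\mathbf w_j}$. Let $\mathcal K_{\overline{\boldsymbol\gamma}}$ be the $\mathcal D$-module on $\mathbb G_m^n$ with global sections $\mathbb C[\mathbf t^{\pm1}]$, on which $\partial_{t_i}$ acts by $g\mapsto \frac{\partial g}{\partial t_i}+\frac{\gamma_i}{t_i}g$ (up to isomorphism it depends only on $\overline{\boldsymbol\gamma}=\boldsymbol\gamma+\mathbb Z^n$), and let $\mathcal L$ be the $\mathcal D$-module on $\mathbb A^1=\operatorname{Spec}\mathbb C[z]$ with global sections $\mathbb C[z]$, on which $\partial_z$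 acts by $f\mapsto f'+f$. Define $$\mathrm{Hyp}_{\overline{\boldsymbol\gamma}}=R\pi_{2+}\big(\pi_1^*\mathcal K_{\overline{\boldsymbol\gamma}}\otimes_{\mathcal O_X}F^*\mathcal L\big),$$ where $R\pi_{2+}$ is the direct image of $\mathcal D$-modules. As $X$ and $Y$ are affine, $\mathcal D$-modules are identified with modules over the rings $D_X=\mathbb C[\mathbf t^{\pm1},\mathbf x,\partial_{\mathbf t},\partial_{\mathbf x}]$ and $D_Y=\mathbb C[\mathbf x,\partial_{\mathbf x}]$ of global differential operators, and the direct image of a left $D_X$-module $M$ is $\Gamma(Y,R\pi_{2+}M)=D_{Y\leftarrow X}\otimes^L_{D_X}M$, where $D_{Y\leftarrow X}=\omega_X\otimes D_{X\to Y}\otimes\omega_Y^{-1}$, $D_{X\to Y}=\mathcal O(X)\otimes_{\mathcal O(Y)}D_Y$, is the transfer $(D_Y,D_X)$-bimodule. Let $D^\cdot$ be the twisted relative de Rham complex with $$D^q=\bigoplus_{1\le i_1<\dots<i_q\le n}\mathbb C[\mathbf t^{\pm1},\mathbf x]\,\frac{dt_{i_1}}{t_{i_1}}\wedge\dots\wedge\frac{dt_{i_q}}{t_{i_q}}$$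 in degree $q$ ($0\le q\le n$) and with differential $\mathbf t^{-\boldsymbol\gamma}e^{-F}\circ d_{\mathbf t}\circ\mathbf t^{\boldsymbol\gamma}e^{F}$, that is $$d\Big(h\,\tfrac{dt_{i_1}}{t_{i_1}}\wedge\dots\wedge\tfrac{dt_{i_q}}{t_{i_q}}\Big)=\sum_{i=1}^n\Big(t_i\frac{\partial h}{\partial t_i}+\gamma_ih+\sum_{j=1}^N x_jw_{ij}\mathbf t^{\mathbf w_j}h\Big)\frac{dt_i}{t_i}\wedge\frac{dt_{i_1}}{t_{i_1}}\wedge\dots\wedge\frac{dt_{i_q}}{t_{i_q}}.$$ It is a complex of left $\mathbb C[\mathbf x,\partial_{\mathbf x}]$-modules, $x_j$ acting on the coefficients $h$ by multiplication and $\partial_{x_j}$ by $\mathbf t^{-\boldsymbol\gamma}e^{-F}\circ\frac{\partial}{\partial x_j}\circ\mathbf t^{\boldsymbol\gamma}e^{F}$, that is $h\mapsto\frac{\partial h}{\partial x_j}+\mathbf t^{\mathbf w_j}h$. Then there is an isomorphism $$\Gamma(\mathbb A^N,\mathrm{Hyp}_{\overline{\boldsymbol\gamma}})\cong D^\cdot[n]$$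 in the derived category of $\mathbb C[\mathbf x,\partial_{\mathbf x}]$-modules. -/

import Mathlib

open CategoryTheory TensorProduct MulOpposite

noncomputable section

universe w

namespace GKZ

/-! ## Affine varieties with étale coordinates and their rings of differential operators -/

/-- Étale coordinates on the affine variety `Spec A` over `ℂ`: functions `coord i`, whose
differentials generate the Kähler differentials, and the dual derivations `pd i = ∂/∂(coord i)`. -/
structure EtaleCoords (ι A : Type) [Fintype ι] [DecidableEq ι] [CommRing A] [Algebra ℂ A] where
  coord : ι → A
  pd : ι → Derivation ℂ A A
  pd_coord : ∀ i j, pd i (coord j) = if j = i then 1 else 0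
  D_eq_sum : ∀ f : A, KaehlerDifferential.D ℂ A f =
    ∑ i, pd i f • KaehlerDifferential.D ℂ A (coord i)

namespace EtaleCoords

variable {ι A : Type} [Fintype ι] [DecidableEq ι] [CommRing A] [Algebra ℂ A]

/-- Chain rule for an arbitrary derivation. -/
theorem derivation_apply (c : EtaleCoords ι A) {M : Type} [AddCommGroup M] [Module A M]
    [Module ℂ M] [IsScalarTower ℂ A M] (d : Derivation ℂ A M) (f : A) :
    d f = ∑ i, c.pd i f • d (c.coord i) := by
  have h := congrArg d.liftKaehlerDifferential (c.D_eq_sum f)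
  simpa [map_sum] using h

theorem pd_comm (c : EtaleCoords ι A) (i j : ι) (f : A) :
    c.pd i (c.pd j f) = c.pd j (c.pd i f) := by
  have h := c.derivation_apply ⁅c.pd i, c.pd j⁆ f
  have h0 : ∀ k, ⁅c.pd i, c.pd j⁆ (c.coord k) = 0 := by
    intro k
    rw [Derivation.commutator_apply, c.pd_coord, c.pd_coord]
    split_ifs <;> simp
  simp only [h0, smul_zero, Finset.sum_const_zero] at h
  rw [Derivation.commutator_apply] at h
  exact sub_eq_zero.mp h

/-- The defining relations of the ring of differential operators: functions form a subalgebra,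
`∂ᵢ a = a ∂ᵢ + ∂ᵢ(a)`, and the `∂ᵢ` commute. -/
inductive Rel (c : EtaleCoords ι A) : FreeAlgebra ℂ (A ⊕ ι) → FreeAlgebra ℂ (A ⊕ ι) → Prop
  | add (a b : A) : Rel c (FreeAlgebra.ι ℂ (Sum.inl (a + b)))
      (FreeAlgebra.ι ℂ (Sum.inl a) + FreeAlgebra.ι ℂ (Sum.inl b))
  | mul (a b : A) : Rel c (FreeAlgebra.ι ℂ (Sum.inl (a * b)))
      (FreeAlgebra.ι ℂ (Sum.inl a) * FreeAlgebra.ι ℂ (Sum.inl b))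
  | scalar (r : ℂ) : Rel c (FreeAlgebra.ι ℂ (Sum.inl (algebraMap ℂ A r)))
      (algebraMap ℂ (FreeAlgebra ℂ (A ⊕ ι)) r)
  | leibniz (i : ι) (a : A) :
      Rel c (FreeAlgebra.ι ℂ (Sum.inr i) * FreeAlgebra.ι ℂ (Sum.inl a))
        (FreeAlgebra.ι ℂ (Sum.inl a) * FreeAlgebra.ι ℂ (Sum.inr i)
          + FreeAlgebra.ι ℂ (Sum.inl (c.pd i a)))
  | comm (i j : ι) :
      Rel c (FreeAlgebra.ι ℂ (Sum.inr i) * FreeAlgebra.ι ℂ (Sum.inr j))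
        (FreeAlgebra.ι ℂ (Sum.inr j) * FreeAlgebra.ι ℂ (Sum.inr i))

/-- The ring `A[∂]` of (global) differential operators of `Spec A`: the `ℂ`-algebra generated by
`A` and the `∂ᵢ` with the usual relations. For `A = ℂ[x]` it is the Weyl algebra `ℂ[x, ∂ₓ]`. -/
def DiffOp (c : EtaleCoords ι A) : Type := RingQuot c.Rel

variable (c : EtaleCoords ι A)

instance : Ring c.DiffOp := inferInstanceAs (Ring (RingQuot c.Rel))
instance : Algebra ℂ c.DiffOp := inferInstanceAs (Algebra ℂ (RingQuot c.Rel))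

/-- The quotient map from the free algebra. -/
def proj : FreeAlgebra ℂ (A ⊕ ι) →ₐ[ℂ] c.DiffOp := RingQuot.mkAlgHom ℂ c.Rel

theorem proj_rel {x y : FreeAlgebra ℂ (A ⊕ ι)} (h : c.Rel x y) : c.proj x = c.proj y :=
  RingQuot.mkAlgHom_rel ℂ h

/-- Functions as differential operators of order zero. -/
def fn : A →ₐ[ℂ] c.DiffOp where
  toFun a := c.proj (FreeAlgebra.ι ℂ (Sum.inl a))
  map_one' := by
    have h := c.proj_rel (Rel.scalar 1)
    simpa using h
  map_mul' a b := by simpa using c.proj_rel (Rel.mul a b)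
  map_zero' := by
    have h := c.proj_rel (Rel.scalar 0)
    simpa using h
  map_add' a b := by simpa using c.proj_rel (Rel.add a b)
  commutes' r := by simpa using c.proj_rel (Rel.scalar r)

/-- The operator `∂ᵢ`. -/
def del (i : ι) : c.DiffOp := c.proj (FreeAlgebra.ι ℂ (Sum.inr i))

theorem del_mul_fn (i : ι) (a : A) :
    c.del i * c.fn a = c.fn a * c.del i + c.fn (c.pd i a) := by
  have h := c.proj_rel (Rel.leibniz i a)
  rw [map_mul, map_add, map_mul] at h
  exact h

theorem del_mul_del (i j : ι) : c.del i * c.del j = c.del j * c.del i := by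
  have h := c.proj_rel (Rel.comm i j)
  rw [map_mul, map_mul] at h
  exact h

/-- The universal property of the ring of differential operators. -/
def lift {S : Type} [Ring S] [Algebra ℂ S] (f : A →ₐ[ℂ] S) (g : ι → S)
    (hl : ∀ i a, g i * f a = f a * g i + f (c.pd i a)) (hc : ∀ i j, g i * g j = g j * g i) :
    c.DiffOp →ₐ[ℂ] S :=
  RingQuot.liftAlgHom ℂ (s := c.Rel) ⟨FreeAlgebra.lift ℂ (Sum.elim f g), by
    intro x y h
    induction h with
    | add a b => simp
    | mul a b => simp
    | scalar r => simp [AlgHom.commutes]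
    | leibniz i a => simpa using hl i a
    | comm i j => simpa using hc i j⟩

@[simp] theorem lift_fn {S : Type} [Ring S] [Algebra ℂ S] (f : A →ₐ[ℂ] S) (g : ι → S)
    (hl : ∀ i a, g i * f a = f a * g i + f (c.pd i a)) (hc : ∀ i j, g i * g j = g j * g i) (a : A) :
    c.lift f g hl hc (c.fn a) = f a := by
  have : c.lift f g hl hc (c.proj (FreeAlgebra.ι ℂ (Sum.inl a))) = f a := by
    simp only [lift, proj]
    erw [RingQuot.liftAlgHom_mkAlgHom_apply]
    simp
  exact this

@[simp] theorem lift_del {S : Type} [Ring S] [Algebra ℂ S] (f : A →ₐ[ℂ] S) (g : ι → S)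
    (hl : ∀ i a, g i * f a = f a * g i + f (c.pd i a)) (hc : ∀ i j, g i * g j = g j * g i) (i : ι) :
    c.lift f g hl hc (c.del i) = g i := by
  have : c.lift f g hl hc (c.proj (FreeAlgebra.ι ℂ (Sum.inr i))) = g i := by
    simp only [lift, proj]
    erw [RingQuot.liftAlgHom_mkAlgHom_apply]
    simp
  exact this

theorem hom_ext {S : Type} [Ring S] [Algebra ℂ S] {u v : c.DiffOp →ₐ[ℂ] S}
    (hf : ∀ a, u (c.fn a) = v (c.fn a)) (hd : ∀ i, u (c.del i) = v (c.del i)) : u = v := by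
  apply RingQuot.ringQuot_ext'
  apply FreeAlgebra.hom_ext
  funext x
  rcases x with a | i
  · exact hf a
  · exact hd i

theorem induction {p : c.DiffOp → Prop} (hf : ∀ a, p (c.fn a)) (hd : ∀ i, p (c.del i))
    (ha : ∀ P Q, p P → p Q → p (P + Q)) (hm : ∀ P Q, p P → p Q → p (P * Q)) (P : c.DiffOp) :
    p P := by
  obtain ⟨x, rfl⟩ : ∃ x, c.proj x = P := RingQuot.mkAlgHom_surjective ℂ c.Rel P
  induction x using FreeAlgebra.induction with
  | grade0 r =>
    rw [AlgHom.commutes, ← c.fn.commutes]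
    exact hf _
  | grade1 x =>
    rcases x with a | i
    · exact hf a
    · exact hd i
  | mul x y hx hy => rw [map_mul]; exact hm _ _ hx hy
  | add x y hx hy => rw [map_add]; exact ha _ _ hx hy

/-- The formal adjoint `P ↦ Pᵗ`, the anti-automorphism with `aᵗ = a`, `∂ᵢᵗ = -∂ᵢ`. It describes
the right action of differential operators on top forms in the frame `dy₁ ∧ dy₂ ∧ ⋯` given by the
coordinates, `(f dy) P = (Pᵗ f) dy`. -/
def transpose : c.DiffOp →ₐ[ℂ] (c.DiffOp)ᵐᵒᵖ :=
  c.lift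
    (AlgHom.toOpposite c.fn fun a b => by
      show c.fn a * c.fn b = c.fn b * c.fn a
      rw [← map_mul, ← map_mul, mul_comm])
    (fun i => -op (c.del i))
    (fun i a => by
      apply unop_injective
      simp [c.del_mul_fn])
    (fun i j => by
      apply unop_injective
      simp [c.del_mul_del i j])

/-- Differential operators form a module over the functions by left multiplication. -/
instance : Module A c.DiffOp := Module.compHom c.DiffOp c.fn.toRingHom

theorem smul_def (a : A) (P : c.DiffOp) : a • P = c.fn a * P := rfl

instance : IsScalarTower ℂ A c.DiffOp where
  smul_assoc r a P := by simp [smul_def]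

end EtaleCoords

/-! ## Left `D`-modules as modules with a flat connection -/

section Conn

variable {ι A : Type} [Fintype ι] [DecidableEq ι] [CommRing A] [Algebra ℂ A]

/-- A left `D`-module structure on the `A`-module `M`, given by commuting additive operators
`nabla i` (the action of `∂ᵢ`) satisfying the Leibniz rule. -/
structure FlatConn (c : EtaleCoords ι A) (M : Type) [AddCommGroup M] [Module A M] where
  nabla : ι → M →+ M
  leibniz : ∀ i (a : A) (m : M), nabla i (a • m) = c.pd i a • m + a • nabla i m
  comm : ∀ i j (m : M), nabla i (nabla j m) = nabla j (nabla i m)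

namespace FlatConn

variable {c : EtaleCoords ι A} {M : Type} [AddCommGroup M] [Module A M]

/-- The operator `∂ᵢ` on `M` is `ℂ`-linear. -/
def nablaLin [Module ℂ M] [IsScalarTower ℂ A M] (V : FlatConn c M) (i : ι) : M →ₗ[ℂ] M where
  toFun := V.nabla i
  map_add' := map_add _
  map_smul' r m := by
    have h := V.leibniz i (algebraMap ℂ A r) m
    simpa [algebraMap_smul] using h

/-- The action of the ring of differential operators defined by a flat connection. -/
def rep [Module ℂ M] [IsScalarTower ℂ A M] (V : FlatConn c M) : c.DiffOp →ₐ[ℂ] Module.End ℂ M :=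
  c.lift (Algebra.lsmul ℂ ℂ M) V.nablaLin
    (fun i a => LinearMap.ext fun m => by
      show V.nabla i (a • m) = a • V.nabla i m + c.pd i a • m
      rw [V.leibniz, add_comm])
    (fun i j => LinearMap.ext fun m => V.comm i j m)

theorem rep_fn [Module ℂ M] [IsScalarTower ℂ A M] (V : FlatConn c M) (a : A) (m : M) :
    V.rep (c.fn a) m = a • m := by simp [rep]

theorem rep_del [Module ℂ M] [IsScalarTower ℂ A M] (V : FlatConn c M) (i : ι) (m : M) :
    V.rep (c.del i) m = V.nabla i m := by
  rw [rep, EtaleCoords.lift_del]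
  rfl

/-- The underlying space of a flat connection, as a left module over the differential operators. -/
def Space (_ : FlatConn c M) : Type := M

instance (V : FlatConn c M) : AddCommGroup V.Space := inferInstanceAs (AddCommGroup M)
instance (V : FlatConn c M) [Module ℂ M] : Module ℂ V.Space := inferInstanceAs (Module ℂ M)

instance [Module ℂ M] [IsScalarTower ℂ A M] (V : FlatConn c M) : Module c.DiffOp V.Space :=
  Module.compHom M V.rep.toRingHom

theorem smul_eq [Module ℂ M] [IsScalarTower ℂ A M] (V : FlatConn c M) (P : c.DiffOp)
    (m : V.Space) : P • m = (V.rep P m : M) := rfl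

instance [Module ℂ M] [IsScalarTower ℂ A M] (V : FlatConn c M) :
    IsScalarTower ℂ c.DiffOp V.Space where
  smul_assoc r P m := by
    exact congrArg (fun u : Module.End ℂ M => u m) (map_smul V.rep r P)

instance [Module ℂ M] [IsScalarTower ℂ A M] (V : FlatConn c M) :
    SMulCommClass ℂ c.DiffOp V.Space where
  smul_comm r P m := (map_smul (V.rep P) r m).symm

/-- The corresponding object of the category of left modules over the differential operators. -/
def toModuleCat [Module ℂ M] [IsScalarTower ℂ A M] (V : FlatConn c M) : ModuleCat.{0} c.DiffOp :=
  ModuleCat.of c.DiffOp V.Space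

/-- The structure module `A` with the connection `d + α`, for a closed form `α = ∑ αᵢ dyᵢ`:
`∂ᵢ` acts by `h ↦ ∂h/∂yᵢ + αᵢ h`. -/
def ofForm (c : EtaleCoords ι A) (α : ι → A) (hα : ∀ i j, c.pd i (α j) = c.pd j (α i)) :
    FlatConn c A where
  nabla i := (c.pd i : A →+ A) + AddMonoidHom.mulLeft (α i)
  leibniz i a m := by
    simp [Derivation.leibniz]
    ring
  comm i j m := by
    simp [Derivation.leibniz, c.pd_comm i j m, hα i j]
    ring

/-- The ring of differential operators as a left module over itself. -/
def regular (c : EtaleCoords ι A) : FlatConn c c.DiffOp where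
  nabla i := AddMonoidHom.mulLeft (c.del i)
  leibniz i a P := by
    simp [EtaleCoords.smul_def, ← mul_assoc, c.del_mul_fn, add_mul, add_comm]
  comm i j P := by
    simp [← mul_assoc, c.del_mul_del i j]

/-- Tensor product over the functions of two left `D`-modules, with
`∂ᵢ(m ⊗ m') = ∂ᵢ m ⊗ m' + m ⊗ ∂ᵢ m'`. -/
def tensor {M' : Type} [AddCommGroup M'] [Module A M'] (V : FlatConn c M) (V' : FlatConn c M') :
    FlatConn c (M ⊗[A] M') where
  nabla i := TensorProduct.liftAddHom
    (AddMonoidHom.mk' (fun m => AddMonoidHom.mk' (fun m' => V.nabla i m ⊗ₜ[A] m' +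
        m ⊗ₜ[A] V'.nabla i m') (by
          intro x y
          simp only [map_add, tmul_add]
          abel))
      (by
        intro x y
        ext m'
        simp only [map_add, add_tmul, AddMonoidHom.mk'_apply, AddMonoidHom.add_apply]
        abel))
    (by
      intro a m m'
      simp only [AddMonoidHom.mk'_apply, V.leibniz, V'.leibniz, add_tmul, tmul_add, tmul_smul,
        smul_tmul']
      abel)
  leibniz i a x := by
    induction x with
    | zero => simp
    | add x y hx hy => simp only [smul_add, map_add, hx, hy]; abel
    | tmul m m' =>
      simp only [smul_tmul', liftAddHom_tmul, AddMonoidHom.mk'_apply, V.leibniz, add_tmul,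
        smul_add]
      abel
  comm i j x := by
    induction x with
    | zero => simp
    | add x y hx hy => simp only [map_add, hx, hy]
    | tmul m m' =>
      simp only [liftAddHom_tmul, AddMonoidHom.mk'_apply, map_add, V.comm i j m, V'.comm i j m']
      abel

end FlatConn

/-! ## Inverse images -/

variable {κ B : Type} [Fintype κ] [DecidableEq κ] [CommRing B] [Algebra ℂ B]

/-- The ring `A`, regarded as a `B`-algebra through `φ : B → A`. -/
def Along (_ : B →ₐ[ℂ] A) : Type := A

instance (φ : B →ₐ[ℂ] A) : CommRing (Along φ) := inferInstanceAs (CommRing A)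
instance (φ : B →ₐ[ℂ] A) : Algebra ℂ (Along φ) := inferInstanceAs (Algebra ℂ A)
instance (φ : B →ₐ[ℂ] A) : Algebra A (Along φ) := inferInstanceAs (Algebra A A)
instance (φ : B →ₐ[ℂ] A) : Algebra B (Along φ) := φ.toRingHom.toAlgebra
instance (φ : B →ₐ[ℂ] A) : IsScalarTower ℂ A (Along φ) := inferInstanceAs (IsScalarTower ℂ A A)
instance (φ : B →ₐ[ℂ] A) : IsScalarTower ℂ B (Along φ) :=
  IsScalarTower.of_algebraMap_eq fun r => (φ.commutes r).symm

/-- The carrier `A ⊗_B N` of the inverse image of the `B`-module `N` along `φ : B → A`. -/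
abbrev PullbackCarrier (φ : B →ₐ[ℂ] A) (N : Type) [AddCommGroup N] [Module B N] : Type :=
  Along φ ⊗[B] N

theorem along_smul (φ : B →ₐ[ℂ] A) (b : B) (a : Along φ) : b • a = (show A from φ b * (show A from a)) := rfl

/-- A derivation of `A` as an additive map of `Along φ`. -/
def alongPd (c : EtaleCoords ι A) (φ : B →ₐ[ℂ] A) (i : ι) : Along φ →+ Along φ :=
  (c.pd i : A →+ A)

/-- `∂ᵢ (φ yⱼ)`. -/
def jac (c : EtaleCoords ι A) (e : EtaleCoords κ B) (φ : B →ₐ[ℂ] A) (i : ι) (j : κ) : Along φ :=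
  (c.pd i (φ (e.coord j)) : A)

theorem alongPd_mul (c : EtaleCoords ι A) (φ : B →ₐ[ℂ] A) (i : ι) (a a' : Along φ) :
    alongPd c φ i (a * a') = alongPd c φ i a * a' + a * alongPd c φ i a' := by
  show c.pd i ((show A from a) * (show A from a')) = _
  rw [Derivation.leibniz, add_comm, smul_eq_mul, smul_eq_mul, mul_comm _ (c.pd i _)]
  rfl

theorem alongPd_smul (c : EtaleCoords ι A) (e : EtaleCoords κ B) (φ : B →ₐ[ℂ] A) (i : ι) (b : B)
    (a : Along φ) :
    alongPd c φ i (b • a) = b • alongPd c φ i a + ∑ j, e.pd j b • (a * jac c e φ i j) := by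
  let d : Derivation ℂ B (Along φ) := Derivation.mk'
    ({ toFun := fun b => (c.pd i (φ b) : A)
       map_add' := fun x y => by simp only [map_add]; rfl
       map_smul' := fun r x => by
        rw [map_smul]
        exact (c.pd i).map_smul r (φ x) } : B →ₗ[ℂ] Along φ)
    (fun x y => by
      show c.pd i (φ (x * y)) = φ x * c.pd i (φ y) + φ y * c.pd i (φ x)
      rw [map_mul, Derivation.leibniz, smul_eq_mul, smul_eq_mul])
  have h : d b = ∑ j, e.pd j b • jac c e φ i j := e.derivation_apply d b
  have h' : alongPd c φ i (b • a) = b • alongPd c φ i a + a * d b := by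
    show c.pd i (φ b * (show A from a)) = φ b * c.pd i (show A from a) +
      (show A from a) * c.pd i (φ b)
    rw [Derivation.leibniz, smul_eq_mul, smul_eq_mul]
  rw [h', h, Finset.mul_sum]
  simp only [mul_smul_comm]

/-- The inverse image of a left `D`-module along `φ : B → A`: the `A`-module `A ⊗_B N` with
`∂ᵢ (a ⊗ n) = ∂ᵢ a ⊗ n + ∑ⱼ a ∂ᵢ(φ yⱼ) ⊗ ∂ⱼ n`. -/
def FlatConn.pullback (c : EtaleCoords ι A) {e : EtaleCoords κ B} (φ : B →ₐ[ℂ] A) {N : Type}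
    [AddCommGroup N] [Module B N] (V : FlatConn e N) : FlatConn c (PullbackCarrier φ N) where
  nabla i := TensorProduct.liftAddHom
    (AddMonoidHom.mk' (fun a => AddMonoidHom.mk' (fun n => alongPd c φ i a ⊗ₜ[B] n +
        ∑ j, (a * jac c e φ i j) ⊗ₜ[B] V.nabla j n) (by
          intro x y
          simp only [map_add, tmul_add, Finset.sum_add_distrib]
          abel))
      (by
        intro x y
        ext n
        simp only [map_add, add_tmul, add_mul, Finset.sum_add_distrib, AddMonoidHom.mk'_apply,
          AddMonoidHom.add_apply]
        abel))
    (by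
      intro b a n
      simp only [AddMonoidHom.mk'_apply, V.leibniz, alongPd_smul c e, add_tmul, tmul_add,
        Finset.sum_add_distrib, sum_tmul, tmul_smul, smul_tmul', smul_mul_assoc]
      abel)
  leibniz i a x := by
    induction x using TensorProduct.induction_on with
    | zero => simp
    | add x y hx hy => simp only [smul_add, map_add, hx, hy]; abel
    | tmul m m' =>
      have h : alongPd c φ i (a • m) = c.pd i a • m + a • alongPd c φ i m := by
        show c.pd i (a * (show A from m)) = _
        rw [Derivation.leibniz, add_comm, smul_eq_mul, smul_eq_mul, mul_comm _ (c.pd i a)]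
        rfl
      simp only [smul_tmul', liftAddHom_tmul, AddMonoidHom.mk'_apply, h, add_tmul,
        smul_add, Finset.smul_sum, smul_mul_assoc]
      abel
  comm i k x := by
    induction x using TensorProduct.induction_on with
    | zero => simp
    | add x y hx hy => simp only [map_add, hx, hy]
    | tmul a n =>
      have h1 : alongPd c φ i (alongPd c φ k a) = alongPd c φ k (alongPd c φ i a) :=
        c.pd_comm i k a
      have h2 : ∀ j, alongPd c φ i (jac c e φ k j) = alongPd c φ k (jac c e φ i j) :=
        fun j => c.pd_comm i k _
      have h3 : ∀ j l, a * jac c e φ k j * jac c e φ i l = a * jac c e φ i l * jac c e φ k j :=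
        fun j l => mul_right_comm _ _ _
      simp only [liftAddHom_tmul, AddMonoidHom.mk'_apply, map_add, map_sum, alongPd_mul, add_tmul,
        Finset.sum_add_distrib, h1, h2]
      have h4 : ∑ j, ∑ l, (a * jac c e φ k j * jac c e φ i l) ⊗ₜ[B] V.nabla l (V.nabla j n) =
          ∑ j, ∑ l, (a * jac c e φ i j * jac c e φ k l) ⊗ₜ[B] V.nabla l (V.nabla j n) := by
        rw [Finset.sum_comm]
        simp only [h3, V.comm]
      rw [h4]
      abel

/-! ## Direct images -/

/-- The transfer bimodule `D_{X → Y} = A ⊗_B D_Y` of a morphism `X = Spec A → Y = Spec B`. -/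
abbrev Transfer (e : EtaleCoords κ B) (φ : B →ₐ[ℂ] A) : Type := PullbackCarrier φ e.DiffOp

/-- The left `D_X`-module structure on `D_{X → Y}`: it is the inverse image of `D_Y`. -/
def transferConn (c : EtaleCoords ι A) (e : EtaleCoords κ B) (φ : B →ₐ[ℂ] A) :
    FlatConn c (Transfer e φ) :=
  FlatConn.pullback c φ (FlatConn.regular e)

/-- The right action of `D_Y` on `D_{X → Y}`: `(a ⊗ P) Q = a ⊗ P Q`. -/
def transferRight (e : EtaleCoords κ B) (φ : B →ₐ[ℂ] A) (Q : e.DiffOp) :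
    Transfer e φ →ₗ[B] Transfer e φ :=
  LinearMap.lTensor (Along φ)
    { toFun := fun P => P * Q
      map_add' := fun P P' => add_mul P P' Q
      map_smul' := fun b P => by simp [EtaleCoords.smul_def, mul_assoc] }

@[simp] theorem transferRight_tmul (e : EtaleCoords κ B) (φ : B →ₐ[ℂ] A) (Q : e.DiffOp)
    (a : Along φ) (P : e.DiffOp) : transferRight e φ Q (a ⊗ₜ P) = a ⊗ₜ (P * Q) := rfl

theorem transferRight_comm (c : EtaleCoords ι A) (e : EtaleCoords κ B) (φ : B →ₐ[ℂ] A)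
    (Q : e.DiffOp) (P : c.DiffOp) (x : Transfer e φ) :
    transferRight e φ Q ((transferConn c e φ).rep P x) =
      (transferConn c e φ).rep P (transferRight e φ Q x) := by
  induction P using EtaleCoords.induction generalizing x with
  | hf a =>
    rw [FlatConn.rep_fn, FlatConn.rep_fn]
    induction x using TensorProduct.induction_on with
    | zero => simp
    | add x y hx hy => rw [smul_add, map_add, hx, hy, map_add, smul_add]
    | tmul a' P => rfl
  | hd i =>
    rw [FlatConn.rep_del, FlatConn.rep_del]
    induction x using TensorProduct.induction_on with
    | zero => simp
    | add x y hx hy => rw [map_add, map_add, hx, hy, map_add, map_add]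
    | tmul a' P =>
      simp [transferConn, FlatConn.pullback, FlatConn.regular, mul_assoc]
  | ha P P' hP hP' => simp only [map_add, LinearMap.add_apply, hP, hP']
  | hm P P' hP hP' => simp only [map_mul, Module.End.mul_apply, hP, hP']

/-- The `(D_Y, D_X)`-bimodule `D_{Y ← X} = ω_X ⊗ D_{X → Y} ⊗ ω_Y⁻¹`. The coordinates give frames
`dx₁ ∧ dx₂ ∧ ⋯` of `ω_X` and `dy₁ ∧ dy₂ ∧ ⋯` of `ω_Y`; in these frames the underlying space is
`D_{X → Y}`, and both actions of `D_{X → Y}` change sides through the formal adjoint. -/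
def TransferRev (_ : EtaleCoords ι A) (e : EtaleCoords κ B) (φ : B →ₐ[ℂ] A) : Type :=
  Transfer e φ

section TransferRev

variable (c : EtaleCoords ι A) (e : EtaleCoords κ B) (φ : B →ₐ[ℂ] A)

instance : AddCommGroup (TransferRev c e φ) := inferInstanceAs (AddCommGroup (Transfer e φ))

/-- The right `D_X`-module structure `τ P = Pᵗ τ`. -/
instance : Module (c.DiffOp)ᵐᵒᵖ (TransferRev c e φ) :=
  Module.compHom (Transfer e φ)
    ((transferConn c e φ).rep.toRingHom.comp
      (((RingEquiv.opOp c.DiffOp).symm : (c.DiffOp)ᵐᵒᵖᵐᵒᵖ →+* c.DiffOp).comp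
        (RingHom.op c.transpose.toRingHom)))

theorem op_smul_def (P : c.DiffOp) (τ : TransferRev c e φ) :
    op P • τ = ((transferConn c e φ).rep (c.transpose P).unop τ : Transfer e φ) := rfl

/-- The left `D_Y`-module structure `Q τ = τ Qᵗ`. -/
instance : Module e.DiffOp (TransferRev c e φ) where
  smul Q τ := transferRight e φ (e.transpose Q).unop τ
  one_smul τ := by
    show transferRight e φ (e.transpose 1).unop τ = τ
    induction τ using TensorProduct.induction_on with
    | zero => exact map_zero _
    | add x y hx hy => exact (map_add _ _ _).trans (congrArg₂ _ hx hy)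
    | tmul a P => simp
  mul_smul P Q τ := by
    show transferRight e φ (e.transpose (P * Q)).unop τ =
      transferRight e φ (e.transpose P).unop (transferRight e φ (e.transpose Q).unop τ)
    induction τ using TensorProduct.induction_on with
    | zero => simp
    | add x y hx hy => rw [map_add, hx, hy, map_add, map_add]
    | tmul a P => simp [mul_assoc]
  smul_zero Q := map_zero (transferRight e φ (e.transpose Q).unop)
  smul_add Q := map_add (transferRight e φ (e.transpose Q).unop)
  add_smul P Q τ := by
    show transferRight e φ (e.transpose (P + Q)).unop τ =
      transferRight e φ (e.transpose P).unop τ + transferRight e φ (e.transpose Q).unop τ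
    induction τ using TensorProduct.induction_on with
    | zero => simp
    | add x y hx hy => rw [map_add, hx, hy, map_add, map_add]; abel
    | tmul a P => simp [mul_add, tmul_add]
  zero_smul τ := by
    show transferRight e φ (e.transpose 0).unop τ = 0
    induction τ using TensorProduct.induction_on with
    | zero => simp
    | add x y hx hy => rw [map_add, hx, hy, add_zero]
    | tmul a P => simp

instance : SMulCommClass e.DiffOp (c.DiffOp)ᵐᵒᵖ (TransferRev c e φ) where
  smul_comm Q P τ :=
    transferRight_comm c e φ (e.transpose Q).unop (c.transpose P.unop).unop τ

end TransferRev

end Conn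

/-! ## Tensor products over noncommutative rings, and direct images -/

section NCTensor

variable (R S T : Type) [Ring R] [Ring S] [AddCommGroup T] [Module S T] [Module Rᵐᵒᵖ T]
  [SMulCommClass S Rᵐᵒᵖ T]

/-- The relations `τ r ⊗ m = τ ⊗ r m`; their `S`-span is their additive span as the actions of
`R` and `S` on `T` commute. -/
def ncRel (M : Type) [AddCommGroup M] [Module R M] : Submodule S (T ⊗[ℤ] M) :=
  Submodule.span S {z | ∃ (τ : T) (r : R) (m : M), z = (op r • τ) ⊗ₜ m - τ ⊗ₜ (r • m)}

/-- The tensor product `T ⊗_R M` of an `(S, R)`-bimodule `T` and a left `R`-module `M`, as a left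
`S`-module. -/
abbrev NCTensor (M : Type) [AddCommGroup M] [Module R M] : Type := (T ⊗[ℤ] M) ⧸ ncRel R S T M

/-- The map `T ⊗_R M → T ⊗_R M'` induced by an `R`-linear map `M → M'`. -/
def ncMap {M M' : Type} [AddCommGroup M] [Module R M] [AddCommGroup M'] [Module R M']
    (f : M →ₗ[R] M') : NCTensor R S T M →ₗ[S] NCTensor R S T M' :=
  Submodule.mapQ _ _
    (TensorProduct.AlgebraTensorModule.map (LinearMap.id : T →ₗ[S] T) (f.restrictScalars ℤ)) (by
      rw [ncRel, Submodule.span_le]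
      rintro _ ⟨τ, r, m, rfl⟩
      apply Submodule.subset_span
      exact ⟨τ, r, f m, by simp⟩)

theorem ncMap_mk {M M' : Type} [AddCommGroup M] [Module R M] [AddCommGroup M'] [Module R M']
    (f : M →ₗ[R] M') (x : T ⊗[ℤ] M) : ncMap R S T f (Submodule.Quotient.mk x) =
      Submodule.Quotient.mk (LinearMap.lTensor T (f.restrictScalars ℤ) x) := rfl

theorem ncMap_id (M : Type) [AddCommGroup M] [Module R M] :
    ncMap R S T (LinearMap.id : M →ₗ[R] M) = LinearMap.id := by
  apply LinearMap.ext
  intro x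
  obtain ⟨x, rfl⟩ := Submodule.Quotient.mk_surjective _ x
  rw [ncMap_mk]
  simp

theorem ncMap_comp {M M' M'' : Type} [AddCommGroup M] [Module R M] [AddCommGroup M'] [Module R M']
    [AddCommGroup M''] [Module R M''] (f : M →ₗ[R] M') (g : M' →ₗ[R] M'') :
    ncMap R S T (g ∘ₗ f) = ncMap R S T g ∘ₗ ncMap R S T f := by
  apply LinearMap.ext
  intro x
  obtain ⟨x, rfl⟩ := Submodule.Quotient.mk_surjective _ x
  rw [LinearMap.comp_apply, ncMap_mk, ncMap_mk, ncMap_mk, ← LinearMap.lTensor_comp_apply]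
  rfl

theorem ncMap_add {M M' : Type} [AddCommGroup M] [Module R M] [AddCommGroup M'] [Module R M']
    (f g : M →ₗ[R] M') : ncMap R S T (f + g) = ncMap R S T f + ncMap R S T g := by
  apply LinearMap.ext
  intro x
  obtain ⟨x, rfl⟩ := Submodule.Quotient.mk_surjective _ x
  rw [LinearMap.add_apply, ncMap_mk, ncMap_mk, ncMap_mk, ← Submodule.Quotient.mk_add,
    ← LinearMap.add_apply, ← LinearMap.lTensor_add]
  rfl

/-- The functor `T ⊗_R -` from left `R`-modules to left `S`-modules. -/
def ncTensorFunctor : ModuleCat.{0} R ⥤ ModuleCat.{0} S where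
  obj M := ModuleCat.of S (NCTensor R S T M)
  map f := ModuleCat.ofHom (ncMap R S T f.hom)
  map_id M := by
    apply ModuleCat.hom_ext
    exact ncMap_id R S T M
  map_comp f g := by
    apply ModuleCat.hom_ext
    exact ncMap_comp R S T f.hom g.hom

instance : (ncTensorFunctor R S T).Additive where
  map_add {M M' f g} := by
    apply ModuleCat.hom_ext
    exact ncMap_add R S T f.hom g.hom

/-- The derived tensor product `T ⊗ᴸ_R M` of the `(S, R)`-bimodule `T` and the left `R`-module `M`,
as an object of the derived category of left `S`-modules: it is computed by a projective
resolution of `M`. -/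
def derivedNCTensor [HasDerivedCategory.{w} (ModuleCat.{0} S)] (M : ModuleCat.{0} R) :
    DerivedCategory (ModuleCat.{0} S) :=
  DerivedCategory.Q.obj
    (((ncTensorFunctor R S T).mapHomologicalComplex (ComplexShape.up ℤ)).obj
      (projectiveResolution M).cochainComplex)

end NCTensor

/-- The derived direct image along `Spec A → Spec B` of a left `D`-module, on global sections:
`D_{Y ← X} ⊗ᴸ_{D_X} M`. -/
def derivedDirectImage {ι A κ B : Type} [Fintype ι] [DecidableEq ι] [CommRing A] [Algebra ℂ A]
    [Fintype κ] [DecidableEq κ] [CommRing B] [Algebra ℂ B] (c : EtaleCoords ι A)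
    (e : EtaleCoords κ B) (φ : B →ₐ[ℂ] A) [HasDerivedCategory.{w} (ModuleCat.{0} e.DiffOp)]
    (M : ModuleCat.{0} c.DiffOp) : DerivedCategory (ModuleCat.{0} e.DiffOp) :=
  derivedNCTensor c.DiffOp e.DiffOp (TransferRev c e φ) M

/-! ## Affine space and the torus -/

theorem derivation_sum_apply {A M κ : Type} [CommRing A] [Algebra ℂ A] [AddCommGroup M]
    [Module A M] [Module ℂ M] (s : Finset κ) (d : κ → Derivation ℂ A M) (f : A) :
    (∑ i ∈ s, d i) f = ∑ i ∈ s, d i f := by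
  have h := congrFun (map_sum (Derivation.coeFnAddMonoidHom (R := ℂ) (A := A) (M := M)) d s) f
  rw [Finset.sum_apply] at h
  exact h

/-- The coordinate ring `ℂ[x₁, …, x_N]` of affine space. -/
abbrev Poly (N : ℕ) : Type := MvPolynomial (Fin N) ℂ

/-- The standard coordinates on affine space. -/
def polyCoords (N : ℕ) : EtaleCoords (Fin N) (Poly N) where
  coord := MvPolynomial.X
  pd := MvPolynomial.pderiv
  pd_coord i j := by
    rw [MvPolynomial.pderiv_X, Pi.single_apply]
  D_eq_sum f := by
    have h : KaehlerDifferential.D ℂ (Poly N) = ∑ i : Fin N,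
        (LinearMap.toSpanSingleton (Poly N) _
          (KaehlerDifferential.D ℂ (Poly N) (MvPolynomial.X i))).compDer
          (MvPolynomial.pderiv i) := by
      apply MvPolynomial.derivation_ext
      intro j
      rw [derivation_sum_apply, Finset.sum_eq_single j]
      · simp
      · intro i _ hij
        simp [MvPolynomial.pderiv_X_of_ne hij.symm]
      · simp
    conv_lhs => rw [h]
    rw [derivation_sum_apply]
    simp

/-- The Weyl algebra `ℂ[x₁, …, x_N, ∂_{x₁}, …, ∂_{x_N}]`. -/
abbrev Weyl (N : ℕ) : Type := (polyCoords N).DiffOp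

section Laurent

variable (n : ℕ) (R : Type) [CommRing R]

/-- The Laurent polynomial ring `R[t₁^{±1}, …, t_n^{±1}]`. -/
abbrev Laurent : Type := AddMonoidAlgebra R (Fin n → ℤ)

variable {n R}

/-- The Laurent monomial `t^k`. -/
def mono (k : Fin n → ℤ) : Laurent n R := AddMonoidAlgebra.single k 1

theorem mono_mul (k l : Fin n → ℤ) : (mono k * mono l : Laurent n R) = mono (k + l) := by
  simp [mono, AddMonoidAlgebra.single_mul_single]

theorem mono_zero : (mono 0 : Laurent n R) = 1 := rfl

theorem single_eq (k : Fin n → ℤ) (r : R) :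
    (AddMonoidAlgebra.single k r : Laurent n R) = algebraMap R _ r * mono k := by
  simp [mono, AddMonoidAlgebra.single_mul_single]

/-- The exponent vector of `tᵢ`. -/
abbrev unitVec (i : Fin n) : Fin n → ℤ := Pi.single i 1

theorem laurent_ext {M : Type} [AddCommGroup M] {f g : Laurent n R →+ M}
    (h : ∀ k r, f (AddMonoidAlgebra.single k r) = g (AddMonoidAlgebra.single k r)) : f = g := by
  refine AddMonoidHom.ext fun x => ?_
  induction x using AddMonoidAlgebra.induction_linear with
  | zero => simp
  | add x y hx hy => rw [map_add, map_add, hx, hy]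
  | single k r => exact h k r

theorem leibniz_of_single {f : Laurent n R →+ Laurent n R}
    (h : ∀ k l r s, f (AddMonoidAlgebra.single k r * AddMonoidAlgebra.single l s) =
      AddMonoidAlgebra.single k r * f (AddMonoidAlgebra.single l s) +
        AddMonoidAlgebra.single l s * f (AddMonoidAlgebra.single k r)) (x y : Laurent n R) :
    f (x * y) = x * f y + y * f x := by
  induction x using AddMonoidAlgebra.induction_linear with
  | zero => simp
  | add x x' hx hx' => rw [add_mul, map_add, map_add, hx, hx']; ring
  | single k r =>
    induction y using AddMonoidAlgebra.induction_linear with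
    | zero => simp
    | add y y' hy hy' => rw [mul_add, map_add, map_add, hy, hy']; ring
    | single l s => exact h k l r s

variable (R) in
/-- The linear map underlying `∂/∂tᵢ`. -/
def pdTLin (i : Fin n) : Laurent n R →ₗ[R] Laurent n R :=
  (Finsupp.lsum R fun k => (k i) • (LinearMap.toSpanSingleton R (Laurent n R)
    (mono (k - unitVec i)))) ∘ₗ (AddMonoidAlgebra.coeffLinearEquiv R).toLinearMap

theorem pdTLin_single (i : Fin n) (k : Fin n → ℤ) (r : R) :
    pdTLin R i (AddMonoidAlgebra.single k r) =
      AddMonoidAlgebra.single (k - unitVec i) ((k i : R) * r) := by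
  simp [pdTLin, mono, ← zsmul_eq_mul]

variable (R) in
/-- The derivation `∂/∂tᵢ` of `R[t^{±1}]`, with `∂ (r t^k)/∂tᵢ = kᵢ r t^k / tᵢ`. -/
def pdT (i : Fin n) : Derivation R (Laurent n R) (Laurent n R) := Derivation.mk' (pdTLin R i)
  (leibniz_of_single (f := (pdTLin R i).toAddMonoidHom) (by
    intro k l r s
    simp only [AddMonoidAlgebra.single_mul_single, LinearMap.toAddMonoidHom_coe, pdTLin_single]
    have h1 : k + (l - unitVec i) = k + l - unitVec i := by abel
    have h2 : l + (k - unitVec i) = k + l - unitVec i := by abel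
    rw [h1, h2, ← AddMonoidAlgebra.single_add]
    congr 1
    push_cast [Pi.add_apply]
    ring))

theorem pdT_single (i : Fin n) (k : Fin n → ℤ) (r : R) :
    pdT R i (AddMonoidAlgebra.single k r) =
      AddMonoidAlgebra.single (k - unitVec i) ((k i : R) * r) := pdTLin_single i k r

/-- The linear map underlying `coeffDer`. -/
def coeffDerLin [Algebra ℂ R] (d : Derivation ℂ R R) : Laurent n R →ₗ[ℂ] Laurent n R :=
  (AddMonoidAlgebra.coeffLinearEquiv ℂ).symm.toLinearMap ∘ₗ
    Finsupp.mapRange.linearMap (d : R →ₗ[ℂ] R) ∘ₗ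
    (AddMonoidAlgebra.coeffLinearEquiv ℂ).toLinearMap

theorem coeffDerLin_single [Algebra ℂ R] (d : Derivation ℂ R R) (k : Fin n → ℤ) (r : R) :
    coeffDerLin d (AddMonoidAlgebra.single k r) = AddMonoidAlgebra.single k (d r) := by
  simp [coeffDerLin]

/-- A derivation of `R`, extended to `R[t^{±1}]` coefficient by coefficient. -/
def coeffDer [Algebra ℂ R] (d : Derivation ℂ R R) : Derivation ℂ (Laurent n R) (Laurent n R) :=
  Derivation.mk' (coeffDerLin d)
    (leibniz_of_single (f := (coeffDerLin d).toAddMonoidHom) (by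
      intro k l r s
      simp only [AddMonoidAlgebra.single_mul_single, LinearMap.toAddMonoidHom_coe,
        coeffDerLin_single]
      rw [add_comm l, ← AddMonoidAlgebra.single_add, Derivation.leibniz]
      rfl))

theorem coeffDer_single [Algebra ℂ R] (d : Derivation ℂ R R) (k : Fin n → ℤ) (r : R) :
    coeffDer d (AddMonoidAlgebra.single k r) = AddMonoidAlgebra.single k (d r) :=
  coeffDerLin_single d k r

/-- A derivation sends `t^k` to `∑ᵢ kᵢ t^k / tᵢ` times its value at `tᵢ`. -/
theorem derivation_mono [Algebra ℂ R] {M : Type} [AddCommGroup M] [Module (Laurent n R) M]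
    [Module ℂ M] (d : Derivation ℂ (Laurent n R) M) (k : Fin n → ℤ) :
    d (mono k) = ∑ i, k i • (mono (k - unitVec i) : Laurent n R) • d (mono (unitVec i)) := by
  have hunit : ∀ k : Fin n → ℤ, (mono (-k) * mono k : Laurent n R) = 1 := fun k => by
    rw [mono_mul, neg_add_cancel, mono_zero]
  let f : (Fin n → ℤ) →+ M := AddMonoidHom.mk' (fun k => (mono (-k) : Laurent n R) • d (mono k))
    (by
      intro k l
      have h1 : (mono (-(k + l)) * mono k : Laurent n R) = mono (-l) := by
        rw [mono_mul]
        congr 1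
        abel
      have h2 : (mono (-(k + l)) * mono l : Laurent n R) = mono (-k) := by
        rw [mono_mul]
        congr 1
        abel
      rw [← mono_mul k l, Derivation.leibniz, smul_add, smul_smul, smul_smul, h1, h2, add_comm])
  have hk : k = ∑ i, k i • unitVec i := by
    ext j
    simp [Finset.sum_apply, Pi.single_apply]
  have h : (mono (-k) : Laurent n R) • d (mono k) = f k := rfl
  have h2 : f k = ∑ i, k i • (mono (-unitVec i) : Laurent n R) • d (mono (unitVec i)) := by
    conv_lhs => rw [hk, map_sum]
    simp only [map_zsmul]
    rfl
  have h3 : d (mono k) = (mono k : Laurent n R) • f k := by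
    rw [← h, smul_smul, mul_comm, hunit, one_smul]
  rw [h3, h2, Finset.smul_sum]
  refine Finset.sum_congr rfl fun i _ => ?_
  rw [smul_comm, smul_smul, mono_mul, sub_eq_add_neg]

theorem pdT_coord (i j : Fin n) :
    pdT R i (mono (unitVec j)) = if j = i then 1 else 0 := by
  rw [mono, pdT_single]
  split_ifs with h
  · subst h
    simp [← AddMonoidAlgebra.one_def]
  · simp [Ne.symm h]

theorem pdT_single_smul (i : Fin n) (k : Fin n → ℤ) (r : R) :
    pdT R i (AddMonoidAlgebra.single k r) =
      k i • (algebraMap R (Laurent n R) r * mono (k - unitVec i)) := by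
  rw [pdT_single, ← single_eq, ← zsmul_eq_mul, AddMonoidAlgebra.smul_single]

/-- The coordinates `t₁, …, t_n` on the torus. -/
def torusCoords (n : ℕ) : EtaleCoords (Fin n) (Laurent n ℂ) where
  coord i := mono (unitVec i)
  pd i := pdT ℂ i
  pd_coord i j := by
    exact pdT_coord i j
  D_eq_sum f := by
    induction f using AddMonoidAlgebra.induction_linear with
    | zero => simp
    | add x y hx hy => simp only [map_add, add_smul, Finset.sum_add_distrib, hx, hy]
    | single k r =>
      rw [single_eq, Derivation.leibniz, Derivation.map_algebraMap, smul_zero, add_zero,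
        derivation_mono, Finset.smul_sum]
      refine Finset.sum_congr rfl fun i _ => ?_
      rw [← single_eq, pdT_single_smul, smul_assoc, mul_smul, smul_comm]

/-- The coordinates `t₁, …, t_n` and `y_j` on the product of the torus and a variety with
coordinates `y_j`. -/
def torusProdCoords (n : ℕ) {κ B : Type} [Fintype κ] [DecidableEq κ] [CommRing B] [Algebra ℂ B]
    (e : EtaleCoords κ B) : EtaleCoords (Fin n ⊕ κ) (Laurent n B) where
  coord := Sum.elim (fun i => mono (unitVec i)) (fun j => algebraMap B (Laurent n B) (e.coord j))
  pd := Sum.elim (fun i => (pdT B i).restrictScalars ℂ) (fun j => coeffDer (e.pd j))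
  pd_coord := by
    rintro (i | i) (j | j)
    · simpa using pdT_coord i j
    · show pdT B i (algebraMap B (Laurent n B) (e.coord j)) = _
      rw [Derivation.map_algebraMap]
      simp
    · show coeffDer (e.pd i) (AddMonoidAlgebra.single _ 1) = _
      rw [coeffDer_single]
      simp
    · show coeffDer (e.pd i) (AddMonoidAlgebra.single 0 (e.coord j)) = _
      rw [coeffDer_single, e.pd_coord]
      simp only [Sum.inr.injEq]
      split_ifs
      · rfl
      · simp
  D_eq_sum f := by
    induction f using AddMonoidAlgebra.induction_linear with
    | zero => simp
    | add x y hx hy => simp only [map_add, add_smul, Finset.sum_add_distrib, hx, hy]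
    | single k r =>
      have h := e.derivation_apply ((KaehlerDifferential.D ℂ (Laurent n B)).compAlgebraMap B) r
      simp only [Derivation.compAlgebraMap_apply] at h
      rw [Fintype.sum_sum_type]
      conv_lhs => rw [single_eq, Derivation.leibniz, h, derivation_mono, Finset.smul_sum,
        Finset.smul_sum]
      congr 1
      · refine Finset.sum_congr rfl fun i _ => ?_
        simp only [Sum.elim_inl, Derivation.restrictScalars_apply]
        rw [pdT_single_smul, smul_assoc, mul_smul, smul_comm]
      · refine Finset.sum_congr rfl fun i _ => ?_
        simp only [Sum.elim_inr]
        rw [coeffDer_single, single_eq, mul_comm, mul_smul, algebraMap_smul]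

end Laurent

/-! ## The hypergeometric module -/

section Hyp

variable {n N : ℕ}

/-- The coordinate ring `ℂ[t^{±1}, x]` of `𝔾_mⁿ × 𝔸^N`. -/
abbrev TotalRing (n N : ℕ) : Type := Laurent n (Poly N)

/-- The coordinates `t₁, …, t_n, x₁, …, x_N` on `𝔾_mⁿ × 𝔸^N`. -/
abbrev totalCoords (n N : ℕ) : EtaleCoords (Fin n ⊕ Fin N) (TotalRing n N) :=
  torusProdCoords n (polyCoords N)

/-- The comorphism of the projection `π₁ : 𝔾_mⁿ × 𝔸^N → 𝔾_mⁿ`. -/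
def proj₁ (n N : ℕ) : Laurent n ℂ →ₐ[ℂ] TotalRing n N :=
  AddMonoidAlgebra.mapAlgHom (Fin n → ℤ) (Algebra.ofId ℂ (Poly N))

/-- The comorphism of the projection `π₂ : 𝔾_mⁿ × 𝔸^N → 𝔸^N`. -/
def proj₂ (n N : ℕ) : Poly N →ₐ[ℂ] TotalRing n N := IsScalarTower.toAlgHom ℂ _ _

/-- The monomial `t^{w_j} = ∏ᵢ tᵢ^{w_{ij}}` of the `j`-th column of `w`. -/
def colMono (w : Matrix (Fin n) (Fin N) ℤ) (j : Fin N) : TotalRing n N := mono fun i => w i j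

/-- The coordinate `x_j`, as a function on `𝔾_mⁿ × 𝔸^N`. -/
def xVar (n : ℕ) {N : ℕ} (j : Fin N) : TotalRing n N :=
  algebraMap (Poly N) (TotalRing n N) (MvPolynomial.X j)

/-- The function `F = ∑_j x_j t^{w_j}`. -/
def expF (w : Matrix (Fin n) (Fin N) ℤ) : TotalRing n N := ∑ j, xVar n j * colMono w j

/-- The comorphism of the morphism `F : 𝔾_mⁿ × 𝔸^N → 𝔸¹`. -/
def comapF (w : Matrix (Fin n) (Fin N) ℤ) : Poly 1 →ₐ[ℂ] TotalRing n N :=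
  MvPolynomial.aeval fun _ => expF w

/-- The `D`-module `K_γ = ℂ[t^{±1}] t^γ` on the torus: `∂_{tᵢ} g = ∂g/∂tᵢ + (γᵢ / tᵢ) g`. -/
def kummer (γ : Fin n → ℂ) : FlatConn (torusCoords n) (Laurent n ℂ) :=
  FlatConn.ofForm (torusCoords n) (fun i => γ i • mono (-unitVec i)) (by
    intro i j
    show pdT ℂ i (γ j • mono (-unitVec j)) = pdT ℂ j (γ i • mono (-unitVec i))
    rcases eq_or_ne i j with rfl | h
    · rfl
    · rw [Derivation.map_smul, Derivation.map_smul, mono, mono, pdT_single, pdT_single]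
      simp [h, h.symm])

/-- The `D`-module `L = ℂ[z] e^z` on the affine line: `∂_z f = ∂f/∂z + f`. -/
def expModule : FlatConn (polyCoords 1) (Poly 1) :=
  FlatConn.ofForm (polyCoords 1) (fun _ => 1) (by simp)

/-- The `D`-module `π₁^* K_γ ⊗ F^* L` on `𝔾_mⁿ × 𝔸^N`. -/
def gkzConn (w : Matrix (Fin n) (Fin N) ℤ) (γ : Fin n → ℂ) :
    FlatConn (totalCoords n N)
      (PullbackCarrier (proj₁ n N) (Laurent n ℂ) ⊗[TotalRing n N]
        PullbackCarrier (comapF w) (Poly 1)) :=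
  ((kummer γ).pullback (totalCoords n N) (proj₁ n N)).tensor
    (expModule.pullback (totalCoords n N) (comapF w))

/-- The global sections of the hypergeometric `D`-module `Hyp_γ = Rπ₂₊(π₁^* K_γ ⊗ F^* L)`, an
object of the derived category of left modules over the Weyl algebra. -/
def hyp [HasDerivedCategory.{w} (ModuleCat.{0} (Weyl N))] (w : Matrix (Fin n) (Fin N) ℤ)
    (γ : Fin n → ℂ) : DerivedCategory (ModuleCat.{0} (Weyl N)) :=
  derivedDirectImage (totalCoords n N) (polyCoords N) (proj₂ n N) (gkzConn w γ).toModuleCat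

/-! ## The twisted relative de Rham complex -/

/-- The derivation `∂/∂x_j` of `ℂ[t^{±1}, x]`. -/
def xDer (n : ℕ) {N : ℕ} (j : Fin N) : Derivation ℂ (TotalRing n N) (TotalRing n N) :=
  coeffDer (MvPolynomial.pderiv j)

theorem xDer_algebraMap (j : Fin N) (b : Poly N) :
    xDer n j (algebraMap (Poly N) (TotalRing n N) b) =
      algebraMap (Poly N) (TotalRing n N) (MvPolynomial.pderiv j b) := coeffDer_single _ _ _

theorem xDer_mono (j : Fin N) (k : Fin n → ℤ) : xDer n j (mono k : TotalRing n N) = 0 := by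
  rw [xDer, mono, coeffDer_single]
  simp

theorem xDer_xVar (j k : Fin N) : xDer n j (xVar n k) = if k = j then 1 else 0 := by
  rw [xVar, xDer_algebraMap, MvPolynomial.pderiv_X, Pi.single_apply]
  split_ifs
  · exact map_one _
  · exact map_zero _

theorem xDer_comm (j k : Fin N) (h : TotalRing n N) :
    xDer n j (xDer n k h) = xDer n k (xDer n j h) :=
  (totalCoords n N).pd_comm (Sum.inr j) (Sum.inr k) h

theorem xDer_pdT (j : Fin N) (i : Fin n) (h : TotalRing n N) :
    xDer n j (pdT (Poly N) i h) = pdT (Poly N) i (xDer n j h) :=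
  (totalCoords n N).pd_comm (Sum.inr j) (Sum.inl i) h

theorem pdT_xVar (i : Fin n) (j : Fin N) : pdT (Poly N) i (xVar n j) = 0 :=
  Derivation.map_algebraMap _ _

theorem mono_pdT_mono (i : Fin n) (k : Fin n → ℤ) :
    mono (unitVec i) * pdT (Poly N) i (mono k) = k i • (mono k : TotalRing n N) := by
  have h : pdT (Poly N) i (mono k) = k i • (mono (k - unitVec i) : TotalRing n N) := by
    rw [mono, pdT_single_smul, map_one, one_mul]
  rw [h, mul_smul_comm, mono_mul, add_sub_cancel]

/-- The derivation `tᵢ ∂/∂tᵢ`. -/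
def theta (N : ℕ) (i : Fin n) : Derivation (Poly N) (TotalRing n N) (TotalRing n N) :=
  (mono (unitVec i) : TotalRing n N) • pdT (Poly N) i

theorem theta_apply (i : Fin n) (h : TotalRing n N) :
    theta N i h = mono (unitVec i) * pdT (Poly N) i h := rfl

theorem theta_mono (i : Fin n) (k : Fin n → ℤ) :
    theta N i (mono k) = k i • (mono k : TotalRing n N) := mono_pdT_mono i k

theorem theta_comm (i k : Fin n) (h : TotalRing n N) :
    theta N i (theta N k h) = theta N k (theta N i h) := by
  induction h using AddMonoidAlgebra.induction_linear with
  | zero => simp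
  | add x y hx hy => simp only [map_add, hx, hy]
  | single l r =>
    rw [single_eq, ← Algebra.smul_def]
    simp only [Derivation.map_smul, theta_mono, map_zsmul]
    rw [smul_comm (l k)]

theorem xDer_theta (j : Fin N) (i : Fin n) (h : TotalRing n N) :
    xDer n j (theta N i h) = theta N i (xDer n j h) := by
  rw [theta_apply, theta_apply, Derivation.leibniz, xDer_mono, xDer_pdT, smul_eq_mul, smul_zero,
    add_zero]

/-- The left module over the Weyl algebra `ℂ[x, ∂ₓ]` with underlying space `ℂ[t^{±1}, x]`, on which
`∂_{x_j}` acts by `t^{-γ} e^{-F} ∘ ∂/∂x_j ∘ t^γ e^F`, that is `h ↦ ∂h/∂x_j + t^{w_j} h`. -/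
def coeffConn (w : Matrix (Fin n) (Fin N) ℤ) : FlatConn (polyCoords N) (TotalRing n N) where
  nabla j := (xDer n j : TotalRing n N →+ TotalRing n N) +
    AddMonoidHom.mulLeft (colMono w j)
  leibniz j b h := by
    simp only [AddMonoidHom.add_apply, AddMonoidHom.coe_mulLeft, AddMonoidHom.coe_coe]
    rw [Algebra.smul_def, Algebra.smul_def, Algebra.smul_def, Derivation.leibniz, xDer_algebraMap,
      smul_eq_mul, smul_eq_mul]
    show _ = algebraMap (Poly N) (TotalRing n N) (MvPolynomial.pderiv j b) * h + _
    ring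
  comm j k h := by
    simp only [AddMonoidHom.add_apply, AddMonoidHom.coe_mulLeft, AddMonoidHom.coe_coe, map_add,
      Derivation.leibniz, colMono, xDer_mono, smul_eq_mul, xDer_comm j k h]
    ring

/-- The operator `t^{-γ} e^{-F} ∘ tᵢ ∂/∂tᵢ ∘ t^γ e^F` on `ℂ[t^{±1}, x]`, that is
`h ↦ tᵢ ∂h/∂tᵢ + γᵢ h + ∑_j x_j w_{ij} t^{w_j} h`. -/
def logOp (w : Matrix (Fin n) (Fin N) ℤ) (γ : Fin n → ℂ) (i : Fin n) :
    TotalRing n N →ₗ[ℂ] TotalRing n N where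
  toFun h := mono (unitVec i) * pdT (Poly N) i h + γ i • h +
    (∑ j, w i j • (xVar n j * colMono w j)) * h
  map_add' h h' := by
    simp only [map_add, smul_add, mul_add]
    abel
  map_smul' r h := by
    rw [← algebraMap_smul (Poly N) r h, Derivation.map_smul, algebraMap_smul, algebraMap_smul,
      smul_comm (γ i) r h]
    simp only [smul_add, mul_smul_comm, RingHom.id_apply]

/-- The multiplication part of `logOp`. -/
def logMul (w : Matrix (Fin n) (Fin N) ℤ) (γ : Fin n → ℂ) (i : Fin n) : TotalRing n N :=
  algebraMap (Poly N) (TotalRing n N) (algebraMap ℂ (Poly N) (γ i)) +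
    ∑ j, w i j • (xVar n j * colMono w j)

theorem logOp_eq (w : Matrix (Fin n) (Fin N) ℤ) (γ : Fin n → ℂ) (i : Fin n)
    (h : TotalRing n N) : logOp w γ i h = theta N i h + logMul w γ i * h := by
  have h1 : γ i • h = algebraMap (Poly N) (TotalRing n N) (algebraMap ℂ (Poly N) (γ i)) * h := by
    rw [← Algebra.smul_def, algebraMap_smul]
  rw [logMul, add_mul, ← h1, ← add_assoc]
  rfl

theorem theta_term (w : Matrix (Fin n) (Fin N) ℤ) (i : Fin n) (j : Fin N) :
    theta N i (xVar n j * colMono w j) = w i j • (xVar n j * colMono w j) := by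
  rw [xVar, ← Algebra.smul_def, Derivation.map_smul, colMono, theta_mono, smul_comm]

theorem theta_logMul (w : Matrix (Fin n) (Fin N) ℤ) (γ : Fin n → ℂ) (i k : Fin n) :
    theta N i (logMul w γ k) = theta N k (logMul w γ i) := by
  simp only [logMul, map_add, Derivation.map_algebraMap, map_sum, map_zsmul, theta_term]
  congr 1
  exact Finset.sum_congr rfl fun j _ => smul_comm _ _ _

theorem xDer_logMul (w : Matrix (Fin n) (Fin N) ℤ) (γ : Fin n → ℂ) (i : Fin n) (j : Fin N) :
    xDer n j (logMul w γ i) = w i j • colMono w j := by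
  have h0 : xDer n j (algebraMap (Poly N) (TotalRing n N) (algebraMap ℂ (Poly N) (γ i))) = 0 := by
    rw [xDer_algebraMap, Derivation.map_algebraMap, map_zero]
  rw [logMul, map_add, h0, zero_add, map_sum, Finset.sum_eq_single j]
  · rw [map_zsmul, Derivation.leibniz, xDer_xVar, colMono, xDer_mono]
    simp
  · intro k _ hk
    rw [map_zsmul, Derivation.leibniz, xDer_xVar, colMono, xDer_mono]
    simp [hk]
  · simp

theorem logOp_comm (w : Matrix (Fin n) (Fin N) ℤ) (γ : Fin n → ℂ) (i k : Fin n)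
    (h : TotalRing n N) : logOp w γ i (logOp w γ k h) = logOp w γ k (logOp w γ i h) := by
  simp only [logOp_eq, map_add, Derivation.leibniz, smul_eq_mul, theta_comm i k h,
    theta_logMul w γ i k]
  ring

theorem logOp_smul (w : Matrix (Fin n) (Fin N) ℤ) (γ : Fin n → ℂ) (i : Fin n) (P : Weyl N)
    (h : TotalRing n N) : logOp w γ i ((coeffConn w).rep P h) =
      (coeffConn w).rep P (logOp w γ i h) := by
  induction P using EtaleCoords.induction generalizing h with
  | hf b =>
    rw [FlatConn.rep_fn, FlatConn.rep_fn, logOp_eq, logOp_eq, Derivation.map_smul, smul_add,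
      mul_smul_comm]
  | hd j =>
    rw [FlatConn.rep_del, FlatConn.rep_del]
    show logOp w γ i (xDer n j h + colMono w j * h) =
      xDer n j (logOp w γ i h) + colMono w j * logOp w γ i h
    have h1 : theta N i (colMono w j) = w i j • colMono w j := theta_mono _ _
    simp only [logOp_eq, map_add, Derivation.leibniz, smul_eq_mul, xDer_theta, xDer_logMul, h1]
    ring
  | ha P P' hP hP' => simp only [map_add, LinearMap.add_apply, hP, hP']
  | hm P P' hP hP' => simp only [map_mul, Module.End.mul_apply, hP, hP']

/-- The operator `logOp`, which commutes with the action of the Weyl algebra. -/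
def logOpLin (w : Matrix (Fin n) (Fin N) ℤ) (γ : Fin n → ℂ) (i : Fin n) :
    (coeffConn (n := n) w).Space →ₗ[Weyl N] (coeffConn (n := n) w).Space where
  toFun := logOp w γ i
  map_add' := map_add (logOp w γ i)
  map_smul' := logOp_smul w γ i

/-- Exterior multiplication by the `i`-th basis vector, which stands for `dtᵢ / tᵢ`. -/
def wedge (n : ℕ) (i : Fin n) (q : ℕ) :
    ⋀[ℂ]^q (Fin n → ℂ) →ₗ[ℂ] ⋀[ℂ]^(q + 1) (Fin n → ℂ) :=
  (LinearMap.mulLeft ℂ (ExteriorAlgebra.ι ℂ (Pi.single i (1 : ℂ)))).restrict (fun x hx => by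
    rw [ExteriorAlgebra.exteriorPower, pow_succ']
    exact Submodule.mul_mem_mul (LinearMap.mem_range_self _ _) hx)

theorem wedge_wedge (n : ℕ) (i k : Fin n) (q : ℕ) (ω : ⋀[ℂ]^q (Fin n → ℂ)) :
    wedge n i (q + 1) (wedge n k q ω) = -wedge n k (q + 1) (wedge n i q ω) := by
  apply Subtype.ext
  show ExteriorAlgebra.ι ℂ (Pi.single i (1 : ℂ)) * (ExteriorAlgebra.ι ℂ (Pi.single k (1 : ℂ)) *
      (ω : ExteriorAlgebra ℂ (Fin n → ℂ))) =
    -(ExteriorAlgebra.ι ℂ (Pi.single k (1 : ℂ)) * (ExteriorAlgebra.ι ℂ (Pi.single i (1 : ℂ)) *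
      (ω : ExteriorAlgebra ℂ (Fin n → ℂ))))
  rw [← mul_assoc, ← mul_assoc, ← neg_mul]
  congr 1
  exact eq_neg_of_add_eq_zero_left (ExteriorAlgebra.ι_add_mul_swap _ _)

/-- The space `D^q = ⨁ ℂ[t^{±1}, x] (dt_{i₁}/t_{i₁}) ∧ ⋯ ∧ (dt_{i_q}/t_{i_q})` of relative
differential forms, as `ℂ[t^{±1}, x] ⊗ ⋀^q ℂⁿ`. -/
abbrev Forms (n : ℕ) {N : ℕ} (w : Matrix (Fin n) (Fin N) ℤ) (q : ℕ) : Type :=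
  (coeffConn (n := n) w).Space ⊗[ℂ] ⋀[ℂ]^q (Fin n → ℂ)

/-- The differential `t^{-γ} e^{-F} ∘ d_t ∘ t^γ e^F`:
`d (h ω) = ∑ᵢ (tᵢ ∂h/∂tᵢ + γᵢ h + ∑_j x_j w_{ij} t^{w_j} h) (dtᵢ / tᵢ) ∧ ω`. -/
def twistedD (w : Matrix (Fin n) (Fin N) ℤ) (γ : Fin n → ℂ) (q : ℕ) :
    Forms n w q →ₗ[Weyl N] Forms n w (q + 1) :=
  ∑ i, TensorProduct.AlgebraTensorModule.map (logOpLin w γ i) (wedge n i q)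

theorem twistedD_comp (w : Matrix (Fin n) (Fin N) ℤ) (γ : Fin n → ℂ) (q : ℕ) :
    twistedD w γ (q + 1) ∘ₗ twistedD w γ q = 0 := by
  have key : ∀ x : Forms n w q, twistedD w γ (q + 1) (twistedD w γ q x) = 0 := by
    intro x
    induction x using TensorProduct.induction_on with
    | zero => rw [map_zero, map_zero]
    | add x y hx hy => rw [map_add, map_add, hx, hy, add_zero]
    | tmul h ω =>
      have h1 : ∀ i k, logOpLin w γ i (logOpLin w γ k h) = logOpLin w γ k (logOpLin w γ i h) :=
        fun i k => logOp_comm w γ i k h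
      have h2 : twistedD w γ (q + 1) (twistedD w γ q (h ⊗ₜ ω)) =
          ∑ i, ∑ k, logOpLin w γ i (logOpLin w γ k h) ⊗ₜ wedge n i (q + 1) (wedge n k q ω) := by
        simp only [twistedD, LinearMap.sum_apply, map_sum,
          TensorProduct.AlgebraTensorModule.map_tmul]
        rw [Finset.sum_comm]
      have h3 : twistedD w γ (q + 1) (twistedD w γ q (h ⊗ₜ ω)) =
          -twistedD w γ (q + 1) (twistedD w γ q (h ⊗ₜ ω)) := by
        conv_lhs => rw [h2, Finset.sum_comm]
        rw [h2, ← Finset.sum_neg_distrib]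
        refine Finset.sum_congr rfl fun i _ => ?_
        rw [← Finset.sum_neg_distrib]
        refine Finset.sum_congr rfl fun k _ => ?_
        rw [h1 k i, wedge_wedge, tmul_neg]
      have h4 : (2 : ℂ) • twistedD w γ (q + 1) (twistedD w γ q (h ⊗ₜ ω)) = 0 := by
        rw [two_smul]
        nth_rewrite 1 [h3]
        exact neg_add_cancel _
      have h5 := congrArg (fun y => (2 : ℂ)⁻¹ • y) h4
      simpa only [smul_zero, smul_smul, inv_mul_cancel₀ (two_ne_zero' ℂ), one_smul] using h5
  exact LinearMap.ext key

/-- The twisted relative de Rham complex `D^·` of left modules over the Weyl algebra, with `D^q` in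
degree `q` and zero in negative degrees. -/
def twistedDeRham (w : Matrix (Fin n) (Fin N) ℤ) (γ : Fin n → ℂ) :
    CochainComplex (ModuleCat.{0} (Weyl N)) ℤ :=
  (CochainComplex.of (fun q : ℕ => ModuleCat.of (Weyl N) (Forms n w q))
    (fun q => ModuleCat.ofHom (twistedD w γ q)) (fun q => by
      rw [← ModuleCat.ofHom_comp, twistedD_comp]
      rfl)).extend ComplexShape.embeddingUpNat

end Hyp

end GKZ

/-!
The complex `twistedDeRham w γ` is `D_{Y ← X} ⊗ K`, up to a shift by `n`, for a resolution `K` of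
the `D_X`-module `M = π₁^* K_γ ⊗ F^* L` by modules that are acyclic for `D_{Y ← X} ⊗ -`.

* The functor. For the projection `X = 𝔾_mⁿ × 𝔸^N → Y = 𝔸^N`, the map `m ↦ (1 ⊗ 1) ⊗ m` identifies
  `D_{Y ← X} ⊗ A` with the quotient of `A` by the sum of the images of the commuting operators
  `∂_{tᵢ} tᵢ` (`toTransfer_surjective`, `toTransfer_eq_zero_iff`). If these operators act on `A` as
  a weakly regular sequence, then `A` is as good as a projective module: a bounded above exact
  complex of such modules stays exact after passage to the quotients, by descending induction on
  the degree and induction on the number of operators (`acyclic_map_of_isRegularList`). Applied to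
  the mapping cone of a comparison of resolutions, this shows that resolutions by such modules
  compute the derived functor (`nonempty_iso_of_isRegularList`).

* The resolution. For a `D_X`-module `A`, the space `A[s₁, …, s_n]` is a `D_X`-module on which
  functions and the `∂_{x_j}` act on the coefficients and `∂_{tᵢ}` acts by `∂_{tᵢ} + tᵢ⁻¹ sᵢ`. As
  `∂_{tᵢ} tᵢ` acts by `sᵢ + ∂_{tᵢ} tᵢ`, these operators form a regular sequence, and the quotient is
  `A` through the evaluation `sᵢ = -∂_{tᵢ} tᵢ` (`isRegularList_ind`, `indEval_eq_zero_iff`). Every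
  projective module is a retract of such a module (`isRegularList_of_projective`). The Koszul
  complex of `s₁, …, s_n` on the modules `(M ⊗ ⋀^q ℂⁿ)[s]` is a resolution of `M`, placed in degree
  `n`: in characteristic zero it is contracted, away from the constants in top degree, by the
  homotopy `∑ ∂/∂sᵢ ⊗ ιᵢ` divided by the total degree (`koszul_exact_succ`, `koszul_exact_zero`).

* The comparison. `M` is the ring of functions with the connection `d + ∑ γᵢ dtᵢ / tᵢ + dF`
  (`gkzIso`). Evaluation at `sᵢ = -∂_{tᵢ} tᵢ` turns the differential `-∑ sᵢ ⊗ eᵢ` into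
  `∑ ∂_{tᵢ} tᵢ ⊗ eᵢ`, and multiplication by `t₁ ⋯ t_n`, the ratio of the volume forms `dt` and
  `dt / t`, conjugates `∂_{tᵢ} tᵢ` into `t^{-γ} e^{-F} ∘ tᵢ ∂/∂tᵢ ∘ t^γ e^F`. So the direct image
  of the resolution is the twisted de Rham complex (`koszulToForms_koszulLin`).
-/

namespace GKZ

/-! ### Weakly regular sequences of commuting operators -/

section Regular

variable {R : Type} [Ring R]

/-- The subgroup `r₁ A + ⋯ + r_k A` of a left module `A` over a noncommutative ring, for a list
`r₁, …, r_k` of ring elements. -/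
def opSum (A : Type) [AddCommGroup A] [Module R A] : List R → AddSubgroup A
  | [] => ⊥
  | r :: l => (DistribSMul.toAddMonoidHom A r).range ⊔ opSum A l

/-- The list `r_k, …, r_1` acts on `A` as a weakly regular sequence: each entry acts injectively on
the quotient of `A` by the images of the entries behind it. -/
def IsRegularList (A : Type) [AddCommGroup A] [Module R A] : List R → Prop
  | [] => True
  | r :: l => IsRegularList A l ∧ ∀ a : A, r • a ∈ opSum A l → a ∈ opSum A l

variable {A B C : Type} [AddCommGroup A] [Module R A] [AddCommGroup B] [Module R B]
  [AddCommGroup C] [Module R C]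

theorem mem_opSum_cons {r : R} {l : List R} {x : A} :
    x ∈ opSum A (r :: l) ↔ ∃ a, ∃ y ∈ opSum A l, r • a + y = x := by
  rw [opSum, AddSubgroup.mem_sup]
  constructor
  · rintro ⟨_, ⟨a, rfl⟩, y, hy, rfl⟩
    exact ⟨a, y, hy, rfl⟩
  · rintro ⟨a, y, hy, rfl⟩
    exact ⟨_, ⟨a, rfl⟩, y, hy, rfl⟩

theorem smul_mem_opSum {l : List R} {r : R} (hr : r ∈ l) (a : A) : r • a ∈ opSum A l := by
  induction l with
  | nil => cases hr
  | cons s l ih =>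
    rcases List.mem_cons.mp hr with rfl | h
    · exact mem_opSum_cons.mpr ⟨a, 0, zero_mem _, add_zero _⟩
    · exact mem_opSum_cons.mpr ⟨0, _, ih h, by simp⟩

/-- An additive subgroup containing all `r A`, `r ∈ l`, contains their sum. -/
theorem opSum_le {l : List R} {H : AddSubgroup A} (h : ∀ r ∈ l, ∀ a : A, r • a ∈ H) :
    opSum A l ≤ H := by
  induction l with
  | nil => exact bot_le
  | cons s l ih =>
    refine sup_le ?_ (ih fun r hr => h r (List.mem_cons_of_mem _ hr))
    rintro _ ⟨a, rfl⟩
    exact h s List.mem_cons_self a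

theorem map_mem_opSum (f : A →ₗ[R] B) {l : List R} {x : A} (hx : x ∈ opSum A l) :
    f x ∈ opSum B l := by
  have h : opSum A l ≤ (opSum B l).comap f.toAddMonoidHom :=
    opSum_le fun r hr a => by
      show f (r • a) ∈ opSum B l
      rw [map_smul]
      exact smul_mem_opSum hr _
  exact h hx

theorem smul_mem_opSum_of_commute {r : R} {l : List R} (hr : ∀ s ∈ l, r * s = s * r) {x : A}
    (hx : x ∈ opSum A l) : r • x ∈ opSum A l := by
  have h : opSum A l ≤ (opSum A l).comap (DistribSMul.toAddMonoidHom A r) :=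
    opSum_le fun s hs a => by
      show r • s • a ∈ opSum A l
      rw [smul_smul, hr s hs, ← smul_smul]
      exact smul_mem_opSum hs _
  exact h hx

theorem exists_mem_opSum_of_surjective {f : A →ₗ[R] B} (hf : Function.Surjective f) {l : List R}
    {y : B} (hy : y ∈ opSum B l) : ∃ x ∈ opSum A l, f x = y := by
  have h : opSum B l ≤ (opSum A l).map f.toAddMonoidHom :=
    opSum_le fun r hr b => by
      obtain ⟨a, rfl⟩ := hf b
      exact ⟨r • a, smul_mem_opSum hr a, map_smul f r a⟩
  exact h hy

/-- If the list is regular on the quotient `C` of a short exact sequence `0 → A → B → C → 0`, then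
`A → B` stays injective modulo the images of the list. -/
theorem mem_opSum_of_exact {f : A →ₗ[R] B} {g : B →ₗ[R] C} (hf : Function.Injective f)
    (hg : Function.Surjective g) (hfg : Function.Exact f g) {l : List R}
    (hl : l.Pairwise fun r s => r * s = s * r) (hC : IsRegularList C l) {a : A}
    (ha : f a ∈ opSum B l) : a ∈ opSum A l := by
  induction l generalizing a with
  | nil =>
    have : f a = 0 := ha
    rw [map_eq_zero_iff f hf] at this
    rw [this]
    exact zero_mem _
  | cons r l ih =>
    rw [List.pairwise_cons] at hl
    obtain ⟨b, y, hy, hby⟩ := mem_opSum_cons.mp ha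
    have hgy : r • g b = g (-y) := by
      have h1 := congrArg g hby
      rw [map_add, map_smul, hfg.apply_apply_eq_zero] at h1
      rw [map_neg]
      exact eq_neg_of_add_eq_zero_left h1
    have h2 : g b ∈ opSum C l := hC.2 _ (hgy ▸ map_mem_opSum g (neg_mem hy))
    obtain ⟨b', hb', hbb'⟩ := exists_mem_opSum_of_surjective hg h2
    obtain ⟨a', ha'⟩ := (hfg (b - b')).mp (by rw [map_sub, hbb', sub_self])
    have h3 : a - r • a' ∈ opSum A l := by
      apply ih hl.2 hC.1
      have : f (a - r • a') = r • b' + y := by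
        rw [map_sub, map_smul, ha', ← hby, smul_sub]
        abel
      rw [this]
      exact add_mem (smul_mem_opSum_of_commute hl.1 hb') hy
    exact mem_opSum_cons.mpr ⟨a', _, h3, by abel⟩

/-- The kernel of a surjection between modules on which the list is regular. -/
theorem IsRegularList.of_exact {f : A →ₗ[R] B} {g : B →ₗ[R] C} (hf : Function.Injective f)
    (hg : Function.Surjective g) (hfg : Function.Exact f g) {l : List R}
    (hl : l.Pairwise fun r s => r * s = s * r) (hB : IsRegularList B l) (hC : IsRegularList C l) :
    IsRegularList A l := by
  induction l with
  | nil => trivial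
  | cons r l ih =>
    rw [List.pairwise_cons] at hl
    refine ⟨ih hl.2 hB.1 hC.1, fun a ha => ?_⟩
    apply mem_opSum_of_exact hf hg hfg hl.2 hC.1
    apply hB.2
    rw [← map_smul]
    exact map_mem_opSum f ha

theorem IsRegularList.of_retract {l : List R} (hB : IsRegularList B l) (i : A →ₗ[R] B)
    (p : B →ₗ[R] A) (h : ∀ a, p (i a) = a) : IsRegularList A l := by
  induction l with
  | nil => trivial
  | cons r l ih =>
    refine ⟨ih hB.1, fun a ha => ?_⟩
    rw [← h a]
    apply map_mem_opSum
    apply hB.2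
    rw [← map_smul]
    exact map_mem_opSum i ha

/-- A module that is the direct sum of two modules on which the list is regular. -/
theorem IsRegularList.of_sum {l : List R} (hA : IsRegularList A l) (hB : IsRegularList B l)
    (i : A →ₗ[R] C) (p : C →ₗ[R] A) (j : B →ₗ[R] C) (q : C →ₗ[R] B)
    (h : ∀ c, i (p c) + j (q c) = c) : IsRegularList C l := by
  induction l with
  | nil => trivial
  | cons r l ih =>
    refine ⟨ih hA.1 hB.1, fun c hc => ?_⟩
    rw [← h c]
    refine add_mem (map_mem_opSum i (hA.2 _ ?_)) (map_mem_opSum j (hB.2 _ ?_))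
    · rw [← map_smul]
      exact map_mem_opSum p hc
    · rw [← map_smul]
      exact map_mem_opSum q hc

end Regular

/-! ### Exact complexes of modules with a regular list -/

section Acyclic

variable {R S : Type} [Ring R] [Ring S]

theorem exactAt_iff_of_modules {X : CochainComplex (ModuleCat.{0} R) ℤ} (i j k : ℤ)
    (hij : i + 1 = j) (hjk : j + 1 = k) :
    X.ExactAt j ↔ ∀ x : X.X j, (X.d j k).hom x = 0 → ∃ y : X.X i, (X.d i j).hom y = x := by
  rw [HomologicalComplex.exactAt_iff' X i j k (by simp; omega) (by simp; omega),
    ShortComplex.moduleCat_exact_iff]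
  rfl

/-- The cycles in each degree of a bounded above exact complex of modules on which the list is
regular: the complex stays exact modulo the images of the list, by descending induction on the
degree, as the cycles are kernels of surjections between such modules. -/
theorem isRegularList_cycles {l : List R} (hl : l.Pairwise fun r s => r * s = s * r)
    (X : CochainComplex (ModuleCat.{0} R) ℤ) (b : ℤ) (hb : X.IsStrictlyLE b)
    (hX : X.Acyclic) (hreg : ∀ i, IsRegularList (X.X i) l) (i : ℤ) :
    IsRegularList (LinearMap.ker (X.d i (i + 1)).hom) l := by
  have key : ∀ m : ℕ, ∀ i : ℤ, b + 1 - m ≤ i →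
      IsRegularList (LinearMap.ker (X.d i (i + 1)).hom) l := by
    intro m
    induction m with
    | zero =>
      intro i hi
      have : Subsingleton (X.X i) := ModuleCat.subsingleton_of_isZero
        (X.isZero_of_isStrictlyLE b i (by push_cast at hi; omega))
      refine (hreg i).of_retract (Submodule.subtype _) 0 fun a => ?_
      exact Subsingleton.elim _ _
    | succ m ih =>
      intro i hi
      refine IsRegularList.of_exact (f := Submodule.subtype _)
        (g := (X.d i (i + 1)).hom.codRestrict (LinearMap.ker (X.d (i + 1) (i + 1 + 1)).hom)
          fun x => ?_) (Submodule.subtype_injective _) ?_ ?_ hl (hreg i)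
          (ih (i + 1) (by push_cast at hi; omega))
      · rw [LinearMap.mem_ker, ← LinearMap.comp_apply, ← ModuleCat.hom_comp, X.d_comp_d]
        rfl
      · rintro ⟨y, hy⟩
        obtain ⟨x, hx⟩ := (exactAt_iff_of_modules i (i + 1) (i + 1 + 1) rfl rfl).mp
          (hX (i + 1)) y hy
        exact ⟨x, Subtype.ext hx⟩
      · intro x
        constructor
        · intro hx
          exact ⟨⟨x, congrArg Subtype.val hx⟩, rfl⟩
        · rintro ⟨x, rfl⟩
          exact Subtype.ext x.2
  exact key (b + 1 - i).toNat i (by omega)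

/-- A functor `F` with `F M` the quotient of `M` by the images of the list, naturally in `M`, keeps
bounded above exact complexes of modules on which the list is regular exact. -/
theorem acyclic_map_of_isRegularList {l : List R} (hl : l.Pairwise fun r s => r * s = s * r)
    (F : ModuleCat.{0} R ⥤ ModuleCat.{0} S) [F.Additive]
    (θ : ∀ M : ModuleCat.{0} R, M →+ F.obj M) (hθ : ∀ M, Function.Surjective (θ M))
    (hker : ∀ (M : ModuleCat.{0} R) (m : M), θ M m = 0 ↔ m ∈ opSum M l)
    (hnat : ∀ {M M' : ModuleCat.{0} R} (f : M ⟶ M') (m : M),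
      (F.map f).hom (θ M m) = θ M' (f.hom m))
    (X : CochainComplex (ModuleCat.{0} R) ℤ) (b : ℤ) (hb : X.IsStrictlyLE b)
    (hX : X.Acyclic) (hreg : ∀ i, IsRegularList (X.X i) l) :
    ((F.mapHomologicalComplex (ComplexShape.up ℤ)).obj X).Acyclic := by
  intro j
  obtain ⟨i, rfl⟩ : ∃ i, i + 1 = j := ⟨j - 1, by omega⟩
  rw [exactAt_iff_of_modules i (i + 1) (i + 1 + 1) rfl rfl]
  intro y hy
  obtain ⟨x, rfl⟩ := hθ _ y
  replace hy : (F.map (X.d (i + 1) (i + 1 + 1))).hom (θ _ x) = 0 := hy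
  rw [hnat, hker] at hy
  have hZ := isRegularList_cycles hl X b hb hX hreg
  have hd : ∀ k (x : X.X k), (X.d (k + 1) (k + 1 + 1)).hom ((X.d k (k + 1)).hom x) = 0 := by
    intro k x
    rw [← LinearMap.comp_apply, ← ModuleCat.hom_comp, X.d_comp_d]
    rfl
  have hex : ∀ k (x : X.X (k + 1)), (X.d (k + 1) (k + 1 + 1)).hom x = 0 →
      ∃ y : X.X k, (X.d k (k + 1)).hom y = x := fun k =>
    (exactAt_iff_of_modules k (k + 1) (k + 1 + 1) rfl rfl).mp (hX (k + 1))
  let δ : ∀ k, X.X k →ₗ[R] LinearMap.ker (X.d (k + 1) (k + 1 + 1)).hom := fun k =>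
    (X.d k (k + 1)).hom.codRestrict _ (hd k)
  have hδ : ∀ k, Function.Surjective (δ k) := fun k z => by
    obtain ⟨y, hy⟩ := hex k z.1 z.2
    exact ⟨y, Subtype.ext hy⟩
  -- `dx` lies in the images of the list on the cycles, not only on the whole term.
  have h1 : δ (i + 1) x ∈ opSum (LinearMap.ker (X.d (i + 1 + 1) (i + 1 + 1 + 1)).hom) l := by
    refine mem_opSum_of_exact (f := Submodule.subtype _) (g := δ (i + 1 + 1))
      (Submodule.subtype_injective _) (hδ _) ?_ hl (hZ _) hy
    intro x
    constructor
    · intro hx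
      exact ⟨⟨x, congrArg Subtype.val hx⟩, rfl⟩
    · rintro ⟨x, rfl⟩
      exact Subtype.ext x.2
  obtain ⟨x', hx', hxx'⟩ := exists_mem_opSum_of_surjective (hδ (i + 1)) h1
  obtain ⟨y, hy⟩ := hex i (x - x') (by
    have := congrArg Subtype.val hxx'
    rw [map_sub, sub_eq_zero]
    exact this.symm)
  refine ⟨θ _ y, ?_⟩
  show (F.map (X.d i (i + 1))).hom (θ _ y) = _
  rw [hnat, hy, map_sub, (hker _ _).mpr hx', sub_zero]

end Acyclic

/-! ### Comparison of a projective resolution with a resolution by acyclic modules -/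

section Resolution

variable {C : Type*} [Category C] [Abelian C]

theorem isZero_Q_obj_iff_acyclic [HasDerivedCategory C] (X : CochainComplex C ℤ) :
    Limits.IsZero (DerivedCategory.Q.obj X) ↔ X.Acyclic := by
  constructor
  · intro h i
    rw [HomologicalComplex.exactAt_iff_isZero_homology]
    exact ((DerivedCategory.homologyFunctorFactors C i).app X).isZero_iff.mp
      ((DerivedCategory.homologyFunctor C i).map_isZero h)
  · intro h
    have : QuasiIso (0 : X ⟶ X) := by
      rw [quasiIso_iff]
      intro i
      rw [quasiIsoAt_iff_isIso_homologyMap]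
      have hz := (X.exactAt_iff_isZero_homology i).mp (h i)
      exact ⟨0, hz.eq_of_src _ _, hz.eq_of_src _ _⟩
    have h1 : IsIso (DerivedCategory.Q.map (0 : X ⟶ X)) :=
      (DerivedCategory.isIso_Q_map_iff_quasiIso C _).mpr this
    rw [Functor.map_zero] at h1
    rw [Limits.IsZero.iff_id_eq_zero,
      ← IsIso.hom_inv_id (0 : DerivedCategory.Q.obj X ⟶ DerivedCategory.Q.obj X),
      Limits.zero_comp]

attribute [local instance] HasDerivedCategory.standard in
/-- In the derived category, a morphism is invertible if and only if its cone is zero. -/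
theorem quasiIso_iff_acyclic_mappingCone {K L : CochainComplex C ℤ} (φ : K ⟶ L) :
    QuasiIso φ ↔ (CochainComplex.mappingCone φ).Acyclic := by
  rw [← DerivedCategory.isIso_Q_map_iff_quasiIso, ← isZero_Q_obj_iff_acyclic]
  exact (Pretriangulated.Triangle.isZero₃_iff_isIso₁ _
    (DerivedCategory.mappingCone_triangle_distinguished φ)).symm

attribute [local instance] HasDerivedCategory.standard in
/-- A projective resolution maps to every complex quasi-isomorphic to the resolved object. -/
theorem exists_quasiIso_of_projectiveResolution {Z : C} (P : ProjectiveResolution Z)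
    {E : CochainComplex C ℤ} (ε : E ⟶ (CochainComplex.singleFunctor C 0).obj Z) [QuasiIso ε] :
    ∃ φ : P.cochainComplex ⟶ E, QuasiIso φ := by
  have h1 : IsIso (DerivedCategory.Q.map ε) :=
    (DerivedCategory.isIso_Q_map_iff_quasiIso C _).mpr inferInstance
  have h2 : IsIso (DerivedCategory.Q.map P.π') :=
    (DerivedCategory.isIso_Q_map_iff_quasiIso C _).mpr inferInstance
  let e := DerivedCategory.quotientCompQhIso C
  obtain ⟨g, hg⟩ := (CochainComplex.IsKProjective.Qh_map_bijective P.cochainComplex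
    ((HomotopyCategory.quotient _ _).obj E)).surjective
    (e.hom.app P.cochainComplex ≫ DerivedCategory.Q.map P.π' ≫ inv (DerivedCategory.Q.map ε) ≫
      e.inv.app E)
  obtain ⟨φ, rfl⟩ := (HomotopyCategory.quotient _ _).map_surjective g
  refine ⟨φ, ?_⟩
  rw [← DerivedCategory.isIso_Q_map_iff_quasiIso]
  have h3 : DerivedCategory.Q.map φ = DerivedCategory.Q.map P.π' ≫
      inv (DerivedCategory.Q.map ε) := by
    have h4 := e.inv.naturality φ
    have h5 : (HomotopyCategory.quotient C (ComplexShape.up ℤ) ⋙ DerivedCategory.Qh).map φ = _ := hg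
    rw [h5, Iso.inv_hom_id_app_assoc] at h4
    rw [← cancel_mono (e.inv.app E), h4, Category.assoc]
  rw [h3]
  infer_instance

end Resolution

section Comparison

variable {R S : Type} [Ring R] [Ring S]

instance isStrictlyLE_mappingCone {K L : CochainComplex (ModuleCat.{0} R) ℤ} (φ : K ⟶ L) (b : ℤ)
    [K.IsStrictlyLE b] [L.IsStrictlyLE b] : (CochainComplex.mappingCone φ).IsStrictlyLE b := by
  rw [CochainComplex.isStrictlyLE_iff]
  intro i hi
  rw [Limits.IsZero.iff_id_eq_zero, ← CochainComplex.mappingCone.id_X φ i (i + 1) rfl,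
    (K.isZero_of_isStrictlyLE b (i + 1) (by omega)).eq_of_tgt
      ((CochainComplex.mappingCone.fst φ).1.v i (i + 1) rfl) 0,
    (L.isZero_of_isStrictlyLE b i hi).eq_of_tgt
      ((CochainComplex.mappingCone.snd φ).v i i (add_zero i)) 0]
  simp

/-- A functor given by quotients modulo the images of a list of commuting elements is left derived
by bounded above resolutions by modules on which the list is regular, if it is regular on
projective modules. -/
theorem nonempty_iso_of_isRegularList {l : List R} (hl : l.Pairwise fun r s => r * s = s * r)
    (F : ModuleCat.{0} R ⥤ ModuleCat.{0} S) [F.Additive]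
    (θ : ∀ M : ModuleCat.{0} R, M →+ F.obj M) (hθ : ∀ M, Function.Surjective (θ M))
    (hker : ∀ (M : ModuleCat.{0} R) (m : M), θ M m = 0 ↔ m ∈ opSum M l)
    (hnat : ∀ {M M' : ModuleCat.{0} R} (f : M ⟶ M') (m : M),
      (F.map f).hom (θ M m) = θ M' (f.hom m))
    (hproj : ∀ M : ModuleCat.{0} R, Projective M → IsRegularList M l)
    {Z : ModuleCat.{0} R} (P : ProjectiveResolution Z) (E : CochainComplex (ModuleCat.{0} R) ℤ)
    [hE : E.IsStrictlyLE 0] (hreg : ∀ i, IsRegularList (E.X i) l)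
    (ε : E ⟶ (CochainComplex.singleFunctor _ 0).obj Z) [QuasiIso ε]
    [HasDerivedCategory.{w} (ModuleCat.{0} S)] :
    Nonempty (DerivedCategory.Q.obj
        ((F.mapHomologicalComplex (ComplexShape.up ℤ)).obj P.cochainComplex) ≅
      DerivedCategory.Q.obj ((F.mapHomologicalComplex (ComplexShape.up ℤ)).obj E)) := by
  obtain ⟨φ, hφ⟩ := exists_quasiIso_of_projectiveResolution P ε
  rw [quasiIso_iff_acyclic_mappingCone] at hφ
  have h1 : ∀ i, IsRegularList ((CochainComplex.mappingCone φ).X i) l := fun i =>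
    (hproj (P.cochainComplex.X (i + 1)) inferInstance).of_sum (hreg i)
      ((CochainComplex.mappingCone.inl φ).v (i + 1) i (by omega)).hom
      ((CochainComplex.mappingCone.fst φ).1.v i (i + 1) rfl).hom
      ((CochainComplex.mappingCone.inr φ).f i).hom
      ((CochainComplex.mappingCone.snd φ).v i i (add_zero i)).hom
      (fun c => by
        have := congrArg (fun u => u.hom c) (CochainComplex.mappingCone.id_X φ i (i + 1) rfl)
        exact this)
  have h2 := acyclic_map_of_isRegularList hl F θ hθ hker hnat _ 0 inferInstance hφ h1
  have h3 : (CochainComplex.mappingCone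
      ((F.mapHomologicalComplex (ComplexShape.up ℤ)).map φ)).Acyclic := fun i =>
    (h2 i).of_iso (CochainComplex.mappingCone.mapHomologicalComplexIso φ F)
  have h4 := (quasiIso_iff_acyclic_mappingCone _).mpr h3
  have h5 := (DerivedCategory.isIso_Q_map_iff_quasiIso _ _).mpr h4
  exact ⟨asIso (DerivedCategory.Q.map ((F.mapHomologicalComplex (ComplexShape.up ℤ)).map φ))⟩

end Comparison

/-! ### The transfer bimodule of the projection to affine space -/

section TransferProj

variable {n N : ℕ}

/-- The ring of differential operators on `𝔾_mⁿ × 𝔸^N`. -/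
abbrev TotalOp (n N : ℕ) : Type := (totalCoords n N).DiffOp

/-- The transfer bimodule of the projection `𝔾_mⁿ × 𝔸^N → 𝔸^N`. -/
abbrev TransferProj (n N : ℕ) : Type := TransferRev (totalCoords n N) (polyCoords N) (proj₂ n N)

theorem pd_inr_proj₂ (j : Fin N) (b : Poly N) :
    (totalCoords n N).pd (Sum.inr j) (proj₂ n N b) = proj₂ n N (MvPolynomial.pderiv j b) :=
  xDer_algebraMap j b

theorem pd_inl_proj₂ (i : Fin n) (b : Poly N) :
    (totalCoords n N).pd (Sum.inl i) (proj₂ n N b) = 0 :=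
  (pdT (Poly N) i).map_algebraMap b

/-- The inclusion of the Weyl algebra `ℂ[x, ∂ₓ]` into the ring of differential operators on
`𝔾_mⁿ × 𝔸^N`. -/
def weylIncl (n N : ℕ) : Weyl N →ₐ[ℂ] TotalOp n N :=
  (polyCoords N).lift ((totalCoords n N).fn.comp (proj₂ n N))
    (fun j => (totalCoords n N).del (Sum.inr j))
    (fun j b => by
      show _ * (totalCoords n N).fn (proj₂ n N b) = (totalCoords n N).fn (proj₂ n N b) * _ +
        (totalCoords n N).fn (proj₂ n N (MvPolynomial.pderiv j b))
      rw [EtaleCoords.del_mul_fn, pd_inr_proj₂])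
    (fun j k => EtaleCoords.del_mul_del _ _ _)

theorem weylIncl_fn (b : Poly N) :
    weylIncl n N ((polyCoords N).fn b) = (totalCoords n N).fn (proj₂ n N b) := by
  simp [weylIncl]

theorem weylIncl_del (j : Fin N) :
    weylIncl n N ((polyCoords N).del j) = (totalCoords n N).del (Sum.inr j) := by
  simp [weylIncl]

/-- The operator `∂_{tᵢ} ∘ tᵢ`. -/
def delT (N : ℕ) (i : Fin n) : TotalOp n N :=
  (totalCoords n N).del (Sum.inl i) * (totalCoords n N).fn (mono (unitVec i))

/-- The operators `∂_{tᵢ} ∘ tᵢ`, as a list. -/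
def delTList (n N : ℕ) : List (TotalOp n N) := (List.finRange n).map (delT N)

theorem del_inl_mul_weylIncl (i : Fin n) (Q : Weyl N) :
    (totalCoords n N).del (Sum.inl i) * weylIncl n N Q =
      weylIncl n N Q * (totalCoords n N).del (Sum.inl i) := by
  induction Q using EtaleCoords.induction with
  | hf b => rw [weylIncl_fn, EtaleCoords.del_mul_fn, pd_inl_proj₂, map_zero, add_zero]
  | hd j => rw [weylIncl_del, EtaleCoords.del_mul_del]
  | ha P Q hP hQ => rw [map_add, mul_add, add_mul, hP, hQ]
  | hm P Q hP hQ => rw [map_mul, ← mul_assoc, hP, mul_assoc, hQ, mul_assoc]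

theorem fn_mono_mul_del_inr (k : Fin n → ℤ) (j : Fin N) :
    (totalCoords n N).del (Sum.inr j) * (totalCoords n N).fn (mono k) =
      (totalCoords n N).fn (mono k) * (totalCoords n N).del (Sum.inr j) := by
  have h : (totalCoords n N).pd (Sum.inr j) (mono k) = 0 := xDer_mono j k
  rw [EtaleCoords.del_mul_fn, h, map_zero, add_zero]

theorem pdT_mono_of_ne {i k : Fin n} (h : i ≠ k) (m : ℤ) :
    (totalCoords n N).pd (Sum.inl i) (mono (m • unitVec k)) = 0 := by
  show pdT (Poly N) i (mono (m • unitVec k)) = 0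
  rw [mono, pdT_single]
  simp [h]

theorem del_inl_mul_fn_of_ne {i k : Fin n} (h : i ≠ k) :
    (totalCoords n N).del (Sum.inl i) * (totalCoords n N).fn (mono (unitVec k)) =
      (totalCoords n N).fn (mono (unitVec k)) * (totalCoords n N).del (Sum.inl i) := by
  have h1 := pdT_mono_of_ne (N := N) h 1
  rw [one_smul] at h1
  rw [EtaleCoords.del_mul_fn, h1, map_zero, add_zero]

theorem delT_mul_delT (i k : Fin n) : delT N i * delT N k = delT N k * delT N i := by
  rcases eq_or_ne i k with rfl | h
  · rfl
  · have h3 : (totalCoords n N).fn (mono (unitVec i)) * (totalCoords n N).fn (mono (unitVec k)) =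
        (totalCoords n N).fn (mono (unitVec k)) * (totalCoords n N).fn (mono (unitVec i)) := by
      rw [← map_mul, mul_comm, map_mul]
    calc delT N i * delT N k
        = (totalCoords n N).del (Sum.inl i) * ((totalCoords n N).fn (mono (unitVec i)) *
            (totalCoords n N).del (Sum.inl k)) * (totalCoords n N).fn (mono (unitVec k)) := by
          simp only [delT, mul_assoc]
      _ = (totalCoords n N).del (Sum.inl k) * ((totalCoords n N).del (Sum.inl i) *
            (totalCoords n N).fn (mono (unitVec k))) * (totalCoords n N).fn (mono (unitVec i)) := by
          rw [← del_inl_mul_fn_of_ne h.symm, mul_assoc, mul_assoc, h3, ← mul_assoc, ← mul_assoc,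
            EtaleCoords.del_mul_del]
          simp only [mul_assoc]
      _ = delT N k * delT N i := by
          rw [del_inl_mul_fn_of_ne h]
          simp only [delT, mul_assoc]

theorem delTList_pairwise : (delTList n N).Pairwise fun r s => r * s = s * r := by
  rw [delTList, List.pairwise_map]
  exact List.pairwise_of_forall fun i k => delT_mul_delT i k

theorem mem_delTList (i : Fin n) : delT N i ∈ delTList n N :=
  List.mem_map_of_mem (List.mem_finRange i)

/-- The formal adjoint of an element of the Weyl algebra. -/
def weylAdjoint (Q : Weyl N) : Weyl N := ((polyCoords N).transpose Q).unop

theorem weylAdjoint_fn (b : Poly N) :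
    weylAdjoint ((polyCoords N).fn b) = (polyCoords N).fn b := by
  simp [weylAdjoint, EtaleCoords.transpose]

theorem weylAdjoint_del (j : Fin N) :
    weylAdjoint ((polyCoords N).del j) = -(polyCoords N).del j := by
  simp [weylAdjoint, EtaleCoords.transpose]

theorem weylAdjoint_add (P Q : Weyl N) :
    weylAdjoint (P + Q) = weylAdjoint P + weylAdjoint Q := by
  rw [weylAdjoint, map_add]
  rfl

theorem weylAdjoint_neg (Q : Weyl N) : weylAdjoint (-Q) = -weylAdjoint Q := by
  rw [weylAdjoint, map_neg]
  rfl

theorem weylAdjoint_mul (P Q : Weyl N) :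
    weylAdjoint (P * Q) = weylAdjoint Q * weylAdjoint P := by
  rw [weylAdjoint, map_mul]
  rfl

theorem weylAdjoint_one : weylAdjoint (1 : Weyl N) = 1 := by
  rw [weylAdjoint, map_one]
  rfl

theorem weylAdjoint_weylAdjoint (Q : Weyl N) : weylAdjoint (weylAdjoint Q) = Q := by
  induction Q using EtaleCoords.induction with
  | hf b => rw [weylAdjoint_fn, weylAdjoint_fn]
  | hd j => rw [weylAdjoint_del, weylAdjoint_neg, weylAdjoint_del, neg_neg]
  | ha P Q hP hQ => rw [weylAdjoint_add, weylAdjoint_add, hP, hQ]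
  | hm P Q hP hQ => rw [weylAdjoint_mul, weylAdjoint_mul, hP, hQ]

/-- The element `a ⊗ P` of the transfer bimodule. -/
def transferTmul (a : TotalRing n N) (P : Weyl N) : TransferProj n N :=
  (show Transfer (polyCoords N) (proj₂ n N) from (show Along (proj₂ n N) from a) ⊗ₜ[Poly N] P)

theorem transfer_induction {p : TransferProj n N → Prop} (hz : p 0)
    (ha : ∀ τ τ', p τ → p τ' → p (τ + τ')) (ht : ∀ a P, p (transferTmul a P)) (τ) : p τ :=
  TensorProduct.induction_on (R := Poly N) (M := Along (proj₂ n N)) (N := Weyl N)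
    (motive := fun τ => p τ) τ hz ht ha

theorem transferTmul_fn_mul (b : Poly N) (a : TotalRing n N) (P : Weyl N) :
    transferTmul a ((polyCoords N).fn b * P) = transferTmul (proj₂ n N b * a) P :=
  (smul_tmul (R := Poly N) b (show Along (proj₂ n N) from a) P).symm

theorem op_fn_smul (f a : TotalRing n N) (P : Weyl N) :
    op ((totalCoords n N).fn f) • transferTmul a P = transferTmul (f * a) P := by
  have h : ((totalCoords n N).transpose ((totalCoords n N).fn f)).unop =
      (totalCoords n N).fn f := by
    simp [EtaleCoords.transpose]
  exact (congrArg (fun Q => (transferConn (totalCoords n N) (polyCoords N) (proj₂ n N)).rep Q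
    (transferTmul a P : Transfer (polyCoords N) (proj₂ n N))) h).trans (FlatConn.rep_fn _ _ _)

theorem op_del_smul (i : Fin n ⊕ Fin N) (τ : TransferProj n N) :
    op ((totalCoords n N).del i) • τ =
      -((transferConn (totalCoords n N) (polyCoords N) (proj₂ n N)).nabla i τ :
        Transfer (polyCoords N) (proj₂ n N)) := by
  have h : ((totalCoords n N).transpose ((totalCoords n N).del i)).unop =
      -(totalCoords n N).del i := by
    simp [EtaleCoords.transpose]
  refine (congrArg (fun Q => (transferConn (totalCoords n N) (polyCoords N) (proj₂ n N)).rep Q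
    (τ : Transfer (polyCoords N) (proj₂ n N))) h).trans ?_
  rw [map_neg]
  exact congrArg Neg.neg (FlatConn.rep_del _ _ _)

/-- The minus sign is that of the transpose of `∂_{tᵢ}`, which passes to the functions. -/
theorem op_del_inl_smul (i : Fin n) (a : TotalRing n N) (P : Weyl N) :
    op ((totalCoords n N).del (Sum.inl i)) • transferTmul a P =
      -transferTmul ((totalCoords n N).pd (Sum.inl i) a) P := by
  rw [op_del_smul]
  have h : ∀ j, jac (totalCoords n N) (polyCoords N) (proj₂ n N) (Sum.inl i) j = 0 := fun j =>
    pd_inl_proj₂ i _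
  have h2 : ∀ a : Along (proj₂ n N),
      (transferConn (totalCoords n N) (polyCoords N) (proj₂ n N)).nabla (Sum.inl i) (a ⊗ₜ P) =
        alongPd (totalCoords n N) (proj₂ n N) (Sum.inl i) a ⊗ₜ P := fun a => by
    simp [transferConn, FlatConn.pullback, h]
  exact congrArg Neg.neg (h2 a)

theorem op_del_inr_smul (k : Fin N) (a : TotalRing n N) (P : Weyl N) :
    op ((totalCoords n N).del (Sum.inr k)) • transferTmul a P =
      -(transferTmul ((totalCoords n N).pd (Sum.inr k) a) P +
        transferTmul a ((polyCoords N).del k * P)) := by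
  rw [op_del_smul]
  have h : ∀ j, jac (totalCoords n N) (polyCoords N) (proj₂ n N) (Sum.inr k) j =
      if j = k then 1 else 0 := fun j => by
    have h1 := pd_inr_proj₂ (n := n) k ((polyCoords N).coord j)
    have h2 : MvPolynomial.pderiv k ((polyCoords N).coord j) = if j = k then 1 else 0 :=
      (polyCoords N).pd_coord k j
    rw [h2] at h1
    refine h1.trans ?_
    split_ifs
    · exact map_one _
    · exact map_zero _
  have h2 : ∀ a : Along (proj₂ n N),
      (transferConn (totalCoords n N) (polyCoords N) (proj₂ n N)).nabla (Sum.inr k) (a ⊗ₜ P) =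
        alongPd (totalCoords n N) (proj₂ n N) (Sum.inr k) a ⊗ₜ P +
          a ⊗ₜ ((polyCoords N).del k * P) := fun a => by
    simp [transferConn, FlatConn.pullback, h, FlatConn.regular, ite_tmul]
  exact congrArg Neg.neg (h2 a)

theorem smul_transferTmul (Q : Weyl N) (a : TotalRing n N) (P : Weyl N) :
    Q • transferTmul a P = transferTmul a (P * weylAdjoint Q) := rfl

variable (M : Type) [AddCommGroup M] [Module (TotalOp n N) M]

/-- The tensor product of the transfer bimodule with a module. -/
abbrev TransferTensor : Type := NCTensor (TotalOp n N) (Weyl N) (TransferProj n N) M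

variable {M}

/-- The element `τ ⊗ m` of the tensor product with the transfer bimodule. -/
def transferMk (τ : TransferProj n N) (m : M) : TransferTensor (n := n) (N := N) M :=
  Submodule.Quotient.mk (τ ⊗ₜ m)

theorem transferMk_balanced (τ : TransferProj n N) (r : TotalOp n N) (m : M) :
    transferMk (op r • τ) m = transferMk τ (r • m) :=
  (Submodule.Quotient.eq _).mpr (Submodule.subset_span ⟨τ, r, m, rfl⟩)

theorem transferMk_zero (m : M) : transferMk (0 : TransferProj n N) m = 0 := by
  rw [transferMk, zero_tmul, Submodule.Quotient.mk_zero]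

theorem transferMk_add (τ τ' : TransferProj n N) (m : M) :
    transferMk (τ + τ') m = transferMk τ m + transferMk τ' m := by
  rw [transferMk, add_tmul, Submodule.Quotient.mk_add]
  rfl

theorem smul_transferMk (Q : Weyl N) (τ : TransferProj n N) (m : M) :
    Q • transferMk τ m = transferMk (Q • τ) m := rfl

variable (M) in
/-- The map `m ↦ (1 ⊗ 1) ⊗ m`. -/
def toTransfer : M →+ TransferTensor (n := n) (N := N) M where
  toFun m := transferMk (transferTmul 1 1) m
  map_zero' := by rw [transferMk, tmul_zero, Submodule.Quotient.mk_zero]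
  map_add' m m' := by
    rw [transferMk, tmul_add, Submodule.Quotient.mk_add]
    rfl

theorem toTransfer_apply (m : M) :
    toTransfer (n := n) (N := N) M m = transferMk (transferTmul 1 1) m := rfl

theorem toTransfer_fn_smul (f : TotalRing n N) (m : M) :
    toTransfer M ((totalCoords n N).fn f • m) = transferMk (transferTmul f 1) m := by
  rw [toTransfer_apply, ← transferMk_balanced, op_fn_smul, mul_one]

theorem toTransfer_del_inl (i : Fin n) (m : M) :
    toTransfer (n := n) (N := N) M ((totalCoords n N).del (Sum.inl i) • m) = 0 := by
  have h : transferTmul (0 : TotalRing n N) (1 : Weyl N) = 0 := zero_tmul _ _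
  rw [toTransfer_apply, ← transferMk_balanced, op_del_inl_smul, Derivation.map_one_eq_zero, h,
    neg_zero, transferMk_zero]

/-- The map `m ↦ (1 ⊗ 1) ⊗ m` is equivariant under the Weyl algebra. -/
theorem toTransfer_weylIncl (Q : Weyl N) (m : M) :
    toTransfer (n := n) (N := N) M (weylIncl n N Q • m) =
      Q • toTransfer (n := n) (N := N) M m := by
  induction Q using EtaleCoords.induction generalizing m with
  | hf b =>
    rw [weylIncl_fn, toTransfer_fn_smul, toTransfer_apply, smul_transferMk, smul_transferTmul,
      weylAdjoint_fn, one_mul, ← mul_one ((polyCoords N).fn b), transferTmul_fn_mul, mul_one]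
  | hd j =>
    have h : transferTmul (0 : TotalRing n N) (1 : Weyl N) = 0 := zero_tmul _ _
    have h' : transferTmul (1 : TotalRing n N) (-(polyCoords N).del j) =
      -transferTmul (1 : TotalRing n N) ((polyCoords N).del j) := tmul_neg _ _
    rw [weylIncl_del, toTransfer_apply, ← transferMk_balanced, op_del_inr_smul,
      Derivation.map_one_eq_zero, h, zero_add, mul_one, toTransfer_apply, smul_transferMk,
      smul_transferTmul, weylAdjoint_del, one_mul, h']
  | ha P Q hP hQ => rw [map_add, add_smul, map_add, hP, hQ, add_smul]
  | hm P Q hP hQ => rw [map_mul, mul_smul, hP, hQ, mul_smul]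

/-- As `a ⊗ P` is the image of `1 ⊗ 1` under `a` on the right and the transpose of `P` on the left,
every tensor can be brought to the form `(1 ⊗ 1) ⊗ m`. -/
theorem toTransfer_surjective : Function.Surjective (toTransfer (n := n) (N := N) M) := by
  intro y
  obtain ⟨x, rfl⟩ := Submodule.Quotient.mk_surjective _ y
  rw [← Set.mem_range, ← AddMonoidHom.coe_range, SetLike.mem_coe]
  induction x using TensorProduct.induction_on with
  | zero => exact zero_mem _
  | add x y hx hy =>
    rw [Submodule.Quotient.mk_add]
    exact add_mem hx hy
  | tmul τ m =>
    show transferMk τ m ∈ _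
    induction τ using transfer_induction with
    | hz => rw [transferMk_zero]; exact zero_mem _
    | ha τ τ' h h' => rw [transferMk_add]; exact add_mem h h'
    | ht a P =>
      refine ⟨weylIncl n N (weylAdjoint P) • (totalCoords n N).fn a • m, ?_⟩
      rw [toTransfer_weylIncl, toTransfer_fn_smul, smul_transferMk, smul_transferTmul,
        weylAdjoint_weylAdjoint, one_mul]

variable (M) in
/-- The additive map `m ↦ Pᵗ a m` from `M` to its quotient by the images of the `∂_{tᵢ}`. -/
def adjointAction (a : TotalRing n N) (P : Weyl N) : M →+ M ⧸ opSum M (delTList n N) :=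
  (QuotientAddGroup.mk' (opSum M (delTList n N))).comp (DistribSMul.toAddMonoidHom M
    (weylIncl n N (weylAdjoint P) * (totalCoords n N).fn a))

theorem adjointAction_apply (a : TotalRing n N) (P : Weyl N) (m : M) :
    adjointAction M a P m = QuotientAddGroup.mk
      ((weylIncl n N (weylAdjoint P) * (totalCoords n N).fn a) • m) := rfl

variable (M) in
/-- The pairing `(a ⊗ P, m) ↦ Pᵗ a m` of the transfer bimodule and `M`, with values in the quotient
of `M` by the images of the `∂_{tᵢ}`. -/
def transferPairing : TransferProj n N →+ M →+ M ⧸ opSum M (delTList n N) :=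
  TensorProduct.liftAddHom (R := Poly N) (M := Along (proj₂ n N)) (N := Weyl N)
    (AddMonoidHom.mk' (fun a => AddMonoidHom.mk' (fun P => adjointAction M a P)
      (by
        intro P P'
        ext m
        rw [AddMonoidHom.add_apply, adjointAction_apply, adjointAction_apply, adjointAction_apply,
          weylAdjoint_add, map_add, add_mul, add_smul, QuotientAddGroup.mk_add]))
      (by
        intro a a'
        ext P m
        show adjointAction M ((show TotalRing n N from a) + (show TotalRing n N from a')) P m =
          adjointAction M a P m + adjointAction M a' P m
        rw [adjointAction_apply, adjointAction_apply, adjointAction_apply,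
          map_add, mul_add, add_smul, QuotientAddGroup.mk_add]))
    (by
      intro b a P
      have h : ∀ a : TotalRing n N, adjointAction M (proj₂ n N b * a) P =
          adjointAction M a ((polyCoords N).fn b * P) := fun a => by
        rw [adjointAction, adjointAction, weylAdjoint_mul, weylAdjoint_fn, map_mul,
          map_mul, weylIncl_fn, mul_assoc]
      exact h a)

theorem transferPairing_tmul (a : TotalRing n N) (P : Weyl N) (m : M) :
    transferPairing M (transferTmul a P) m = QuotientAddGroup.mk
      ((weylIncl n N (weylAdjoint P) * (totalCoords n N).fn a) • m) := rfl

theorem del_inl_smul_mem_opSum (i : Fin n) (m : M) :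
    (totalCoords n N).del (Sum.inl i) • m ∈ opSum M (delTList n N) := by
  have h : (totalCoords n N).del (Sum.inl i) • m =
      delT N i • (totalCoords n N).fn (mono (-unitVec i)) • m := by
    rw [smul_smul, delT, mul_assoc, ← map_mul, mono_mul, add_neg_cancel, mono_zero, map_one,
      mul_one]
  rw [h]
  exact smul_mem_opSum (mem_delTList i) _

theorem fn_mul_del (i : Fin n ⊕ Fin N) (a : TotalRing n N) :
    (totalCoords n N).fn a * (totalCoords n N).del i =
      (totalCoords n N).del i * (totalCoords n N).fn a -
        (totalCoords n N).fn ((totalCoords n N).pd i a) := by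
  rw [EtaleCoords.del_mul_fn, add_sub_cancel_right]

/-- The pairing is balanced over `D_X`: `∂ᵢ` acts on the right of `D_{Y ← X}` through its transpose,
and `∂_{tᵢ}`, which commutes with the image of the Weyl algebra, dies in the quotient. -/
theorem transferPairing_balanced (r : TotalOp n N) (τ : TransferProj n N) (m : M) :
    transferPairing M (op r • τ) m = transferPairing M τ (r • m) := by
  induction r using EtaleCoords.induction generalizing τ m with
  | hf f =>
    induction τ using transfer_induction with
    | hz => rw [smul_zero, map_zero, AddMonoidHom.zero_apply, AddMonoidHom.zero_apply]
    | ha τ τ' h h' =>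
      rw [smul_add, map_add, map_add, AddMonoidHom.add_apply, AddMonoidHom.add_apply, h, h']
    | ht a P =>
      rw [op_fn_smul, transferPairing_tmul, transferPairing_tmul, mul_comm f a, map_mul,
        smul_smul, mul_assoc]
  | hd i =>
    induction τ using transfer_induction with
    | hz => rw [smul_zero, map_zero, AddMonoidHom.zero_apply, AddMonoidHom.zero_apply]
    | ha τ τ' h h' =>
      rw [smul_add, map_add, map_add, AddMonoidHom.add_apply, AddMonoidHom.add_apply, h, h']
    | ht a P =>
      rw [transferPairing_tmul, smul_smul, mul_assoc, fn_mul_del, mul_sub, sub_smul]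
      rcases i with i | k
      · rw [op_del_inl_smul, map_neg, AddMonoidHom.neg_apply, transferPairing_tmul,
          ← mul_assoc, ← del_inl_mul_weylIncl, ← QuotientAddGroup.mk_neg, eq_comm,
          QuotientAddGroup.eq, mul_assoc, mul_smul]
        convert neg_mem (del_inl_smul_mem_opSum (N := N) i
          ((weylIncl n N (weylAdjoint P) * (totalCoords n N).fn a) • m)) using 1
        abel
      · rw [op_del_inr_smul, map_neg, map_add, AddMonoidHom.neg_apply, AddMonoidHom.add_apply,
          transferPairing_tmul, transferPairing_tmul, weylAdjoint_mul, weylAdjoint_del, map_mul,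
          map_neg, weylIncl_del, ← QuotientAddGroup.mk_add, ← QuotientAddGroup.mk_neg]
        congr 1
        simp only [mul_neg, neg_mul, neg_smul, mul_assoc]
        abel
  | ha P Q hP hQ =>
    rw [MulOpposite.op_add, add_smul, map_add, AddMonoidHom.add_apply, hP, hQ, add_smul, map_add]
  | hm P Q hP hQ => rw [op_mul, mul_smul, hQ, hP, mul_smul]

/-- The tensor product with the transfer bimodule is the quotient of `M` by the images of the
`∂_{tᵢ}`. -/
theorem toTransfer_eq_zero_iff (m : M) :
    toTransfer (n := n) (N := N) M m = 0 ↔ m ∈ opSum M (delTList n N) := by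
  constructor
  · intro h
    let G : TransferProj n N ⊗[ℤ] M →+ M ⧸ opSum M (delTList n N) :=
      TensorProduct.liftAddHom (transferPairing M) fun r τ m => by
        rw [map_zsmul, map_zsmul, AddMonoidHom.smul_apply]
    have hG : ∀ z ∈ ncRel (TotalOp n N) (Weyl N) (TransferProj n N) M, ∀ Q : Weyl N,
        G (Q • z) = 0 := by
      intro z hz
      induction hz using Submodule.span_induction with
      | mem z hz =>
        obtain ⟨τ, r, m, rfl⟩ := hz
        intro Q
        rw [smul_sub, map_sub, smul_tmul', smul_tmul', sub_eq_zero, smul_comm Q (op r) τ]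
        exact transferPairing_balanced r (Q • τ) m
      | zero => intro Q; rw [smul_zero, map_zero]
      | add x y _ _ hx hy => intro Q; rw [smul_add, map_add, hx, hy, add_zero]
      | smul P x _ hx => intro Q; rw [smul_smul]; exact hx _
    have h1 : G ((1 : Weyl N) • (transferTmul 1 1 ⊗ₜ[ℤ] m)) = 0 :=
      hG _ ((Submodule.Quotient.mk_eq_zero _).mp h) 1
    rw [one_smul, liftAddHom_tmul, transferPairing_tmul, weylAdjoint_one, map_one, map_one, one_mul,
      one_smul] at h1
    exact (QuotientAddGroup.eq_zero_iff m).mp h1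
  · intro h
    have h1 : opSum M (delTList n N) ≤ (toTransfer (n := n) (N := N) M).ker := opSum_le (by
      intro r hr a
      obtain ⟨i, -, rfl⟩ := List.mem_map.mp hr
      rw [AddMonoidHom.mem_ker, delT, mul_smul]
      exact toTransfer_del_inl i _)
    exact h1 h

theorem ncMap_toTransfer {M' : Type} [AddCommGroup M'] [Module (TotalOp n N) M']
    (f : M →ₗ[TotalOp n N] M') (m : M) :
    ncMap (TotalOp n N) (Weyl N) (TransferProj n N) f (toTransfer M m) = toTransfer M' (f m) :=
  rfl

end TransferProj

/-! ### Polynomials with coefficients in a vector space -/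

section PolyTensor

variable {n : ℕ} {A C : Type} [AddCommGroup A] [Module ℂ A] [AddCommGroup C] [Module ℂ C]

variable (n A) in
/-- The space `A[s₁, …, s_n]` of polynomials with coefficients in the vector space `A`. -/
abbrev PolyTensor : Type := MvPolynomial (Fin n) ℂ ⊗[ℂ] A

variable (A) in
/-- Multiplication by `sᵢ` on `A[s]`. -/
def sMul (i : Fin n) : PolyTensor n A →ₗ[ℂ] PolyTensor n A :=
  LinearMap.rTensor A (LinearMap.mulLeft ℂ (MvPolynomial.X i))

@[simp] theorem sMul_tmul (i : Fin n) (p : MvPolynomial (Fin n) ℂ) (a : A) :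
    sMul A i (p ⊗ₜ a) = (MvPolynomial.X i * p) ⊗ₜ a := rfl

theorem sMul_injective (i : Fin n) : Function.Injective (sMul A i) :=
  Module.Flat.rTensor_preserves_injective_linearMap _
    (mul_right_injective₀ (MvPolynomial.X_ne_zero i))

theorem polyTensor_induction {p : PolyTensor n A → Prop} (hc : ∀ a, p (1 ⊗ₜ a))
    (ha : ∀ x y, p x → p y → p (x + y)) (hs : ∀ i x, p x → p (sMul A i x)) (x : PolyTensor n A) :
    p x := by
  induction x using TensorProduct.induction_on with
  | zero => simpa using hc 0
  | add x y hx hy => exact ha x y hx hy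
  | tmul q a =>
    induction q using MvPolynomial.induction_on generalizing a with
    | C r =>
      have h : (MvPolynomial.C r : MvPolynomial (Fin n) ℂ) = r • 1 := by
        rw [MvPolynomial.smul_eq_C_mul, mul_one]
      rw [h, smul_tmul]
      exact hc _
    | add q q' h h' => rw [add_tmul]; exact ha _ _ (h a) (h' a)
    | mul_X q i h =>
      rw [mul_comm]
      exact hs i _ (h a)

open scoped IsMulCommutative in
/-- The action of polynomials through commuting operators. -/
def polyAct (T : Fin n → Module.End ℂ C) (hT : ∀ i k, T i * T k = T k * T i) :
    MvPolynomial (Fin n) ℂ →ₐ[ℂ] Module.End ℂ C :=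
  haveI := Algebra.isMulCommutative_adjoin ℂ (s := Set.range T) (by
    rintro _ ⟨i, rfl⟩ _ ⟨k, rfl⟩
    exact hT i k)
  (Algebra.adjoin ℂ (Set.range T)).val.comp
    (MvPolynomial.aeval (S₁ := Algebra.adjoin ℂ (Set.range T))
      fun i => ⟨T i, Algebra.subset_adjoin ⟨i, rfl⟩⟩)

theorem polyAct_X (T : Fin n → Module.End ℂ C) (hT : ∀ i k, T i * T k = T k * T i) (i : Fin n) :
    polyAct T hT (MvPolynomial.X i) = T i := by
  simp [polyAct]

/-- The universal property of `A[s]`: the extension of a linear map `A → C` that turns `sᵢ` into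
the operator `T i` on `C`. -/
def polyExtend (T : Fin n → Module.End ℂ C) (hT : ∀ i k, T i * T k = T k * T i) (f : A →ₗ[ℂ] C) :
    PolyTensor n A →ₗ[ℂ] C :=
  TensorProduct.lift (LinearMap.lcomp ℂ C f ∘ₗ (polyAct T hT).toLinearMap)

section

variable (T : Fin n → Module.End ℂ C) (hT : ∀ i k, T i * T k = T k * T i) (f : A →ₗ[ℂ] C)

theorem polyExtend_tmul (p : MvPolynomial (Fin n) ℂ) (a : A) :
    polyExtend T hT f (p ⊗ₜ a) = polyAct T hT p (f a) := rfl

@[simp] theorem polyExtend_one (a : A) : polyExtend T hT f (1 ⊗ₜ a) = f a := by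
  rw [polyExtend_tmul, map_one]
  rfl

@[simp] theorem polyExtend_sMul (i : Fin n) (x : PolyTensor n A) :
    polyExtend T hT f (sMul A i x) = T i (polyExtend T hT f x) := by
  induction x using TensorProduct.induction_on with
  | zero => simp
  | add x y hx hy => simp only [map_add, hx, hy]
  | tmul p a =>
    rw [sMul_tmul, polyExtend_tmul, map_mul, polyAct_X]
    rfl

end

/-- An operator on `A`, applied to the coefficients of polynomials. -/
abbrev coeffMap (D : A →ₗ[ℂ] C) : PolyTensor n A →ₗ[ℂ] PolyTensor n C := LinearMap.lTensor _ D

theorem coeffMap_sMul (D : A →ₗ[ℂ] C) (i : Fin n) (x : PolyTensor n A) :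
    coeffMap D (sMul A i x) = sMul C i (coeffMap D x) := by
  induction x using TensorProduct.induction_on with
  | zero => simp
  | add x y hx hy => simp only [map_add, hx, hy]
  | tmul p a => simp [coeffMap]

theorem sMul_comm (i k : Fin n) (x : PolyTensor n A) :
    sMul A i (sMul A k x) = sMul A k (sMul A i x) := by
  induction x using TensorProduct.induction_on with
  | zero => simp
  | add x y hx hy => simp only [map_add, hx, hy]
  | tmul p a => simp [mul_left_comm]

theorem coeffMap_comp_apply {E : Type} [AddCommGroup E] [Module ℂ E] (D : A →ₗ[ℂ] C)
    (D' : C →ₗ[ℂ] E) (x : PolyTensor n A) :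
    coeffMap D' (coeffMap D x) = coeffMap (D' ∘ₗ D) x := by
  rw [coeffMap, coeffMap, coeffMap, LinearMap.lTensor_comp_apply]

variable (D : Fin n → Module.End ℂ A) (hD : ∀ i k, D i * D k = D k * D i)

/-- `s_i + D_i` acts injectively on `A[s]`: it is conjugate to `s_i` under `s ↦ s + D`. -/
theorem sMul_add_injective (hD : ∀ i k, D i * D k = D k * D i) (i : Fin n) {x : PolyTensor n A}
    (hx : sMul A i x + coeffMap (D i) x = 0) : x = 0 := by
  have hcomm : ∀ (c : ℂ) (i k : Fin n), (sMul A i + c • coeffMap (D i)) *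
      (sMul A k + c • coeffMap (D k)) =
      (sMul A k + c • coeffMap (D k)) * (sMul A i + c • coeffMap (D i)) := by
    intro c i k
    refine LinearMap.ext fun z => ?_
    have h := hD i k
    simp only [Module.End.mul_apply, LinearMap.add_apply, LinearMap.smul_apply, map_add, map_smul,
      coeffMap_sMul, coeffMap_comp_apply, sMul_comm i k]
    rw [show D i ∘ₗ D k = D k ∘ₗ D i from h]
    module
  let Φ : ℂ → PolyTensor n A →ₗ[ℂ] PolyTensor n A := fun c =>
    polyExtend (fun i => sMul A i + c • coeffMap (D i)) (hcomm c) (TensorProduct.mk ℂ _ A 1)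
  have hΦs : ∀ c i z, Φ c (sMul A i z) = sMul A i (Φ c z) + c • coeffMap (D i) (Φ c z) :=
    fun c i z => polyExtend_sMul _ _ _ i z
  have hΦ1 : ∀ c a, Φ c (1 ⊗ₜ a) = 1 ⊗ₜ a := fun c a => polyExtend_one _ _ _ a
  have hΦD : ∀ c i z, Φ c (coeffMap (D i) z) = coeffMap (D i) (Φ c z) := by
    intro c i z
    induction z using polyTensor_induction with
    | hc a => rw [LinearMap.lTensor_tmul, hΦ1, hΦ1, LinearMap.lTensor_tmul]
    | ha x y hx hy => simp only [map_add, hx, hy]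
    | hs k x hx =>
      rw [coeffMap_sMul, hΦs, hΦs, hx, map_add, coeffMap_sMul, map_smul, coeffMap_comp_apply,
        coeffMap_comp_apply]
      rw [show D k ∘ₗ D i = D i ∘ₗ D k from hD k i]
  have hinv : ∀ z, Φ 1 (Φ (-1) z) = z := by
    intro z
    induction z using polyTensor_induction with
    | hc a => rw [hΦ1, hΦ1]
    | ha x y hx hy => simp only [map_add, hx, hy]
    | hs i x hx =>
      rw [hΦs, map_add, hΦs, map_smul, hΦD, hx]
      module
  have h1 : sMul A i (Φ (-1) x) = 0 := by
    have h2 := congrArg (Φ (-1)) hx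
    rw [map_add, hΦs, hΦD, map_zero] at h2
    rw [← h2]
    module
  have h3 : Φ (-1) x = 0 := sMul_injective i (by rw [h1, map_zero])
  rw [← hinv x, h3, map_zero]

end PolyTensor

/-! ### Induced modules -/

section Induced

variable {n N : ℕ}

/-- An additive map that commutes with functions and with the `∂ᵢ` is linear over the differential
operators. -/
def EtaleCoords.linearMapOfCommute {ι A : Type} [Fintype ι] [DecidableEq ι] [CommRing A]
    [Algebra ℂ A] (c : EtaleCoords ι A) {X Y : Type} [AddCommGroup X] [Module c.DiffOp X]
    [AddCommGroup Y] [Module c.DiffOp Y] (f : X →+ Y) (hf : ∀ a x, f (c.fn a • x) = c.fn a • f x)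
    (hd : ∀ i x, f (c.del i • x) = c.del i • f x) : X →ₗ[c.DiffOp] Y where
  toFun := f
  map_add' := map_add f
  map_smul' P x := by
    show f (P • x) = P • f x
    induction P using EtaleCoords.induction generalizing x with
    | hf a => exact hf a x
    | hd i => exact hd i x
    | ha P Q hP hQ => rw [add_smul, map_add, hP, hQ, add_smul]
    | hm P Q hP hQ => rw [mul_smul, hP, hQ, mul_smul]

variable (n N)
variable (A B : Type) [AddCommGroup A] [Module ℂ A] [Module (TotalOp n N) A]
  [IsScalarTower ℂ (TotalOp n N) A] [AddCommGroup B] [Module ℂ B] [Module (TotalOp n N) B]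
  [IsScalarTower ℂ (TotalOp n N) B]

/-- A differential operator as an endomorphism of a module. -/
abbrev opAct (P : TotalOp n N) : Module.End ℂ A := Algebra.lsmul ℂ ℂ A P

variable {n N} in
/-- The action of `∂_{tᵢ}` and `∂_{x_j}` on the induced module. -/
def indDel : Fin n ⊕ Fin N → Module.End ℂ (PolyTensor n A)
  | .inl i => coeffMap (opAct n N A ((totalCoords n N).del (Sum.inl i))) +
      sMul A i * coeffMap (opAct n N A ((totalCoords n N).fn (mono (-unitVec i))))
  | .inr j => coeffMap (opAct n N A ((totalCoords n N).del (Sum.inr j)))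

variable {A B n N}

theorem pdT_mono_neg_of_ne {i k : Fin n} (h : i ≠ k) :
    (totalCoords n N).pd (Sum.inl i) (mono (-unitVec k)) = 0 := by
  simpa using pdT_mono_of_ne (N := N) h (-1)

theorem indDel_inl_tmul (i : Fin n) (p : MvPolynomial (Fin n) ℂ) (a : A) :
    indDel A (Sum.inl i : Fin n ⊕ Fin N) (p ⊗ₜ a) =
      p ⊗ₜ ((totalCoords n N).del (Sum.inl i) • a) +
        (MvPolynomial.X i * p) ⊗ₜ ((totalCoords n N).fn (mono (-unitVec i)) • a) := rfl

theorem indDel_inr_tmul (j : Fin N) (p : MvPolynomial (Fin n) ℂ) (a : A) :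
    indDel A (Sum.inr j : Fin n ⊕ Fin N) (p ⊗ₜ a) =
      p ⊗ₜ ((totalCoords n N).del (Sum.inr j) • a) := rfl

variable (A) in
/-- The action of the differential operators on the induced module. -/
def indRep : TotalOp n N →ₐ[ℂ] Module.End ℂ (PolyTensor n A) :=
  (totalCoords n N).lift
    ((Module.End.lTensorAlgHom ℂ A (MvPolynomial (Fin n) ℂ)).comp
      ((Algebra.lsmul ℂ ℂ A).comp (totalCoords n N).fn))
    (indDel A)
    (by
      intro i f
      refine TensorProduct.ext' fun p a => ?_
      show indDel A i (p ⊗ₜ ((totalCoords n N).fn f • a)) =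
        coeffMap (opAct n N A ((totalCoords n N).fn f)) (indDel A i (p ⊗ₜ a)) +
          p ⊗ₜ ((totalCoords n N).fn ((totalCoords n N).pd i f) • a)
      rcases i with i | j
      · rw [indDel_inl_tmul, indDel_inl_tmul, map_add, smul_smul, smul_smul,
          EtaleCoords.del_mul_fn, add_smul, tmul_add, ← map_mul, mul_comm _ f, map_mul, mul_smul,
          mul_smul, LinearMap.lTensor_tmul, LinearMap.lTensor_tmul]
        simp only [Algebra.lsmul_coe]
        rw [add_right_comm]
      · rw [indDel_inr_tmul, indDel_inr_tmul, smul_smul,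
          EtaleCoords.del_mul_fn, add_smul, tmul_add, mul_smul, LinearMap.lTensor_tmul]
        simp only [Algebra.lsmul_coe])
    (by
      intro i k
      refine TensorProduct.ext' fun p a => ?_
      simp only [Module.End.mul_apply]
      rcases i with i | i <;> rcases k with k | k
      · rcases eq_or_ne i k with rfl | h
        · rfl
        · have h1 : ∀ a : A, (totalCoords n N).del (Sum.inl i) •
              (totalCoords n N).fn (mono (-unitVec k)) • a =
              (totalCoords n N).fn (mono (-unitVec k)) • (totalCoords n N).del (Sum.inl i) • a :=
            fun a => by
              rw [smul_smul, EtaleCoords.del_mul_fn, pdT_mono_neg_of_ne h, map_zero, add_zero,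
                mul_smul]
          have h2 : ∀ a : A, (totalCoords n N).del (Sum.inl k) •
              (totalCoords n N).fn (mono (-unitVec i)) • a =
              (totalCoords n N).fn (mono (-unitVec i)) • (totalCoords n N).del (Sum.inl k) • a :=
            fun a => by
              rw [smul_smul, EtaleCoords.del_mul_fn, pdT_mono_neg_of_ne h.symm, map_zero,
                add_zero, mul_smul]
          have h3 : (totalCoords n N).fn (mono (-unitVec k)) •
              (totalCoords n N).fn (mono (-unitVec i)) • a =
              (totalCoords n N).fn (mono (-unitVec i)) •
              (totalCoords n N).fn (mono (-unitVec k)) • a := by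
            rw [smul_smul, smul_smul, ← map_mul, ← map_mul, mul_comm]
          have h4 : (totalCoords n N).del (Sum.inl i) • (totalCoords n N).del (Sum.inl k) • a =
              (totalCoords n N).del (Sum.inl k) • (totalCoords n N).del (Sum.inl i) • a := by
            rw [smul_smul, smul_smul, EtaleCoords.del_mul_del]
          simp only [indDel_inl_tmul, map_add, h1, h2, h3, h4,
            mul_left_comm (MvPolynomial.X i) (MvPolynomial.X k)]
          abel
      · simp only [indDel_inl_tmul, indDel_inr_tmul, map_add, smul_smul,
          EtaleCoords.del_mul_del _ (Sum.inr k), fn_mono_mul_del_inr]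
      · simp only [indDel_inl_tmul, indDel_inr_tmul, map_add, smul_smul,
          EtaleCoords.del_mul_del _ (Sum.inr i), fn_mono_mul_del_inr]
      · simp only [indDel_inr_tmul, smul_smul, EtaleCoords.del_mul_del _ (Sum.inr i)])

variable (n A) in
/-- The `D`-module `A[s₁, …, s_n]`, on which functions and the `∂_{x_j}` act on the coefficients
and `∂_{tᵢ}` acts by `∂_{tᵢ} + tᵢ⁻¹ sᵢ`. It is isomorphic to the module induced from `A`, regarded
as a module over the operators which do not differentiate in the direction of `t`. -/
abbrev Ind : Type := PolyTensor n A

instance : Module (TotalOp n N) (Ind n A) :=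
  Module.compHom (PolyTensor n A) (indRep (N := N) A).toRingHom

theorem ind_fn_smul (f : TotalRing n N) (x : Ind n A) :
    (totalCoords n N).fn f • x = coeffMap (opAct n N A ((totalCoords n N).fn f)) x :=
  congrArg (fun u : Module.End ℂ (PolyTensor n A) => u x)
    (EtaleCoords.lift_fn (totalCoords n N) _ _ _ _ f)

theorem ind_del_smul (i : Fin n ⊕ Fin N) (x : Ind n A) :
    (totalCoords n N).del i • x = indDel A i x :=
  congrArg (fun u : Module.End ℂ (PolyTensor n A) => u x)
    (EtaleCoords.lift_del (totalCoords n N) _ _ _ _ i)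

theorem ind_delT_smul (i : Fin n) (x : Ind n A) :
    delT N i • x = (sMul A i x + coeffMap (opAct n N A (delT N i)) x : PolyTensor n A) := by
  rw [delT, mul_smul, ind_fn_smul, ind_del_smul]
  induction x using TensorProduct.induction_on with
  | zero => simp
  | add x y hx hy => simp only [map_add, hx, hy]; abel
  | tmul p a =>
    rw [LinearMap.lTensor_tmul, indDel_inl_tmul, sMul_tmul, LinearMap.lTensor_tmul]
    simp only [Algebra.lsmul_coe]
    rw [smul_smul, smul_smul, ← map_mul, mono_mul, neg_add_cancel, mono_zero, map_one, one_smul,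
      add_comm]

theorem opAct_delT_comm (i k : Fin n) :
    opAct n N A (delT N i) * opAct n N A (delT N k) =
      opAct n N A (delT N k) * opAct n N A (delT N i) := by
  rw [opAct, opAct, ← map_mul, delT_mul_delT, map_mul]

theorem opAct_delT_comp (i k : Fin n) :
    opAct n N A (delT N i) ∘ₗ opAct n N A (delT N k) =
      opAct n N A (delT N k) ∘ₗ opAct n N A (delT N i) := opAct_delT_comm i k

/-- The operators `∂_{tᵢ} ∘ tᵢ` on the coefficients preserve the images of their counterparts on
`A[s]`, as they commute with them. -/
theorem coeffMap_mem_opSum (l : List (Fin n)) (i : Fin n) {y : Ind n A}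
    (hy : y ∈ opSum (Ind n A) (l.map (delT N))) :
    coeffMap (opAct n N A (delT N i)) y ∈ opSum (Ind n A) (l.map (delT N)) := by
  have h : opSum (Ind n A) (l.map (delT N)) ≤
      (opSum (Ind n A) (l.map (delT N))).comap
        (coeffMap (opAct n N A (delT N i))).toAddMonoidHom :=
    opSum_le (by
      intro r hr z
      obtain ⟨k, hk, rfl⟩ := List.mem_map.mp hr
      show coeffMap (opAct n N A (delT N i)) (delT N k • z) ∈
        opSum (Ind n A) (l.map (delT N))
      rw [ind_delT_smul, map_add, coeffMap_sMul, coeffMap_comp_apply, opAct_delT_comp,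
        ← coeffMap_comp_apply, ← ind_delT_smul]
      exact smul_mem_opSum (List.mem_map_of_mem hk) _)
  exact h hy

/-- The operators `∂_{tᵢ} ∘ tᵢ` act on the induced module as a regular sequence. -/
theorem isRegularList_ind_map (l : List (Fin n)) (hl : l.Nodup) :
    IsRegularList (Ind n A) (l.map (delT N)) := by
  let D : Fin n → Module.End ℂ A := fun i => opAct n N A (delT N i)
  have hD : ∀ i k, D i ∘ₗ D k = D k ∘ₗ D i := opAct_delT_comp
  let T : List (Fin n) → Fin n → Module.End ℂ (PolyTensor n A) := fun l i =>
    if i ∈ l then -coeffMap (D i) else sMul A i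
  have hT : ∀ l i k, T l i * T l k = T l k * T l i := by
    intro l i k
    refine LinearMap.ext fun z => ?_
    simp only [T]
    split_ifs <;> simp [coeffMap_sMul, coeffMap_comp_apply, hD i k, sMul_comm i k]
  -- The evaluation `s_i = -D_i` for the `i` in the list.
  let E : List (Fin n) → PolyTensor n A →ₗ[ℂ] PolyTensor n A := fun l =>
    polyExtend (T l) (hT l) (TensorProduct.mk ℂ _ A 1)
  have hE1 : ∀ l a, E l (1 ⊗ₜ a) = 1 ⊗ₜ a := fun l a => polyExtend_one _ _ _ a
  have hEs : ∀ l i z, E l (sMul A i z) = T l i (E l z) := fun l i z => polyExtend_sMul _ _ _ i z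
  have hED : ∀ l i z, E l (coeffMap (D i) z) = coeffMap (D i) (E l z) := by
    intro l i z
    induction z using polyTensor_induction with
    | hc a => rw [LinearMap.lTensor_tmul, hE1, hE1, LinearMap.lTensor_tmul]
    | ha x y hx hy => simp only [map_add, hx, hy]
    | hs k x hx =>
      rw [coeffMap_sMul, hEs, hEs, hx]
      simp only [T]
      split_ifs
      · rw [LinearMap.neg_apply, LinearMap.neg_apply, map_neg, coeffMap_comp_apply,
          coeffMap_comp_apply, hD]
      · rw [coeffMap_sMul]
  have hEmem : ∀ l (z : Ind n A), z ∈ opSum (Ind n A) (l.map (delT N)) → E l z = 0 := by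
    intro l z hz
    have h : opSum (Ind n A) (l.map (delT N)) ≤ (E l).toAddMonoidHom.ker := opSum_le (by
      intro r hr x
      obtain ⟨i, hi, rfl⟩ := List.mem_map.mp hr
      rw [AddMonoidHom.mem_ker, ind_delT_smul]
      show E l (sMul A i x + coeffMap (D i) x) = 0
      rw [map_add, hEs, hED]
      simp [T, hi])
    exact h hz
  have hEsub : ∀ l (z : Ind n A),
      z - E l z ∈ opSum (Ind n A) (l.map (delT N)) := by
    intro l z
    induction z using polyTensor_induction with
    | hc a =>
      rw [hE1]
      convert zero_mem (opSum (Ind n A) (l.map (delT N)))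
      exact sub_self _
    | ha x y hx hy =>
      rw [map_add]
      convert add_mem hx hy using 1
      exact add_sub_add_comm _ _ _ _
    | hs i x hx =>
      have h1 := smul_mem_opSum_of_commute (r := delT N i) (l := l.map (delT N)) (by
        intro s hs
        obtain ⟨k, -, rfl⟩ := List.mem_map.mp hs
        exact delT_mul_delT i k) hx
      rw [smul_sub, ind_delT_smul, ind_delT_smul] at h1
      rw [hEs]
      have h2 := coeffMap_mem_opSum l i hx
      by_cases hi : i ∈ l
      · have h5 := smul_mem_opSum (R := TotalOp n N) (A := Ind n A)
          (List.mem_map_of_mem (f := delT N) hi) x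
        rw [ind_delT_smul] at h5
        convert sub_mem h5 h2 using 1
        simp only [T, if_pos hi, LinearMap.neg_apply, map_sub, D]
        abel
      · convert sub_mem h1 h2 using 1
        simp only [T, if_neg hi, map_sub, D]
        abel
  induction l with
  | nil => trivial
  | cons k l ih =>
    rw [List.nodup_cons] at hl
    refine ⟨ih hl.2, fun x hx => ?_⟩
    have h1 := hEmem l _ hx
    rw [ind_delT_smul] at h1
    have h2 : sMul A k (E l x) + coeffMap (D k) (E l x) = 0 := by
      have h3 : E l (sMul A k x + coeffMap (D k) x) = 0 := h1
      rw [map_add, hEs, hED] at h3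
      simpa only [T, if_neg hl.1] using h3
    have h3 := sMul_add_injective D opAct_delT_comm k h2
    have h4 := hEsub l x
    rw [h3] at h4
    convert h4 using 1
    exact (sub_zero x).symm

theorem isRegularList_ind : IsRegularList (Ind n A) (delTList n N) :=
  isRegularList_ind_map _ (List.nodup_finRange n)

variable (n N A) in
/-- The evaluation of `A[s]` at `sᵢ = -∂_{tᵢ} ∘ tᵢ`. -/
def indEval : PolyTensor n A →ₗ[ℂ] A :=
  polyExtend (fun i => -opAct n N A (delT N i))
    (fun i k => by rw [neg_mul_neg, neg_mul_neg, opAct_delT_comm]) LinearMap.id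

theorem indEval_one (a : A) : indEval n N A (1 ⊗ₜ a) = a := polyExtend_one _ _ _ a

theorem indEval_sMul (i : Fin n) (x : PolyTensor n A) :
    indEval n N A (sMul A i x) = -(delT N i • indEval n N A x) := polyExtend_sMul _ _ _ i x

theorem indEval_surjective : Function.Surjective (indEval n N A) := fun a => ⟨_, indEval_one a⟩

theorem indEval_coeffMap (D : A →ₗ[ℂ] B)
    (hD : ∀ (i : Fin n) (a : A), D (delT N i • a) = delT N i • D a)
    (x : PolyTensor n A) : indEval n N B (coeffMap D x) = D (indEval n N A x) := by
  induction x using polyTensor_induction with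
  | hc a => rw [LinearMap.lTensor_tmul, indEval_one, indEval_one]
  | ha x y hx hy => simp only [map_add, hx, hy]
  | hs i x hx => rw [coeffMap_sMul, indEval_sMul, indEval_sMul, hx, map_neg, hD]

/-- The evaluation identifies `A` with the quotient of the induced module by the images of the
`∂_{tᵢ}`. -/
theorem indEval_eq_zero_iff (x : Ind n A) :
    indEval n N A x = 0 ↔ x ∈ opSum (Ind n A) (delTList n N) := by
  constructor
  · intro h
    have h1 : x - (1 ⊗ₜ indEval n N A x : Ind n A) ∈
        opSum (Ind n A) (delTList n N) := by
      clear h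
      induction x using polyTensor_induction with
      | hc a =>
        rw [indEval_one]
        convert zero_mem (opSum (Ind n A) (delTList n N))
        exact sub_self _
      | ha x y hx hy =>
        rw [map_add, tmul_add]
        convert add_mem hx hy using 1
        exact add_sub_add_comm _ _ _ _
      | hs i x hx =>
        have h2 := smul_mem_opSum (A := Ind n A) (mem_delTList (N := N) i) x
        rw [ind_delT_smul] at h2
        convert sub_mem h2 (coeffMap_mem_opSum _ i hx) using 1
        rw [indEval_sMul, map_sub, LinearMap.lTensor_tmul, tmul_neg]
        simp only [Algebra.lsmul_coe]
        abel
    rw [h, tmul_zero] at h1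
    convert h1 using 1
    exact (sub_zero x).symm
  · intro h
    have h1 : opSum (Ind n A) (delTList n N) ≤
        (indEval n N A).toAddMonoidHom.ker := opSum_le (by
      intro r hr x
      obtain ⟨i, hi, rfl⟩ := List.mem_map.mp hr
      rw [AddMonoidHom.mem_ker, ind_delT_smul]
      show indEval n N A (sMul A i x + coeffMap (opAct n N A (delT N i)) x) = 0
      rw [map_add, indEval_sMul, indEval_coeffMap]
      · simp
      · intro k a
        simp only [Algebra.lsmul_coe]
        rw [smul_smul, smul_smul, delT_mul_delT])
    exact h1 h

end Induced

/-! ### Contractions and the number operator on exterior powers -/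

section Exterior

variable {n : ℕ}

/-- Contraction of the exterior algebra of `ℂⁿ` with the `i`-th coordinate. -/
def contractCoord (n : ℕ) (i : Fin n) :
    ExteriorAlgebra ℂ (Fin n → ℂ) →ₗ[ℂ] ExteriorAlgebra ℂ (Fin n → ℂ) :=
  CliffordAlgebra.contractLeft (Q := (0 : QuadraticForm ℂ (Fin n → ℂ))) (LinearMap.proj i)

theorem contractCoord_ι_mul (i : Fin n) (v : Fin n → ℂ) (x : ExteriorAlgebra ℂ (Fin n → ℂ)) :
    contractCoord n i (ExteriorAlgebra.ι ℂ v * x) =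
      v i • x - ExteriorAlgebra.ι ℂ v * contractCoord n i x :=
  CliffordAlgebra.contractLeft_ι_mul _ _ _

theorem contractCoord_of_mem_zero (i : Fin n) {x : ExteriorAlgebra ℂ (Fin n → ℂ)}
    (hx : x ∈ ⋀[ℂ]^0 (Fin n → ℂ)) : contractCoord n i x = 0 := by
  rw [ExteriorAlgebra.exteriorPower, pow_zero] at hx
  obtain ⟨r, rfl⟩ := Submodule.mem_one.mp hx
  exact CliffordAlgebra.contractLeft_algebraMap (0 : QuadraticForm ℂ (Fin n → ℂ))
    (LinearMap.proj i) r

theorem exteriorPower_succ_induction {q : ℕ} {p : ExteriorAlgebra ℂ (Fin n → ℂ) → Prop}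
    (hm : ∀ (v : Fin n → ℂ), ∀ y ∈ ⋀[ℂ]^q (Fin n → ℂ), p (ExteriorAlgebra.ι ℂ v * y))
    (ha : ∀ x y, p x → p y → p (x + y)) {x} (hx : x ∈ ⋀[ℂ]^(q + 1) (Fin n → ℂ)) : p x := by
  rw [ExteriorAlgebra.exteriorPower, pow_succ'] at hx
  refine Submodule.mul_induction_on hx ?_ ha
  rintro _ ⟨v, rfl⟩ y hy
  exact hm v y hy

theorem contractCoord_mem (i : Fin n) (q : ℕ) {x : ExteriorAlgebra ℂ (Fin n → ℂ)}
    (hx : x ∈ ⋀[ℂ]^(q + 1) (Fin n → ℂ)) : contractCoord n i x ∈ ⋀[ℂ]^q (Fin n → ℂ) := by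
  induction q generalizing x with
  | zero =>
    refine exteriorPower_succ_induction (p := fun x => contractCoord n i x ∈ ⋀[ℂ]^0 (Fin n → ℂ))
      (fun v y hy => ?_) (fun x y hx hy => ?_) hx
    · rw [contractCoord_ι_mul, contractCoord_of_mem_zero i hy, mul_zero, sub_zero]
      exact Submodule.smul_mem _ _ hy
    · rw [map_add]
      exact add_mem hx hy
  | succ q ih =>
    refine exteriorPower_succ_induction
      (p := fun x => contractCoord n i x ∈ ⋀[ℂ]^(q + 1) (Fin n → ℂ))
      (fun v y hy => ?_) (fun x y hx hy => ?_) hx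
    · rw [contractCoord_ι_mul]
      refine sub_mem (Submodule.smul_mem _ _ hy) ?_
      rw [ExteriorAlgebra.exteriorPower, pow_succ']
      exact Submodule.mul_mem_mul (LinearMap.mem_range_self _ _) (ih hy)
    · rw [map_add]
      exact add_mem hx hy

/-- Contraction of an exterior power of `ℂⁿ` with the `i`-th coordinate. -/
def contr (n : ℕ) (i : Fin n) (q : ℕ) :
    ⋀[ℂ]^(q + 1) (Fin n → ℂ) →ₗ[ℂ] ⋀[ℂ]^q (Fin n → ℂ) :=
  (contractCoord n i).restrict fun _ hx => contractCoord_mem i q hx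

theorem sum_smul_ι_single (v : Fin n → ℂ) :
    ∑ i, v i • ExteriorAlgebra.ι ℂ (Pi.single i (1 : ℂ)) = ExteriorAlgebra.ι ℂ v := by
  have h : ∑ i, v i • (Pi.single i (1 : ℂ) : Fin n → ℂ) = v := by
    simp [← Pi.single_smul, Finset.univ_sum_single]
  conv_rhs => rw [← h]
  rw [map_sum]
  exact Finset.sum_congr rfl fun i _ => (map_smul _ _ _).symm

theorem sum_ι_mul_contractCoord_ι_mul (v : Fin n → ℂ) (y : ExteriorAlgebra ℂ (Fin n → ℂ)) :
    ∑ i, ExteriorAlgebra.ι ℂ (Pi.single i (1 : ℂ)) *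
        contractCoord n i (ExteriorAlgebra.ι ℂ v * y) =
      ExteriorAlgebra.ι ℂ v * y + ExteriorAlgebra.ι ℂ v *
        ∑ i, ExteriorAlgebra.ι ℂ (Pi.single i (1 : ℂ)) * contractCoord n i y := by
  have h : ∀ i, ExteriorAlgebra.ι ℂ (Pi.single i (1 : ℂ)) *
      contractCoord n i (ExteriorAlgebra.ι ℂ v * y) =
      (v i • ExteriorAlgebra.ι ℂ (Pi.single i (1 : ℂ))) * y + ExteriorAlgebra.ι ℂ v *
        (ExteriorAlgebra.ι ℂ (Pi.single i (1 : ℂ)) * contractCoord n i y) := fun i => by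
    have hanti : ExteriorAlgebra.ι ℂ (Pi.single i (1 : ℂ)) * ExteriorAlgebra.ι ℂ v =
        -(ExteriorAlgebra.ι ℂ v * ExteriorAlgebra.ι ℂ (Pi.single i (1 : ℂ))) :=
      eq_neg_of_add_eq_zero_left (ExteriorAlgebra.ι_add_mul_swap _ _)
    rw [contractCoord_ι_mul, mul_sub, ← mul_assoc, hanti, neg_mul, sub_neg_eq_add, mul_assoc,
      mul_smul_comm, smul_mul_assoc]
  rw [Finset.sum_congr rfl fun i _ => h i, Finset.sum_add_distrib, ← Finset.sum_mul,
    sum_smul_ι_single, ← Finset.mul_sum]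

/-- The number operator `∑ᵢ eᵢ ∧ ιᵢ` on the exterior algebra. -/
def numberOp (n : ℕ) : Module.End ℂ (ExteriorAlgebra ℂ (Fin n → ℂ)) :=
  ∑ i, LinearMap.mulLeft ℂ (ExteriorAlgebra.ι ℂ (Pi.single i (1 : ℂ))) ∘ₗ contractCoord n i

theorem numberOp_apply (x : ExteriorAlgebra ℂ (Fin n → ℂ)) : numberOp n x =
    ∑ i, ExteriorAlgebra.ι ℂ (Pi.single i (1 : ℂ)) * contractCoord n i x := by
  rw [numberOp, LinearMap.sum_apply]
  rfl

theorem numberOp_ι_mul (v : Fin n → ℂ) (y : ExteriorAlgebra ℂ (Fin n → ℂ)) :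
    numberOp n (ExteriorAlgebra.ι ℂ v * y) =
      ExteriorAlgebra.ι ℂ v * y + ExteriorAlgebra.ι ℂ v * numberOp n y := by
  rw [numberOp_apply, numberOp_apply, sum_ι_mul_contractCoord_ι_mul]

/-- The number operator is multiplication by the degree. -/
theorem numberOp_of_mem (q : ℕ) {x : ExteriorAlgebra ℂ (Fin n → ℂ)}
    (hx : x ∈ ⋀[ℂ]^q (Fin n → ℂ)) : numberOp n x = (q : ℂ) • x := by
  induction q generalizing x with
  | zero =>
    rw [Nat.cast_zero, zero_smul, numberOp_apply]
    refine Finset.sum_eq_zero fun i _ => ?_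
    rw [contractCoord_of_mem_zero i hx, mul_zero]
  | succ q ih =>
    refine exteriorPower_succ_induction (p := fun x => numberOp n x = ((q + 1 : ℕ) : ℂ) • x)
      (fun v y hy => ?_) (fun x y hx hy => ?_) hx
    · rw [numberOp_ι_mul, ih hy, mul_smul_comm, Nat.cast_succ, add_smul, one_smul, add_comm]
    · rw [map_add, hx, hy, smul_add]

theorem sum_wedge_contr (q : ℕ) (x : ⋀[ℂ]^(q + 1) (Fin n → ℂ)) :
    ∑ i, wedge n i q (contr n i q x) = ((q + 1 : ℕ) : ℂ) • x := by
  apply Subtype.ext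
  have h := numberOp_of_mem (q + 1) x.2
  rw [numberOp_apply] at h
  rw [Submodule.coe_sum, Submodule.coe_smul, ← h]
  rfl

/-- The anticommutation relation `ι_i e_k + e_k ι_i = δ_{ik}`. -/
theorem contr_wedge (i k : Fin n) (q : ℕ) (x : ⋀[ℂ]^(q + 1) (Fin n → ℂ)) :
    contr n i (q + 1) (wedge n k (q + 1) x) =
      (if k = i then x else 0) - wedge n k q (contr n i q x) := by
  apply Subtype.ext
  have h := contractCoord_ι_mul i (Pi.single k (1 : ℂ)) (x : ExteriorAlgebra ℂ (Fin n → ℂ))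
  refine h.trans ?_
  rw [Submodule.coe_sub, Pi.single_apply, ite_smul, one_smul, zero_smul]
  congr 1
  split_ifs with h1 h2 h2
  · rfl
  · exact absurd h1.symm h2
  · exact absurd h2.symm h1
  · rfl

theorem contr_wedge_zero (i k : Fin n) (x : ⋀[ℂ]^0 (Fin n → ℂ)) :
    contr n i 0 (wedge n k 0 x) = if k = i then x else 0 := by
  apply Subtype.ext
  have h := contractCoord_ι_mul i (Pi.single k (1 : ℂ)) (x : ExteriorAlgebra ℂ (Fin n → ℂ))
  refine h.trans ?_
  rw [contractCoord_of_mem_zero i x.2, mul_zero, sub_zero, Pi.single_apply, ite_smul, one_smul,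
    zero_smul]
  split_ifs with h1 h2 h2
  · rfl
  · exact absurd h1.symm h2
  · exact absurd h2.symm h1
  · rfl

theorem subsingleton_exteriorPower {q : ℕ} (hq : n < q) :
    Subsingleton (⋀[ℂ]^q (Fin n → ℂ)) := by
  apply Module.finrank_zero_iff (R := ℂ).mp
  rw [exteriorPower.finrank_eq, Module.finrank_fin_fun, Nat.choose_eq_zero_of_lt hq]

theorem finrank_top_exteriorPower : Module.finrank ℂ (⋀[ℂ]^n (Fin n → ℂ)) = 1 := by
  rw [exteriorPower.finrank_eq, Module.finrank_fin_fun, Nat.choose_self]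

end Exterior

/-! ### The Koszul complex of the variables -/

section Koszul

variable {n : ℕ}

/-- The operator on polynomials that multiplies the part of degree `k` by `f k`. -/
def degScale (n : ℕ) (f : ℕ → ℂ) : Module.End ℂ (MvPolynomial (Fin n) ℂ) :=
  (MvPolynomial.basisMonomials (Fin n) ℂ).constr ℂ fun a => MvPolynomial.monomial a (f a.degree)

theorem degScale_monomial (f : ℕ → ℂ) (a : Fin n →₀ ℕ) :
    degScale n f (MvPolynomial.monomial a 1) = f a.degree • MvPolynomial.monomial a 1 := by
  have h := (MvPolynomial.basisMonomials (Fin n) ℂ).constr_basis ℂ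
    (fun a => MvPolynomial.monomial a (f a.degree)) a
  rw [MvPolynomial.coe_basisMonomials] at h
  rw [degScale, h, MvPolynomial.smul_monomial, smul_eq_mul, mul_one]

theorem polynomial_hom_ext {f g : Module.End ℂ (MvPolynomial (Fin n) ℂ)}
    (h : ∀ a, f (MvPolynomial.monomial a 1) = g (MvPolynomial.monomial a 1)) : f = g :=
  (MvPolynomial.basisMonomials (Fin n) ℂ).ext fun a => by
    rw [MvPolynomial.coe_basisMonomials]
    exact h a

/-- Multiplication by a variable raises the degree by one. -/
theorem degScale_X_mul (f : ℕ → ℂ) (i : Fin n) (p : MvPolynomial (Fin n) ℂ) :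
    degScale n f (MvPolynomial.X i * p) =
      MvPolynomial.X i * degScale n (fun k => f (k + 1)) p := by
  have h : degScale n f ∘ₗ LinearMap.mulLeft ℂ (MvPolynomial.X i) =
      LinearMap.mulLeft ℂ (MvPolynomial.X i) ∘ₗ degScale n (fun k => f (k + 1)) := by
    refine polynomial_hom_ext fun a => ?_
    have h1 : (MvPolynomial.X i * MvPolynomial.monomial a 1 : MvPolynomial (Fin n) ℂ) =
        MvPolynomial.monomial (Finsupp.single i 1 + a) 1 := by
      rw [MvPolynomial.X, MvPolynomial.monomial_mul, one_mul]
    simp only [LinearMap.comp_apply, LinearMap.mulLeft_apply, degScale_monomial, h1,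
      mul_smul_comm]
    rw [map_add, Finsupp.degree_single, add_comm]
  exact LinearMap.congr_fun h p

/-- The Euler operator `∑ᵢ sᵢ ∂/∂sᵢ`. -/
def euler (n : ℕ) : Module.End ℂ (MvPolynomial (Fin n) ℂ) :=
  ∑ i, LinearMap.mulLeft ℂ (MvPolynomial.X i) ∘ₗ (MvPolynomial.pderiv i).toLinearMap

theorem euler_apply (p : MvPolynomial (Fin n) ℂ) :
    euler n p = ∑ i, MvPolynomial.X i * MvPolynomial.pderiv i p := by
  rw [euler, LinearMap.sum_apply]
  rfl

/-- The operator `(E + c)⁻¹`, where `E` is the Euler operator; it is zero in the degree `-c`, if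
there is such a degree. -/
abbrev eulerInv (n : ℕ) (c : ℂ) : Module.End ℂ (MvPolynomial (Fin n) ℂ) :=
  degScale n fun k => (k + c)⁻¹

/-- `eulerInv n c` is inverse to `E + c`, up to the constant term if `c = 0`. -/
theorem euler_eulerInv (c : ℕ) (p : MvPolynomial (Fin n) ℂ) :
    euler n (eulerInv n c p) + (c : ℂ) • eulerInv n c p =
      p - if c = 0 then MvPolynomial.C (MvPolynomial.constantCoeff p) else 0 := by
  have h : euler n ∘ₗ eulerInv n c + (c : ℂ) • eulerInv n c = LinearMap.id -
      if c = 0 then (MvPolynomial.lcoeff ℂ 0).smulRight (1 : MvPolynomial (Fin n) ℂ) else 0 := by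
    refine polynomial_hom_ext fun a => ?_
    have h1 : euler n (MvPolynomial.monomial a 1) = (a.degree : ℂ) • MvPolynomial.monomial a 1 := by
      rw [euler_apply,
        (MvPolynomial.isHomogeneous_monomial (1 : ℂ) (n := a.degree) rfl).sum_X_mul_pderiv,
        Nat.cast_smul_eq_nsmul]
    simp only [LinearMap.add_apply, LinearMap.smul_apply, LinearMap.comp_apply, degScale_monomial,
      map_smul, h1, smul_smul, ← add_smul, LinearMap.sub_apply, LinearMap.id_apply]
    rcases Nat.eq_zero_or_pos c with rfl | hc
    · rw [if_pos rfl, LinearMap.smulRight_apply, MvPolynomial.lcoeff_apply,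
        MvPolynomial.coeff_monomial]
      by_cases ha : a = 0
      · subst ha
        simp
      · have h2 : (a.degree : ℂ) ≠ 0 := by
          rw [Nat.cast_ne_zero, Ne, Finsupp.degree_eq_zero_iff]
          exact ha
        simp [ha, h2]
    · have h2 : (a.degree : ℂ) + c ≠ 0 := by
        norm_cast
        omega
      rw [if_neg hc.ne', LinearMap.zero_apply, sub_zero]
      rw [mul_comm (c : ℂ), ← mul_add, inv_mul_cancel₀ h2, one_smul]
  have h2 := LinearMap.congr_fun h p
  simp only [LinearMap.add_apply, LinearMap.smul_apply, LinearMap.comp_apply,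
    LinearMap.sub_apply, LinearMap.id_apply] at h2
  rw [h2]
  congr 1
  split_ifs
  · rw [LinearMap.smulRight_apply, MvPolynomial.lcoeff_apply, MvPolynomial.smul_eq_C_mul, mul_one]
    rfl
  · rfl

variable (M : Type) [AddCommGroup M] [Module ℂ M]

/-- The space `M ⊗ ⋀^q ℂⁿ` of forms with coefficients in `M`. -/
abbrev FormsIn (n : ℕ) (q : ℕ) : Type := M ⊗[ℂ] ⋀[ℂ]^q (Fin n → ℂ)

/-- Exterior multiplication by the `i`-th basis vector on forms with coefficients in `M`. -/
abbrev wedgeIn (i : Fin n) (q : ℕ) : FormsIn M n q →ₗ[ℂ] FormsIn M n (q + 1) :=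
  LinearMap.lTensor M (wedge n i q)

/-- Contraction with the `i`-th coordinate on forms with coefficients in `M`. -/
abbrev contrIn (i : Fin n) (q : ℕ) : FormsIn M n (q + 1) →ₗ[ℂ] FormsIn M n q :=
  LinearMap.lTensor M (contr n i q)

/-- The Koszul differential `∑ᵢ sᵢ ⊗ eᵢ ∧`. -/
def koszulD (n q : ℕ) : PolyTensor n (FormsIn M n q) →ₗ[ℂ] PolyTensor n (FormsIn M n (q + 1)) :=
  ∑ i, sMul _ i ∘ₗ coeffMap (wedgeIn M i q)

/-- The homotopy `∑ᵢ ∂/∂sᵢ ⊗ ιᵢ`. -/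
def koszulH (n q : ℕ) : PolyTensor n (FormsIn M n (q + 1)) →ₗ[ℂ] PolyTensor n (FormsIn M n q) :=
  ∑ i, TensorProduct.map (MvPolynomial.pderiv i).toLinearMap (contrIn M i q)

variable {M}

theorem koszulD_tmul (q : ℕ) (p : MvPolynomial (Fin n) ℂ) (m : M) (ω : ⋀[ℂ]^q (Fin n → ℂ)) :
    koszulD M n q (p ⊗ₜ (m ⊗ₜ ω)) = ∑ i, (MvPolynomial.X i * p) ⊗ₜ (m ⊗ₜ wedge n i q ω) := by
  rw [koszulD, LinearMap.sum_apply]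
  rfl

theorem koszulH_tmul (q : ℕ) (p : MvPolynomial (Fin n) ℂ) (m : M)
    (ω : ⋀[ℂ]^(q + 1) (Fin n → ℂ)) :
    koszulH M n q (p ⊗ₜ (m ⊗ₜ ω)) = ∑ i, (MvPolynomial.pderiv i p) ⊗ₜ (m ⊗ₜ contr n i q ω) := by
  rw [koszulH, LinearMap.sum_apply]
  rfl

theorem formsPoly_induction {q : ℕ} {P : PolyTensor n (FormsIn M n q) → Prop} (hz : P 0)
    (ha : ∀ x y, P x → P y → P (x + y)) (ht : ∀ p m ω, P (p ⊗ₜ (m ⊗ₜ ω))) (x) : P x := by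
  induction x using TensorProduct.induction_on with
  | zero => exact hz
  | add x y hx hy => exact ha x y hx hy
  | tmul p y =>
    induction y using TensorProduct.induction_on with
    | zero => rw [tmul_zero]; exact hz
    | add x y hx hy => rw [tmul_add]; exact ha _ _ hx hy
    | tmul m ω => exact ht p m ω

theorem pderiv_X_mul (i k : Fin n) (p : MvPolynomial (Fin n) ℂ) :
    MvPolynomial.pderiv k (MvPolynomial.X i * p) =
      MvPolynomial.X i * MvPolynomial.pderiv k p + if i = k then p else 0 := by
  rw [Derivation.leibniz, MvPolynomial.pderiv_X, Pi.single_apply, smul_eq_mul, smul_eq_mul,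
    mul_ite, mul_one, mul_zero]

/-- The homotopy contracts the Koszul complex up to the operator `E + c`, where `c` is the
difference of `n` and the degree of the forms. -/
theorem koszul_homotopy (q c : ℕ) (hq : q + 1 + c = n) (x : PolyTensor n (FormsIn M n (q + 1))) :
    koszulD M n q (koszulH M n q x) + koszulH M n (q + 1) (koszulD M n (q + 1) x) =
      LinearMap.rTensor _ (euler n) x + (c : ℂ) • x := by
  induction x using formsPoly_induction with
  | hz => simp
  | ha x y hx hy =>
    simp only [map_add, smul_add]
    rw [add_add_add_comm, hx, hy]
    abel
  | ht p m ω =>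
    rw [koszulH_tmul, koszulD_tmul, map_sum, map_sum]
    simp only [koszulH_tmul, koszulD_tmul, contr_wedge]
    rw [Finset.sum_comm, ← Finset.sum_add_distrib]
    have h : ∀ i, (∑ k, (MvPolynomial.X i * MvPolynomial.pderiv k p) ⊗ₜ[ℂ]
          (m ⊗ₜ[ℂ] wedge n i q (contr n k q ω)) +
        ∑ k, MvPolynomial.pderiv k (MvPolynomial.X i * p) ⊗ₜ[ℂ]
          (m ⊗ₜ[ℂ] ((if i = k then ω else 0) - wedge n i q (contr n k q ω)))) =
        ((MvPolynomial.X i * MvPolynomial.pderiv i p) ⊗ₜ[ℂ] (m ⊗ₜ[ℂ] ω) + p ⊗ₜ[ℂ] (m ⊗ₜ[ℂ] ω) -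
          p ⊗ₜ[ℂ] (m ⊗ₜ[ℂ] wedge n i q (contr n i q ω))) := fun i => by
      rw [← Finset.sum_add_distrib, Finset.sum_eq_single i]
      · rw [pderiv_X_mul, if_pos rfl, if_pos rfl]
        simp only [add_tmul, tmul_sub]
        abel
      · intro k _ hk
        rw [pderiv_X_mul, if_neg hk.symm, if_neg hk.symm, add_zero, zero_sub, tmul_neg, tmul_neg,
          add_neg_cancel]
      · simp
    have hsum : ∑ i, p ⊗ₜ[ℂ] (m ⊗ₜ[ℂ] wedge n i q (contr n i q ω)) =
        p ⊗ₜ[ℂ] (m ⊗ₜ[ℂ] (((q + 1 : ℕ) : ℂ) • ω)) := by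
      rw [← tmul_sum, ← tmul_sum, sum_wedge_contr]
    rw [Finset.sum_congr rfl fun i _ => h i, Finset.sum_sub_distrib, Finset.sum_add_distrib,
      hsum, LinearMap.rTensor_tmul, euler_apply, sum_tmul,
      Finset.sum_const, Finset.card_univ, Fintype.card_fin, tmul_smul, tmul_smul,
      ← Nat.cast_smul_eq_nsmul ℂ, add_sub_assoc, ← sub_smul]
    have hn : (n : ℂ) - ((q + 1 : ℕ) : ℂ) = c := by
      rw [sub_eq_iff_eq_add', ← Nat.cast_add, hq]
    rw [hn]

/-- The case of degree zero of `koszul_homotopy`, where there is no incoming differential. -/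
theorem koszul_homotopy_zero (x : PolyTensor n (FormsIn M n 0)) :
    koszulH M n 0 (koszulD M n 0 x) = LinearMap.rTensor _ (euler n) x + (n : ℂ) • x := by
  induction x using formsPoly_induction with
  | hz => simp
  | ha x y hx hy =>
    simp only [map_add, smul_add, hx, hy]
    abel
  | ht p m ω =>
    rw [koszulD_tmul, map_sum]
    simp only [koszulH_tmul, contr_wedge_zero]
    have h : ∀ i, ∑ k, MvPolynomial.pderiv k (MvPolynomial.X i * p) ⊗ₜ[ℂ]
          (m ⊗ₜ[ℂ] (if i = k then ω else 0)) =
        (MvPolynomial.X i * MvPolynomial.pderiv i p) ⊗ₜ[ℂ] (m ⊗ₜ[ℂ] ω) +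
          p ⊗ₜ[ℂ] (m ⊗ₜ[ℂ] ω) := fun i => by
      rw [Finset.sum_eq_single i]
      · rw [pderiv_X_mul, if_pos rfl, if_pos rfl, add_tmul]
      · intro k _ hk
        rw [if_neg hk.symm, tmul_zero, tmul_zero]
      · simp
    rw [Finset.sum_congr rfl fun i _ => h i, Finset.sum_add_distrib, LinearMap.rTensor_tmul,
      euler_apply, sum_tmul, Finset.sum_const, Finset.card_univ, Fintype.card_fin,
      ← Nat.cast_smul_eq_nsmul ℂ]

/-- The Koszul differential intertwines the inverses of `E + c + 1` and `E + c`, as it raises the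
degree by one. -/
theorem koszulD_eulerInv (q : ℕ) (c : ℂ) (x : PolyTensor n (FormsIn M n q)) :
    koszulD M n q (LinearMap.rTensor _ (eulerInv n (c + 1)) x) =
      LinearMap.rTensor _ (eulerInv n c) (koszulD M n q x) := by
  induction x using formsPoly_induction with
  | hz => simp
  | ha x y hx hy => simp only [map_add, hx, hy]
  | ht p m ω =>
    have h : (fun k : ℕ => ((k + 1 : ℕ) + c)⁻¹) = fun k : ℕ => ((k : ℂ) + (c + 1))⁻¹ := by
      funext k
      rw [Nat.cast_succ, add_assoc, add_comm 1 c]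
    rw [LinearMap.rTensor_tmul, koszulD_tmul, koszulD_tmul, map_sum]
    refine Finset.sum_congr rfl fun i _ => ?_
    rw [LinearMap.rTensor_tmul, eulerInv, eulerInv, degScale_X_mul, h]

variable (n) in
/-- The constant term of a polynomial with coefficients in `A`. -/
def constTerm (A : Type) [AddCommGroup A] [Module ℂ A] : PolyTensor n A →ₗ[ℂ] A :=
  TensorProduct.lift ((LinearMap.lsmul ℂ A).comp (MvPolynomial.lcoeff ℂ 0))

theorem constTerm_tmul {A : Type} [AddCommGroup A] [Module ℂ A] (p : MvPolynomial (Fin n) ℂ)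
    (a : A) : constTerm n A (p ⊗ₜ a) = MvPolynomial.constantCoeff p • a := rfl

theorem euler_rTensor_eulerInv {A : Type} [AddCommGroup A] [Module ℂ A] (c : ℕ)
    (x : PolyTensor n A) (hx : c = 0 → constTerm n A x = 0) :
    LinearMap.rTensor A (euler n) (LinearMap.rTensor A (eulerInv n c) x) +
      (c : ℂ) • LinearMap.rTensor A (eulerInv n c) x = x := by
  have h : LinearMap.rTensor A (euler n) (LinearMap.rTensor A (eulerInv n c) x) +
      (c : ℂ) • LinearMap.rTensor A (eulerInv n c) x =
      x - if c = 0 then 1 ⊗ₜ constTerm n A x else 0 := by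
    clear hx
    induction x using TensorProduct.induction_on with
    | zero => simp
    | add x y hx hy =>
      simp only [map_add, smul_add]
      rw [add_add_add_comm, hx, hy]
      split_ifs
      · rw [tmul_add]; abel
      · abel
    | tmul p a =>
      rw [LinearMap.rTensor_tmul, LinearMap.rTensor_tmul, smul_tmul', ← add_tmul, euler_eulerInv,
        sub_tmul]
      split_ifs
      · rw [constTerm_tmul, tmul_smul, smul_tmul', MvPolynomial.smul_eq_C_mul, mul_one]
      · rw [zero_tmul]
  rw [h]
  split_ifs with hc
  · rw [hx hc, tmul_zero, sub_zero]
  · rw [sub_zero]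

/-- The Koszul complex is exact below the top degree `n`, and in degree `n` its image contains the
polynomials without constant term. -/
theorem koszul_exact_succ (q : ℕ) (x : PolyTensor n (FormsIn M n (q + 1)))
    (hx : koszulD M n (q + 1) x = 0) (hc : q + 1 = n → constTerm n _ x = 0) :
    ∃ y, koszulD M n q y = x := by
  rcases lt_or_ge n (q + 1) with h | h
  · have := subsingleton_exteriorPower h
    have : Subsingleton (FormsIn M n (q + 1)) := inferInstance
    have : Subsingleton (PolyTensor n (FormsIn M n (q + 1))) := inferInstance
    exact ⟨0, Subsingleton.elim _ _⟩
  · obtain ⟨c, hq⟩ := Nat.exists_eq_add_of_le h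
    refine ⟨koszulH M n q (LinearMap.rTensor _ (eulerInv n c) x), ?_⟩
    have h1 := koszul_homotopy q c hq.symm (LinearMap.rTensor _ (eulerInv n c) x)
    have h2 : koszulD M n (q + 1) (LinearMap.rTensor _ (eulerInv n c) x) = 0 := by
      have h3 := koszulD_eulerInv (q + 1) ((c : ℂ) - 1) x
      rwa [hx, map_zero, sub_add_cancel] at h3
    rw [h2, map_zero, add_zero] at h1
    rw [h1, euler_rTensor_eulerInv c x fun h0 => hc (by omega)]

/-- In degree zero, the Koszul differential is injective, except on the constants if `n = 0`. -/
theorem koszul_exact_zero (x : PolyTensor n (FormsIn M n 0)) (hx : koszulD M n 0 x = 0)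
    (hc : n = 0 → constTerm n _ x = 0) : x = 0 := by
  have h1 := koszul_homotopy_zero (LinearMap.rTensor _ (eulerInv n n) x)
  have h2 : koszulD M n 0 (LinearMap.rTensor _ (eulerInv n n) x) = 0 := by
    have h3 := koszulD_eulerInv 0 ((n : ℂ) - 1) x
    rwa [hx, map_zero, sub_add_cancel] at h3
  rw [h2, map_zero, euler_rTensor_eulerInv n x hc] at h1
  exact h1.symm

theorem constTerm_koszulD (q : ℕ) (x : PolyTensor n (FormsIn M n q)) :
    constTerm n _ (koszulD M n q x) = 0 := by
  induction x using formsPoly_induction with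
  | hz => simp
  | ha x y hx hy => rw [map_add, map_add, hx, hy, add_zero]
  | ht p m ω =>
    rw [koszulD_tmul, map_sum]
    refine Finset.sum_eq_zero fun i _ => ?_
    rw [constTerm_tmul, map_mul, MvPolynomial.constantCoeff_X, zero_mul, zero_smul]

theorem koszulD_koszulD (q : ℕ) (x : PolyTensor n (FormsIn M n q)) :
    koszulD M n (q + 1) (koszulD M n q x) = 0 := by
  induction x using formsPoly_induction with
  | hz => simp
  | ha x y hx hy => rw [map_add, map_add, hx, hy, add_zero]
  | ht p m ω =>
    have h2 : koszulD M n (q + 1) (koszulD M n q (p ⊗ₜ (m ⊗ₜ ω))) =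
        ∑ i, ∑ k, (MvPolynomial.X i * (MvPolynomial.X k * p)) ⊗ₜ
          (m ⊗ₜ wedge n i (q + 1) (wedge n k q ω)) := by
      rw [koszulD_tmul, map_sum]
      simp only [koszulD_tmul]
      rw [Finset.sum_comm]
    have h3 : koszulD M n (q + 1) (koszulD M n q (p ⊗ₜ (m ⊗ₜ ω))) =
        -koszulD M n (q + 1) (koszulD M n q (p ⊗ₜ (m ⊗ₜ ω))) := by
      conv_lhs => rw [h2, Finset.sum_comm]
      rw [h2, ← Finset.sum_neg_distrib]
      refine Finset.sum_congr rfl fun i _ => ?_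
      rw [← Finset.sum_neg_distrib]
      refine Finset.sum_congr rfl fun k _ => ?_
      rw [mul_left_comm, wedge_wedge, tmul_neg, tmul_neg]
    have h4 : (2 : ℂ) • koszulD M n (q + 1) (koszulD M n q (p ⊗ₜ (m ⊗ₜ ω))) = 0 := by
      rw [two_smul]
      nth_rewrite 1 [h3]
      exact neg_add_cancel _
    exact (smul_eq_zero.mp h4).resolve_left two_ne_zero

end Koszul

/-! ### Linearity over the differential operators -/

section IndLinear

variable {n N : ℕ}
variable {A B : Type} [AddCommGroup A] [Module ℂ A] [Module (TotalOp n N) A]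
  [IsScalarTower ℂ (TotalOp n N) A] [AddCommGroup B] [Module ℂ B] [Module (TotalOp n N) B]
  [IsScalarTower ℂ (TotalOp n N) B]

/-- A map of induced modules that commutes with the variables `sᵢ` and with the operators on the
coefficients is linear over the differential operators. -/
def indLinear (g : PolyTensor n A →ₗ[ℂ] PolyTensor n B)
    (hc : ∀ (P : TotalOp n N) x, g (coeffMap (opAct n N A P) x) = coeffMap (opAct n N B P) (g x))
    (hs : ∀ i x, g (sMul A i x) = sMul B i (g x)) : Ind n A →ₗ[TotalOp n N] Ind n B :=
  (totalCoords n N).linearMapOfCommute g.toAddMonoidHom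
    (fun f x => by
      rw [ind_fn_smul, ind_fn_smul]
      exact hc _ x)
    (fun i x => by
      rw [ind_del_smul, ind_del_smul]
      rcases i with i | j
      · show g (coeffMap (opAct n N A _) x + sMul A i (coeffMap (opAct n N A _) x)) =
          coeffMap (opAct n N B _) (g x) + sMul B i (coeffMap (opAct n N B _) (g x))
        rw [map_add, hs, hc, hc]
      · exact hc _ x)

variable (n N A) in
/-- The constant term is a linear map from the induced module to `A`. -/
def indConst : Ind n A →ₗ[TotalOp n N] A :=
  (totalCoords n N).linearMapOfCommute (constTerm n A).toAddMonoidHom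
    (fun f x => by
      rw [ind_fn_smul]
      induction x using TensorProduct.induction_on with
      | zero => simp
      | add x y hx hy => rw [map_add, map_add, hx, hy, map_add, smul_add]
      | tmul p a => exact (smul_algebra_smul_comm _ _ _).symm)
    (fun i x => by
      rw [ind_del_smul]
      induction x using TensorProduct.induction_on with
      | zero => simp
      | add x y hx hy => rw [map_add, map_add, hx, hy, map_add, smul_add]
      | tmul p a =>
        show constTerm n A _ = _ • constTerm n A (p ⊗ₜ a)
        rcases i with i | j
        · rw [indDel_inl_tmul, map_add, constTerm_tmul, constTerm_tmul, constTerm_tmul, map_mul,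
            MvPolynomial.constantCoeff_X, zero_mul, zero_smul, add_zero]
          exact (smul_algebra_smul_comm _ _ _).symm
        · rw [indDel_inr_tmul, constTerm_tmul, constTerm_tmul]
          exact (smul_algebra_smul_comm _ _ _).symm)

theorem indConst_apply (x : Ind n A) : indConst n N A x = constTerm n A x := rfl

theorem indConst_surjective : Function.Surjective (indConst n N A) := fun a =>
  ⟨1 ⊗ₜ a, by rw [indConst_apply, constTerm_tmul, map_one, one_smul]⟩

/-- The operators `∂_{tᵢ} ∘ tᵢ` act on a projective module as a regular sequence, as the module is
a retract of an induced module. -/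
theorem isRegularList_of_projective (M : ModuleCat.{0} (TotalOp n N)) [Projective M] :
    IsRegularList M (delTList n N) := by
  let _ : Module ℂ M := Module.compHom M (algebraMap ℂ (TotalOp n N))
  have : IsScalarTower ℂ (TotalOp n N) M := IsScalarTower.of_algebraMap_smul fun _ _ => rfl
  let f : ModuleCat.of (TotalOp n N) (Ind n M) ⟶ M := ModuleCat.ofHom (indConst n N M)
  have : Epi f := (ModuleCat.epi_iff_surjective f).mpr indConst_surjective
  refine IsRegularList.of_retract (B := Ind n M) isRegularList_ind
    (Projective.factorThru (𝟙 M) f).hom f.hom fun m => ?_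
  exact congrArg (fun u => u.hom m) (Projective.factorThru_comp (𝟙 M) f)

variable (M : Type) [AddCommGroup M] [Module ℂ M] [Module (TotalOp n N) M]
  [IsScalarTower ℂ (TotalOp n N) M] [SMulCommClass ℂ (TotalOp n N) M]

variable (n N) in
/-- The Koszul differential as a linear map of induced modules. It is taken with the sign for which
the evaluation at `sᵢ = -∂_{tᵢ} ∘ tᵢ` turns it into `∑ᵢ (∂_{tᵢ} ∘ tᵢ) ⊗ eᵢ ∧`. -/
def koszulLin (q : ℕ) :
    Ind n (FormsIn M n q) →ₗ[TotalOp n N] Ind n (FormsIn M n (q + 1)) :=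
  indLinear (-koszulD M n q)
    (fun P x => by
      induction x using formsPoly_induction with
      | hz => simp
      | ha x y hx hy => simp only [map_add, hx, hy]
      | ht p m ω =>
        show -koszulD M n q (p ⊗ₜ ((P • m) ⊗ₜ ω)) =
          coeffMap (opAct n N _ P) (-koszulD M n q (p ⊗ₜ (m ⊗ₜ ω)))
        rw [koszulD_tmul, koszulD_tmul, map_neg, map_sum]
        rfl)
    (fun i x => by
      induction x using formsPoly_induction with
      | hz => simp
      | ha x y hx hy => simp only [map_add, hx, hy]
      | ht p m ω =>
        rw [sMul_tmul, LinearMap.neg_apply, LinearMap.neg_apply, koszulD_tmul, koszulD_tmul,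
          map_neg, map_sum]
        simp only [sMul_tmul, mul_left_comm])

end IndLinear

/-! ### Bounded resolutions indexed by the natural numbers -/

section Extend

section

open HomologicalComplex

variable {C D ι ι' : Type*} [Category* C] [Category* D] [Preadditive C] [Preadditive D]
  [Limits.HasZeroObject C] {c : ComplexShape ι} {c' : ComplexShape ι'}
  (F : C ⥤ D) [F.Additive] (K : HomologicalComplex C c) (e : c.Embedding c')

/-- The image of the comparison of `K.extend e` and `K`, in the degrees of `K`. -/
def mapXIso {i : ι} {i' : ι'} (h : e.f i = i') :
    ((F.mapHomologicalComplex c').obj (K.extend e)).X i' ≅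
      ((F.mapHomologicalComplex c).obj K).X i :=
  F.mapIso (K.extendXIso e h)

theorem map_extend_d {i j : ι} {i' j' : ι'} (hi : e.f i = i') (hj : e.f j = j') :
    ((F.mapHomologicalComplex c').obj (K.extend e)).d i' j' =
      (mapXIso F K e hi).hom ≫ ((F.mapHomologicalComplex c).obj K).d i j ≫
        (mapXIso F K e hj).inv := by
  have h := congrArg F.map (K.extend_d_eq e hi hj)
  rw [F.map_comp, F.map_comp] at h
  exact h

variable [Limits.HasZeroObject D]

open scoped Classical in
/-- In each degree, an additive functor commutes with the extension of complexes by zero. -/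
def mapExtendXIso (i' : ι') : ((F.mapHomologicalComplex c').obj (K.extend e)).X i' ≅
    (((F.mapHomologicalComplex c).obj K).extend e).X i' :=
  if h : ∃ i, e.f i = i' then
    mapXIso F K e h.choose_spec ≪≫
      (((F.mapHomologicalComplex c).obj K).extendXIso e h.choose_spec).symm
  else
    Limits.IsZero.iso (F.map_isZero (K.isZero_extend_X e i' fun i hi => h ⟨i, hi⟩))
      (((F.mapHomologicalComplex c).obj K).isZero_extend_X e i' fun i hi => h ⟨i, hi⟩)

theorem mapExtendXIso_hom {i : ι} {i' : ι'} (h : e.f i = i') :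
    (mapExtendXIso F K e i').hom = (mapXIso F K e h).hom ≫
      (((F.mapHomologicalComplex c).obj K).extendXIso e h).inv := by
  have h' : ∃ i, e.f i = i' := ⟨i, h⟩
  obtain rfl : i = h'.choose := e.injective_f (h.trans h'.choose_spec.symm)
  rw [mapExtendXIso, dif_pos h']
  rfl

/-- An additive functor commutes with the extension of complexes by zero. -/
def mapExtendIso : (F.mapHomologicalComplex c').obj (K.extend e) ≅
    ((F.mapHomologicalComplex c).obj K).extend e :=
  Hom.isoOfComponents (mapExtendXIso F K e) (fun i' j' _ => by
    by_cases hi : ∃ i, e.f i = i'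
    · by_cases hj : ∃ j, e.f j = j'
      · obtain ⟨i, hi⟩ := hi
        obtain ⟨j, hj⟩ := hj
        rw [mapExtendXIso_hom F K e hi, mapExtendXIso_hom F K e hj, map_extend_d F K e hi hj,
          extend_d_eq _ e hi hj]
        simp only [Category.assoc, Iso.inv_hom_id_assoc]
      · exact (isZero_extend_X _ e j' fun j h => hj ⟨j, h⟩).eq_of_tgt _ _
    · exact Limits.IsZero.eq_of_src
        (F.map_isZero (K.isZero_extend_X e i' fun i h => hi ⟨i, h⟩)) _ _)

end

variable {R S : Type} [Ring R] [Ring S]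

/-- A complex of modules in degrees `0, …, n` which is exact below degree `n` is a resolution of
the cokernel of its last differential. -/
theorem exists_quasiIso_single (K : CochainComplex (ModuleCat.{0} R) ℕ) (n : ℕ)
    (hK : Limits.IsZero (K.X (n + 1))) (Z : ModuleCat.{0} R) (p : K.X n ⟶ Z)
    (hp : Function.Surjective p.hom) (hpd : ∀ i (x : K.X i), p.hom ((K.d i n).hom x) = 0)
    (hker : ∀ x : K.X n, p.hom x = 0 →
      ∃ y : K.X ((ComplexShape.up ℕ).prev n), (K.d _ n).hom y = x)
    (hex : ∀ q, q ≠ n → ∀ x : K.X q, (K.d q (q + 1)).hom x = 0 →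
      ∃ y : K.X ((ComplexShape.up ℕ).prev q), (K.d _ q).hom y = x) :
    ∃ ε : K ⟶ (HomologicalComplex.single _ _ n).obj Z, QuasiIso ε := by
  have hd : ∀ i, (ComplexShape.up ℕ).Rel i n → K.d i n ≫ p = 0 := fun i _ =>
    ModuleCat.hom_ext (LinearMap.ext fun x => hpd i x)
  refine ⟨HomologicalComplex.mkHomToSingle p hd, ⟨fun q => ?_⟩⟩
  by_cases hq : q = n
  · subst hq
    rw [quasiIsoAt_iff, ShortComplex.quasiIso_iff_of_zeros']
    · constructor
      · rw [ShortComplex.moduleCat_exact_iff]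
        intro x hx
        refine hker x ?_
        have h : (HomologicalComplex.singleObjXSelf (ComplexShape.up ℕ) q Z).inv.hom (p.hom x) =
            0 := by
          have h2 : ((HomologicalComplex.mkHomToSingle p hd).f q).hom x = 0 := hx
          rwa [HomologicalComplex.mkHomToSingle_f] at h2
        have h2 := congrArg (HomologicalComplex.singleObjXSelf (ComplexShape.up ℕ) q Z).hom.hom h
        rw [map_zero] at h2
        rw [← h2]
        exact congrArg (fun u => u.hom (p.hom x)) (HomologicalComplex.singleObjXSelf
          (ComplexShape.up ℕ) q Z).inv_hom_id.symm
      · show Epi ((HomologicalComplex.mkHomToSingle p hd).f q)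
        rw [HomologicalComplex.mkHomToSingle_f]
        have : Epi p := (ModuleCat.epi_iff_surjective p).mpr hp
        infer_instance
    · refine Limits.IsZero.eq_of_tgt ?_ _ _
      show Limits.IsZero (K.X _)
      rwa [CochainComplex.next]
    · rfl
    · rfl
  · rw [quasiIsoAt_iff_exactAt']
    · rw [HomologicalComplex.exactAt_iff' K _ q (q + 1) rfl (by simp),
        ShortComplex.moduleCat_exact_iff]
      exact hex q hq
    · exact HomologicalComplex.exactAt_single_obj _ _ _ _ hq

/-- A functor given by quotients modulo the images of a list of commuting elements is left derived
by resolutions `K⁰ → ⋯ → Kⁿ → Z` by modules on which the list is regular, if it is regular on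
projective modules. -/
theorem nonempty_iso_shift_extend {l : List R} (hl : l.Pairwise fun r s => r * s = s * r)
    (F : ModuleCat.{0} R ⥤ ModuleCat.{0} S) [F.Additive]
    (θ : ∀ M : ModuleCat.{0} R, M →+ F.obj M) (hθ : ∀ M, Function.Surjective (θ M))
    (hker : ∀ (M : ModuleCat.{0} R) (m : M), θ M m = 0 ↔ m ∈ opSum M l)
    (hnat : ∀ {M M' : ModuleCat.{0} R} (f : M ⟶ M') (m : M),
      (F.map f).hom (θ M m) = θ M' (f.hom m))
    (hproj : ∀ M : ModuleCat.{0} R, Projective M → IsRegularList M l)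
    {Z : ModuleCat.{0} R} (P : ProjectiveResolution Z) (K : CochainComplex (ModuleCat.{0} R) ℕ)
    (n : ℕ) (hK : ∀ q, n < q → Limits.IsZero (K.X q)) (hreg : ∀ i, IsRegularList (K.X i) l)
    (ε : K ⟶ (HomologicalComplex.single _ _ n).obj Z) [QuasiIso ε]
    (T : CochainComplex (ModuleCat.{0} S) ℕ)
    (f : (F.mapHomologicalComplex (ComplexShape.up ℕ)).obj K ≅ T)
    [HasDerivedCategory.{w} (ModuleCat.{0} S)] :
    Nonempty (DerivedCategory.Q.obj
        ((F.mapHomologicalComplex (ComplexShape.up ℤ)).obj P.cochainComplex) ≅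
      (DerivedCategory.Q.obj (T.extend ComplexShape.embeddingUpNat))⟦(n : ℤ)⟧) := by
  let e := ComplexShape.embeddingUpNat
  let E : CochainComplex (ModuleCat.{0} R) ℤ := (K.extend e)⟦(n : ℤ)⟧
  have hX : ∀ i : ℤ, (∃ q : ℕ, (q : ℤ) = i + n ∧ Nonempty (E.X i ≅ K.X q)) ∨
      (i + n < 0 ∧ Limits.IsZero (E.X i)) := fun i => by
    by_cases h : ∃ q : ℕ, (q : ℤ) = i + n
    · obtain ⟨q, hq⟩ := h
      exact Or.inl ⟨q, hq, ⟨K.extendXIso e hq⟩⟩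
    · refine Or.inr ⟨?_, K.isZero_extend_X e _ fun q hq => h ⟨q, hq⟩⟩
      by_contra h0
      exact h ⟨(i + n).toNat, by omega⟩
  have hE : E.IsStrictlyLE 0 := by
    rw [CochainComplex.isStrictlyLE_iff]
    intro i hi
    rcases hX i with ⟨q, hq, ⟨u⟩⟩ | h
    · exact (hK q (by omega)).of_iso u
    · exact h.2
  have hE' : ∀ i, IsRegularList (E.X i) l := fun i => by
    rcases hX i with ⟨q, hq, ⟨u⟩⟩ | h
    · exact (hreg q).of_retract u.hom.hom u.inv.hom fun a =>
        congrArg (fun v => v.hom a) u.hom_inv_id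
    · exact (hreg 0).of_retract 0 0 fun a => by
        have := ModuleCat.subsingleton_of_isZero h.2
        exact Subsingleton.elim _ _
  let u : ((HomologicalComplex.single _ (ComplexShape.up ℤ) (n : ℤ)).obj Z)⟦(n : ℤ)⟧ ≅
      (CochainComplex.singleFunctor _ 0).obj Z :=
    ((CochainComplex.singleFunctors _).shiftIso (n : ℤ) 0 n (add_zero _)).app Z
  let η : E ⟶ (CochainComplex.singleFunctor _ 0).obj Z :=
    (HomologicalComplex.extendMap ε e ≫
      (HomologicalComplex.extendSingleIso e Z n n rfl).hom)⟦(n : ℤ)⟧' ≫ u.hom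
  have hη : QuasiIso η := by
    have h1 : QuasiIso (HomologicalComplex.extendMap ε e ≫
        (HomologicalComplex.extendSingleIso e Z n (n : ℤ) rfl).hom) := inferInstance
    have h2 := (CochainComplex.quasiIso_shift_iff _ (n : ℤ)).mpr h1
    exact quasiIso_comp _ _
  obtain ⟨u⟩ := nonempty_iso_of_isRegularList hl F θ hθ hker hnat hproj P E hE' η
  refine ⟨u ≪≫ DerivedCategory.Q.mapIso
    ((F.mapCochainComplexShiftIso (n : ℤ)).app (K.extend e) ≪≫
      (shiftFunctor _ (n : ℤ)).mapIso (mapExtendIso F K e ≪≫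
        (e.extendFunctor _).mapIso f)) ≪≫
    (DerivedCategory.Q.commShiftIso (n : ℤ)).app _⟩

end Extend

/-! ### The hypergeometric connection on the structure sheaf -/

section Line

variable {n N : ℕ}

theorem pdT_eq_theta (i : Fin n) (h : TotalRing n N) :
    pdT (Poly N) i h = mono (-unitVec i) * theta N i h := by
  rw [theta_apply, ← mul_assoc, mono_mul, neg_add_cancel, mono_zero, one_mul]

theorem pdT_mono_neg_mul {i k : Fin n} (h : i ≠ k) (f : TotalRing n N) :
    pdT (Poly N) i (mono (-unitVec k) * f) =
      mono (-unitVec k) * (mono (-unitVec i) * theta N i f) := by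
  have h1 : pdT (Poly N) i (mono (-unitVec k) : TotalRing n N) = 0 := pdT_mono_neg_of_ne h
  rw [Derivation.leibniz, h1, smul_zero, add_zero, smul_eq_mul, pdT_eq_theta]

variable (w : Matrix (Fin n) (Fin N) ℤ) (γ : Fin n → ℂ)

/-- The coefficients of the logarithmic derivative `∑ γᵢ dtᵢ / tᵢ + dF` of `t^γ e^F`. -/
def gkzForm : Fin n ⊕ Fin N → TotalRing n N
  | .inl i => mono (-unitVec i) * logMul w γ i
  | .inr j => colMono w j

/-- The form `∑ γᵢ dtᵢ / tᵢ + dF` is closed. -/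
theorem gkzForm_closed (i k : Fin n ⊕ Fin N) :
    (totalCoords n N).pd i (gkzForm w γ k) = (totalCoords n N).pd k (gkzForm w γ i) := by
  have hmix : ∀ (i : Fin n) (j : Fin N), pdT (Poly N) i (colMono w j) =
      xDer n j (mono (-unitVec i) * logMul w γ i) := by
    intro i j
    have h1 : theta N i (colMono w j) = w i j • colMono w j := theta_mono _ _
    rw [pdT_eq_theta, h1, Derivation.leibniz, xDer_mono, xDer_logMul, smul_zero, add_zero,
      smul_eq_mul]
  rcases i with i | i <;> rcases k with k | k
  · rcases eq_or_ne i k with rfl | h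
    · rfl
    · show pdT (Poly N) i (mono (-unitVec k) * logMul w γ k) =
        pdT (Poly N) k (mono (-unitVec i) * logMul w γ i)
      rw [pdT_mono_neg_mul h, pdT_mono_neg_mul h.symm, theta_logMul, mul_left_comm]
  · exact hmix i k
  · exact (hmix k i).symm
  · exact (xDer_mono _ _).trans (xDer_mono _ _).symm

/-- The connection `h ↦ dh + (∑ γᵢ dtᵢ / tᵢ + dF) h` on the structure sheaf. -/
def gkzLine : FlatConn (totalCoords n N) (TotalRing n N) :=
  FlatConn.ofForm (totalCoords n N) (gkzForm w γ) (gkzForm_closed w γ)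

theorem gkzLine_nabla (i : Fin n ⊕ Fin N) (h : TotalRing n N) :
    (gkzLine w γ).nabla i h = (totalCoords n N).pd i h + gkzForm w γ i * h := rfl

end Line

section Pullback

variable {ι A κ B : Type} [Fintype ι] [DecidableEq ι] [CommRing A] [Algebra ℂ A]
  [Fintype κ] [DecidableEq κ] [CommRing B] [Algebra ℂ B]

/-- The inverse image of the structure module is the structure module. -/
def pullbackUnit (φ : B →ₐ[ℂ] A) : A ≃ₗ[A] PullbackCarrier φ B where
  toFun a := (show Along φ from a) ⊗ₜ 1
  invFun x := (TensorProduct.rid B (Along φ) x : Along φ)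
  map_add' a a' := add_tmul _ _ _
  map_smul' a a' := rfl
  left_inv a := by
    show TensorProduct.rid B (Along φ) _ = _
    rw [TensorProduct.rid_tmul, one_smul]
  right_inv x := (TensorProduct.rid B (Along φ)).symm_apply_apply x

/-- Functions on the target can be moved to the left of the tensor sign. -/
theorem pullbackUnit_mul (φ : B →ₐ[ℂ] A) (a : A) (b : B) :
    (show Along φ from a) ⊗ₜ[B] b = pullbackUnit φ (φ b * a) := by
  have h : b = b • (1 : B) := by rw [smul_eq_mul, mul_one]
  conv_lhs => rw [h, ← smul_tmul]
  rfl

/-- The inverse image of the connection `d + α` is the connection `d + φ^* α`. -/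
theorem pullback_ofForm_nabla (c : EtaleCoords ι A) (e : EtaleCoords κ B) (φ : B →ₐ[ℂ] A)
    (α : κ → B) (hα : ∀ i j, e.pd i (α j) = e.pd j (α i)) (i : ι) (a : A) :
    (FlatConn.pullback c φ (FlatConn.ofForm e α hα)).nabla i (pullbackUnit φ a) =
      pullbackUnit φ (c.pd i a + ∑ j, φ (α j) * c.pd i (φ (e.coord j)) * a) := by
  have h1 : ∀ j, (FlatConn.ofForm e α hα).nabla j 1 = α j := fun j => by
    show e.pd j 1 + α j * 1 = α j
    rw [Derivation.map_one_eq_zero, zero_add, mul_one]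
  have h2 : (FlatConn.pullback c φ (FlatConn.ofForm e α hα)).nabla i (pullbackUnit φ a) =
      pullbackUnit φ (c.pd i a) + ∑ j, (show Along φ from a * c.pd i (φ (e.coord j))) ⊗ₜ[B]
        (FlatConn.ofForm e α hα).nabla j 1 := rfl
  rw [h2, map_add, map_sum]
  congr 1
  refine Finset.sum_congr rfl fun j _ => ?_
  rw [h1, pullbackUnit_mul, mul_comm a, mul_assoc]

end Pullback

section Trivialization

variable {n N : ℕ} (w : Matrix (Fin n) (Fin N) ℤ) (γ : Fin n → ℂ)

/-- The module `π₁^* K_γ ⊗ F^* L` is free of rank one over the functions. -/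
def gkzTriv : TotalRing n N ≃ₗ[TotalRing n N]
    PullbackCarrier (proj₁ n N) (Laurent n ℂ) ⊗[TotalRing n N]
      PullbackCarrier (comapF w) (Poly 1) :=
  (TensorProduct.rid (TotalRing n N) (TotalRing n N)).symm ≪≫ₗ
    TensorProduct.congr (pullbackUnit (proj₁ n N)) (pullbackUnit (comapF w))

theorem gkzTriv_apply (h : TotalRing n N) :
    gkzTriv w h = pullbackUnit (proj₁ n N) h ⊗ₜ pullbackUnit (comapF w) 1 := rfl

theorem pullbackUnit_eq_smul {A B : Type} [CommRing A] [Algebra ℂ A]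
    [CommRing B] [Algebra ℂ B] (φ : B →ₐ[ℂ] A) (a : A) :
    pullbackUnit φ a = a • pullbackUnit φ 1 := by
  rw [← map_smul, smul_eq_mul, mul_one]

theorem proj₁_mono (k : Fin n → ℤ) : proj₁ n N (mono k) = mono k := by
  simp [proj₁, mono]

theorem comapF_X : comapF w (MvPolynomial.X 0) = expF w := by
  simp [comapF]

theorem theta_expF (i : Fin n) :
    theta N i (expF w) = ∑ j, w i j • (xVar n j * colMono w j) := by
  rw [expF, map_sum]
  exact Finset.sum_congr rfl fun j _ => theta_term w i j

theorem xDer_expF (j : Fin N) : xDer n j (expF w) = colMono w j := by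
  rw [expF, map_sum, Finset.sum_eq_single j]
  · rw [Derivation.leibniz, xDer_xVar, colMono, xDer_mono]
    simp
  · intro k _ hk
    rw [Derivation.leibniz, xDer_xVar, colMono, xDer_mono]
    simp [hk]
  · simp

/-- The connection form of `π₁^* K_γ ⊗ F^* L`. -/
theorem gkzForm_eq (i : Fin n ⊕ Fin N) :
    ∑ k, proj₁ n N (γ k • mono (-unitVec k)) * (totalCoords n N).pd i
        (proj₁ n N ((torusCoords n).coord k)) +
      ∑ k : Fin 1, comapF w 1 * (totalCoords n N).pd i (comapF w ((polyCoords 1).coord k)) =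
      gkzForm w γ i := by
  have h1 : ∀ k, proj₁ n N ((torusCoords n).coord k) = mono (unitVec k) := fun k => proj₁_mono _
  have h2 : comapF w ((polyCoords 1).coord 0) = expF w := comapF_X w
  rw [Fin.sum_univ_one, map_one, one_mul, h2]
  simp only [h1, map_smul, proj₁_mono]
  rcases i with i | j
  · have h3 : ∀ k, (totalCoords n N).pd (Sum.inl i) (mono (unitVec k)) = if k = i then 1 else 0 :=
      fun k => pdT_coord i k
    have h4 : (totalCoords n N).pd (Sum.inl i) (expF w) = mono (-unitVec i) * theta N i (expF w) :=
      pdT_eq_theta i _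
    rw [h4, theta_expF, Finset.sum_eq_single i]
    · rw [h3, if_pos rfl, mul_one, gkzForm, logMul, mul_add]
      congr 1
      rw [← algebraMap_smul (Poly N) (γ i), Algebra.smul_def, mul_comm]
    · intro k _ hk
      rw [h3, if_neg hk, mul_zero]
    · simp
  · have h3 : ∀ k, (totalCoords n N).pd (Sum.inr j) (mono (unitVec k)) = 0 :=
      fun k => xDer_mono j _
    simp only [h3, mul_zero, Finset.sum_const_zero, zero_add]
    exact xDer_expF w j

/-- The trivialization is horizontal for the connection `d + ∑ γᵢ dtᵢ / tᵢ + dF`. -/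
theorem gkzConn_nabla (i : Fin n ⊕ Fin N) (h : TotalRing n N) :
    (gkzConn w γ).nabla i (gkzTriv w h) = gkzTriv w ((gkzLine w γ).nabla i h) := by
  have h0 : (gkzConn w γ).nabla i (gkzTriv w h) =
      ((kummer γ).pullback (totalCoords n N) (proj₁ n N)).nabla i (pullbackUnit (proj₁ n N) h) ⊗ₜ
        pullbackUnit (comapF w) 1 + pullbackUnit (proj₁ n N) h ⊗ₜ
        (expModule.pullback (totalCoords n N) (comapF w)).nabla i (pullbackUnit (comapF w) 1) := rfl
  rw [h0, kummer, expModule, pullback_ofForm_nabla, pullback_ofForm_nabla,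
    Derivation.map_one_eq_zero, zero_add,
    pullbackUnit_eq_smul (comapF w) (∑ k : Fin 1, comapF w 1 * (totalCoords n N).pd i
      (comapF w ((polyCoords 1).coord k)) * 1), tmul_smul, smul_tmul', ← map_smul, ← add_tmul,
    ← map_add, ← gkzTriv_apply, gkzLine_nabla, ← gkzForm_eq, add_mul, Finset.sum_mul,
    Finset.sum_mul, ← add_assoc, smul_eq_mul, Finset.sum_mul]
  simp only [mul_one]

/-- The `D`-module `π₁^* K_γ ⊗ F^* L` is the structure sheaf with the connection
`h ↦ dh + (∑ γᵢ dtᵢ / tᵢ + dF) h`. -/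
def gkzIso : (gkzLine w γ).Space ≃ₗ[TotalOp n N] (gkzConn w γ).Space :=
  LinearEquiv.ofBijective
    ((totalCoords n N).linearMapOfCommute (gkzTriv w).toLinearMap.toAddMonoidHom
      (X := (gkzLine w γ).Space) (Y := (gkzConn w γ).Space)
      (fun f x => (congrArg (gkzTriv w) ((gkzLine w γ).rep_fn f x)).trans
        ((map_smul (gkzTriv w) f _).trans ((gkzConn w γ).rep_fn f (gkzTriv w x)).symm))
      (fun i x => (congrArg (gkzTriv w) ((gkzLine w γ).rep_del i x)).trans
        ((gkzConn_nabla w γ i x).symm.trans ((gkzConn w γ).rep_del i (gkzTriv w x)).symm)))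
    (gkzTriv w).bijective

end Trivialization

/-! ### The direct image of the Koszul resolution -/

section DirectImage

variable {n N : ℕ}

theorem delT_mul_weylIncl (i : Fin n) (Q : Weyl N) :
    delT N i * weylIncl n N Q = weylIncl n N Q * delT N i := by
  have h : (totalCoords n N).fn (mono (unitVec i)) * weylIncl n N Q =
      weylIncl n N Q * (totalCoords n N).fn (mono (unitVec i)) := by
    induction Q using EtaleCoords.induction with
    | hf b => rw [weylIncl_fn, ← map_mul, ← map_mul, mul_comm]
    | hd j => rw [weylIncl_del, fn_mono_mul_del_inr]
    | ha P Q hP hQ => rw [map_add, mul_add, add_mul, hP, hQ]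
    | hm P Q hP hQ => rw [map_mul, ← mul_assoc, hP, mul_assoc, hQ, mul_assoc]
  rw [delT, mul_assoc, h, ← mul_assoc, del_inl_mul_weylIncl, mul_assoc]

section

variable {A : Type} [AddCommGroup A] [Module ℂ A] [Module (TotalOp n N) A]
  [IsScalarTower ℂ (TotalOp n N) A]

/-- Operators in `x` act on the coefficients. -/
theorem ind_weylIncl_smul (Q : Weyl N) (x : Ind n A) :
    weylIncl n N Q • x = coeffMap (opAct n N A (weylIncl n N Q)) x := by
  induction Q using EtaleCoords.induction generalizing x with
  | hf b => rw [weylIncl_fn, ind_fn_smul]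
  | hd j =>
    rw [weylIncl_del, ind_del_smul]
    rfl
  | ha P Q hP hQ =>
    rw [map_add, add_smul, hP, hQ, opAct, opAct, opAct, map_add, coeffMap, coeffMap, coeffMap,
      LinearMap.lTensor_add]
    rfl
  | hm P Q hP hQ =>
    rw [map_mul, mul_smul, hQ, hP, coeffMap_comp_apply, opAct, opAct, opAct, map_mul]
    rfl

theorem indEval_weylIncl_smul (Q : Weyl N) (x : Ind n A) :
    indEval n N A (weylIncl n N Q • x) = weylIncl n N Q • indEval n N A x := by
  rw [ind_weylIncl_smul]
  exact indEval_coeffMap _ (fun i a => by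
    simp only [Algebra.lsmul_coe]
    rw [smul_smul, smul_smul, delT_mul_weylIncl]) x

end

/-- An additive map that is equivariant along a ring homomorphism descends to a linear isomorphism
from any other quotient with the same kernel. -/
theorem exists_linearEquiv_of_ker_eq {R S X Y Z : Type} [Ring R] [Ring S] [AddCommGroup X]
    [Module R X] [AddCommGroup Y] [Module S Y] [AddCommGroup Z] [Module S Z] (φ : S → R)
    (α : X →+ Y) (β : X →+ Z) (hα : Function.Surjective α) (hβ : Function.Surjective β)
    (h : ∀ x, α x = 0 ↔ β x = 0) (hαs : ∀ s x, α (φ s • x) = s • α x)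
    (hβs : ∀ s x, β (φ s • x) = s • β x) : ∃ e : Y ≃ₗ[S] Z, ∀ x, e (α x) = β x := by
  have hwd : ∀ x y, α x = α y → β x = β y := fun x y hxy => by
    rw [← sub_eq_zero, ← map_sub, ← h, map_sub, hxy, sub_self]
  have hr := Function.rightInverse_surjInv hα
  have he : ∀ x, β (Function.surjInv hα (α x)) = β x := fun x => hwd _ _ (hr _)
  let f : Y →ₗ[S] Z :=
    { toFun := fun y => β (Function.surjInv hα y)
      map_add' := fun y y' => by
        rw [← map_add]
        exact hwd _ _ (by rw [map_add, hr, hr, hr])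
      map_smul' := fun s y => by
        rw [RingHom.id_apply, ← hβs]
        exact hwd _ _ (by rw [hαs, hr, hr]) }
  refine ⟨LinearEquiv.ofBijective f ⟨?_, fun z => ?_⟩, he⟩
  · rw [← LinearMap.ker_eq_bot, LinearMap.ker_eq_bot']
    intro y hy
    have h1 := (h (Function.surjInv hα y)).mpr hy
    rwa [hr] at h1
  · obtain ⟨x, rfl⟩ := hβ z
    exact ⟨α x, he x⟩

variable (w : Matrix (Fin n) (Fin N) ℤ) (γ : Fin n → ℂ)

/-- The action of `∂_{tᵢ} ∘ tᵢ` becomes that of `logOp` after multiplication by `t₁ ⋯ t_n`. -/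
theorem logOp_mono_mul (i : Fin n) (m : (gkzLine w γ).Space) :
    logOp w γ i (mono 1 * (show TotalRing n N from m)) =
      mono 1 * (show TotalRing n N from delT N i • m) := by
  have h1 : (delT N i • m : (gkzLine w γ).Space) =
      (gkzLine w γ).nabla (Sum.inl i)
        ((mono (unitVec i) : TotalRing n N) • (show TotalRing n N from m)) := by
    rw [delT, mul_smul]
    refine ((gkzLine w γ).rep_del _ _).trans (congrArg _ ?_)
    exact (gkzLine w γ).rep_fn _ _
  have h2 : ∀ m : TotalRing n N, (totalCoords n N).pd (Sum.inl i) (mono (unitVec i) * m) =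
      m + theta N i m := fun m => by
    show pdT (Poly N) i (mono (unitVec i) * m) = _
    rw [Derivation.leibniz, pdT_coord, if_pos rfl, theta_apply, smul_eq_mul, smul_eq_mul, mul_one,
      add_comm]
  have h3 : ∀ m : TotalRing n N, gkzForm w γ (Sum.inl i) * (mono (unitVec i) * m) =
      logMul w γ i * m := fun m => by
    rw [gkzForm, mul_mul_mul_comm, mono_mul, neg_add_cancel, mono_zero, one_mul]
  have h4 : theta N i (mono 1 : TotalRing n N) = mono 1 := by
    rw [theta_mono, Pi.one_apply, one_smul]
  rw [h1, gkzLine_nabla, smul_eq_mul, h2, h3, logOp_eq, Derivation.leibniz, h4, smul_eq_mul,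
    smul_eq_mul]
  ring

theorem mono_mul_mono_mul {k l : Fin n → ℤ} (h : k + l = 0) (m : TotalRing n N) :
    mono k * (mono l * m) = m := by
  rw [← mul_assoc, mono_mul, h, mono_zero, one_mul]

/-- Multiplication by `t₁ ⋯ t_n`, that is by the ratio of the volume forms `dt₁ ∧ ⋯ ∧ dt_n` and
`dt₁/t₁ ∧ ⋯ ∧ dt_n/t_n`. -/
def volumeMul : (gkzLine w γ).Space ≃ₗ[ℂ] (coeffConn (n := n) w).Space :=
  LinearEquiv.ofLinearMap
    (LinearMap.mulLeft ℂ (mono 1 : TotalRing n N) :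
      (gkzLine w γ).Space →ₗ[ℂ] (coeffConn (n := n) w).Space)
    (LinearMap.mulLeft ℂ (mono (-1) : TotalRing n N) :
      (coeffConn (n := n) w).Space →ₗ[ℂ] (gkzLine w γ).Space)
    (LinearMap.ext fun m => mono_mul_mono_mul (add_neg_cancel 1) m)
    (LinearMap.ext fun m => mono_mul_mono_mul (neg_add_cancel 1) m)

/-- Multiplication by `t₁ ⋯ t_n` commutes with the operators in `x`. -/
theorem volumeMul_weylIncl_smul (Q : Weyl N) (m : (gkzLine w γ).Space) :
    volumeMul w γ (weylIncl n N Q • m) = Q • volumeMul w γ m := by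
  induction Q using EtaleCoords.induction generalizing m with
  | hf b =>
    have h1 : weylIncl n N ((polyCoords N).fn b) • m =
        (show (gkzLine w γ).Space from proj₂ n N b * (show TotalRing n N from m)) := by
      rw [weylIncl_fn]
      exact (gkzLine w γ).rep_fn _ m
    have h2 : (polyCoords N).fn b • volumeMul w γ m =
        (show (coeffConn (n := n) w).Space from
          proj₂ n N b * (show TotalRing n N from volumeMul w γ m)) :=
      ((coeffConn w).rep_fn b _).trans (Algebra.smul_def _ _)
    rw [h1, h2]
    exact mul_left_comm (mono 1) (proj₂ n N b) (show TotalRing n N from m)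
  | hd j =>
    have h1 : weylIncl n N ((polyCoords N).del j) • m =
        (show (gkzLine w γ).Space from
          xDer n j (show TotalRing n N from m) + colMono w j * (show TotalRing n N from m)) := by
      rw [weylIncl_del]
      exact (gkzLine w γ).rep_del _ m
    have h2 : (polyCoords N).del j • volumeMul w γ m =
        (show (coeffConn (n := n) w).Space from
          xDer n j (mono 1 * (show TotalRing n N from m)) +
            colMono w j * (mono 1 * (show TotalRing n N from m))) :=
      (coeffConn w).rep_del j _
    have h3 : ∀ m : TotalRing n N, mono 1 * (xDer n j m + colMono w j * m) =
        xDer n j (mono 1 * m) + colMono w j * (mono 1 * m) := fun m => by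
      rw [Derivation.leibniz, xDer_mono, smul_zero, add_zero, smul_eq_mul, mul_add, mul_left_comm]
    rw [h1, h2]
    exact h3 _
  | ha P Q hP hQ => rw [map_add, add_smul, map_add, hP, hQ, add_smul]
  | hm P Q hP hQ => rw [map_mul, mul_smul, hP, hQ, mul_smul]

theorem volumeMul_delT_smul (i : Fin n) (m : (gkzLine w γ).Space) :
    volumeMul w γ (delT N i • m) = logOpLin w γ i (volumeMul w γ m) :=
  (logOp_mono_mul w γ i m).symm

/-- The map from the Koszul resolution to the twisted de Rham complex: evaluation at
`sᵢ = -∂_{tᵢ} ∘ tᵢ`, followed by multiplication by `t₁ ⋯ t_n`. -/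
def koszulToForms (q : ℕ) :
    PolyTensor n (FormsIn (gkzLine w γ).Space n q) →ₗ[ℂ] Forms n w q :=
  (LinearMap.rTensor _ (volumeMul w γ).toLinearMap) ∘ₗ
    indEval n N (FormsIn (gkzLine w γ).Space n q)

theorem koszulToForms_surjective (q : ℕ) : Function.Surjective (koszulToForms w γ q) :=
  (LinearEquiv.rTensor _ (volumeMul w γ)).surjective.comp indEval_surjective

theorem koszulToForms_eq_zero_iff (q : ℕ) (x : Ind n (FormsIn (gkzLine w γ).Space n q)) :
    koszulToForms w γ q x = 0 ↔ x ∈ opSum (Ind n (FormsIn (gkzLine w γ).Space n q))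
      (delTList n N) := by
  rw [← indEval_eq_zero_iff]
  exact (LinearEquiv.rTensor _ (volumeMul w γ)).map_eq_zero_iff

theorem koszulToForms_weylIncl_smul (q : ℕ) (Q : Weyl N)
    (x : Ind n (FormsIn (gkzLine w γ).Space n q)) :
    koszulToForms w γ q (weylIncl n N Q • x) = Q • koszulToForms w γ q x := by
  show LinearMap.rTensor _ _ (indEval n N _ (weylIncl n N Q • x)) =
    Q • LinearMap.rTensor _ _ (indEval n N _ x)
  rw [indEval_weylIncl_smul]
  induction indEval n N (FormsIn (gkzLine w γ).Space n q) x using TensorProduct.induction_on with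
  | zero => simp
  | add x y hx hy => rw [smul_add, map_add, hx, hy, map_add, smul_add]
  | tmul m ω =>
    show volumeMul w γ (weylIncl n N Q • m) ⊗ₜ ω = (Q • volumeMul w γ m) ⊗ₜ ω
    rw [volumeMul_weylIncl_smul]

/-- The evaluation carries the Koszul differential to the twisted differential. -/
theorem koszulToForms_koszulLin (q : ℕ) (x : Ind n (FormsIn (gkzLine w γ).Space n q)) :
    koszulToForms w γ (q + 1) (koszulLin n N (gkzLine w γ).Space q x) =
      twistedD w γ q (koszulToForms w γ q x) := by
  have h1 : ∀ i, indEval n N _ (coeffMap (wedgeIn (gkzLine w γ).Space i q) x) =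
      wedgeIn (gkzLine w γ).Space i q (indEval n N _ x) := fun i =>
    indEval_coeffMap _ (fun k a => by
      induction a using TensorProduct.induction_on with
      | zero => simp
      | add x y hx hy => rw [smul_add, map_add, hx, hy, map_add, smul_add]
      | tmul m ω => rfl) x
  have h2 : indEval n N _ (-koszulD (gkzLine w γ).Space n q x) =
      ∑ i, delT N i • wedgeIn (gkzLine w γ).Space i q (indEval n N _ x) := by
    rw [map_neg, koszulD, LinearMap.sum_apply, map_sum, ← Finset.sum_neg_distrib]
    refine Finset.sum_congr rfl fun i _ => ?_
    rw [LinearMap.comp_apply, indEval_sMul, neg_neg, h1]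
  show LinearMap.rTensor _ _ (indEval n N _ (-koszulD (gkzLine w γ).Space n q x)) =
    twistedD w γ q (LinearMap.rTensor _ _ (indEval n N _ x))
  rw [h2]
  generalize indEval n N (FormsIn (gkzLine w γ).Space n q) x = y
  rw [map_sum, twistedD, LinearMap.sum_apply]
  refine Finset.sum_congr rfl fun i _ => ?_
  induction y using TensorProduct.induction_on with
  | zero => simp
  | add x y hx hy => rw [map_add, smul_add, map_add, hx, hy, map_add, map_add]
  | tmul m ω =>
    show volumeMul w γ (delT N i • m) ⊗ₜ wedge n i q ω =
      logOpLin w γ i (volumeMul w γ m) ⊗ₜ wedge n i q ω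
    rw [volumeMul_delT_smul]

/-- The direct image of a term of the Koszul resolution is a term of the twisted de Rham complex. -/
theorem exists_transferTensor_equiv (q : ℕ) :
    ∃ e : TransferTensor (n := n) (N := N) (Ind n (FormsIn (gkzLine w γ).Space n q)) ≃ₗ[Weyl N]
      Forms n w q, ∀ x, e (toTransfer _ x) = koszulToForms w γ q x :=
  exists_linearEquiv_of_ker_eq (weylIncl n N) (toTransfer _)
    (koszulToForms w γ q).toAddMonoidHom toTransfer_surjective (koszulToForms_surjective w γ q)
    (fun x => (toTransfer_eq_zero_iff x).trans (koszulToForms_eq_zero_iff w γ q x).symm)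
    (fun Q x => toTransfer_weylIncl Q x) (koszulToForms_weylIncl_smul w γ q)

/-- The Koszul resolution of `π₁^* K_γ ⊗ F^* L` by induced modules. -/
def koszulComplex : CochainComplex (ModuleCat.{0} (TotalOp n N)) ℕ :=
  CochainComplex.of
    (fun q => ModuleCat.of (TotalOp n N) (Ind n (FormsIn (gkzLine w γ).Space n q)))
    (fun q => ModuleCat.ofHom (koszulLin n N (gkzLine w γ).Space q)) (fun q => by
      rw [← ModuleCat.ofHom_comp]
      refine ModuleCat.hom_ext (LinearMap.ext fun x => ?_)
      show -koszulD _ n (q + 1) (-koszulD _ n q x) = 0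
      rw [map_neg, neg_neg, koszulD_koszulD])

theorem koszulComplex_d (q : ℕ) : (koszulComplex w γ).d q (q + 1) =
    ModuleCat.ofHom (koszulLin n N (gkzLine w γ).Space q) :=
  CochainComplex.of_d
    (fun q => ModuleCat.of (TotalOp n N) (Ind n (FormsIn (gkzLine w γ).Space n q)))
    (fun q => ModuleCat.ofHom (koszulLin n N (gkzLine w γ).Space q)) q

theorem koszulComplex_d_apply (q : ℕ) (x : Ind n (FormsIn (gkzLine w γ).Space n q)) :
    ((koszulComplex w γ).d q (q + 1)).hom x =
      (-koszulD (gkzLine w γ).Space n q x : PolyTensor n _) := by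
  rw [koszulComplex_d]
  rfl

/-- The twisted relative de Rham complex, indexed by the natural numbers. -/
def twistedDeRhamNat : CochainComplex (ModuleCat.{0} (Weyl N)) ℕ :=
  CochainComplex.of (fun q : ℕ => ModuleCat.of (Weyl N) (Forms n w q))
    (fun q => ModuleCat.ofHom (twistedD w γ q)) (fun q => by
      rw [← ModuleCat.ofHom_comp, twistedD_comp]
      rfl)

/-- The functor `M ↦ D_{Y ← X} ⊗ M`. -/
abbrev transferFunctor (n N : ℕ) : ModuleCat.{0} (TotalOp n N) ⥤ ModuleCat.{0} (Weyl N) :=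
  ncTensorFunctor (TotalOp n N) (Weyl N) (TransferProj n N)

/-- The direct image of the Koszul resolution, term by term, is the twisted de Rham complex. -/
theorem nonempty_map_koszulComplex_iso :
    Nonempty (((transferFunctor n N).mapHomologicalComplex (ComplexShape.up ℕ)).obj
      (koszulComplex w γ) ≅ twistedDeRhamNat w γ) := by
  choose e he using exists_transferTensor_equiv w γ
  refine ⟨HomologicalComplex.Hom.isoOfComponents (fun q => (e q).toModuleIso) ?_⟩
  rintro q _ rfl
  refine ModuleCat.hom_ext (LinearMap.ext fun y => ?_)
  obtain ⟨x, rfl⟩ : ∃ x : Ind n (FormsIn (gkzLine w γ).Space n q), toTransfer _ x = y :=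
    toTransfer_surjective y
  have h1 : (twistedDeRhamNat w γ).d q (q + 1) = ModuleCat.ofHom (twistedD w γ q) :=
    CochainComplex.of_d (fun q => ModuleCat.of (Weyl N) (Forms n w q))
      (fun q => ModuleCat.ofHom (twistedD w γ q)) q
  show ((twistedDeRhamNat w γ).d q (q + 1)).hom (e q (toTransfer _ x)) =
    e (q + 1) (ncMap (TotalOp n N) (Weyl N) (TransferProj n N)
      ((koszulComplex w γ).d q (q + 1)).hom (toTransfer _ x))
  rw [h1, koszulComplex_d]
  show twistedD w γ q (e q (toTransfer _ x)) =
    e (q + 1) (toTransfer _ (koszulLin n N (gkzLine w γ).Space q x))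
  rw [he, he, koszulToForms_koszulLin]

/-- Forms of top degree with coefficients in `M` are identified with `M`, by an arbitrary
isomorphism of the one-dimensional space `⋀^n ℂⁿ` with `ℂ`. -/
def topForms (M : Type) [AddCommGroup M] [Module ℂ M] [Module (TotalOp n N) M]
    [IsScalarTower ℂ (TotalOp n N) M] [SMulCommClass ℂ (TotalOp n N) M] :
    FormsIn M n n ≃ₗ[TotalOp n N] M :=
  TensorProduct.AlgebraTensorModule.congr (LinearEquiv.refl (TotalOp n N) M)
      (LinearEquiv.ofFinrankEq (⋀[ℂ]^n (Fin n → ℂ)) ℂ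
        (finrank_top_exteriorPower.trans (Module.finrank_self ℂ).symm)) ≪≫ₗ
    TensorProduct.AlgebraTensorModule.rid ℂ (TotalOp n N) M

/-- The augmentation of the Koszul resolution: the constant term in top degree. -/
def koszulAug : (koszulComplex w γ).X n ⟶ (gkzConn w γ).toModuleCat :=
  ModuleCat.ofHom ((gkzIso w γ).toLinearMap ∘ₗ (topForms (gkzLine w γ).Space).toLinearMap ∘ₗ
    indConst n N (FormsIn (gkzLine w γ).Space n n))

theorem koszulAug_eq_zero_iff (x : Ind n (FormsIn (gkzLine w γ).Space n n)) :
    (koszulAug w γ).hom x = 0 ↔ constTerm n (FormsIn (gkzLine w γ).Space n n) x = 0 := by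
  show gkzIso w γ (topForms (gkzLine w γ).Space (constTerm n _ x)) = 0 ↔ _
  rw [LinearEquiv.map_eq_zero_iff, LinearEquiv.map_eq_zero_iff]

/-- The Koszul complex is a resolution of `π₁^* K_γ ⊗ F^* L`, placed in degree `n`. -/
theorem exists_koszulComplex_quasiIso :
    ∃ ε : koszulComplex w γ ⟶ (HomologicalComplex.single _ _ n).obj (gkzConn w γ).toModuleCat,
      QuasiIso ε := by
  have hex : ∀ q (x : Ind n (FormsIn (gkzLine w γ).Space n q)),
      koszulD (gkzLine w γ).Space n q x = 0 → (q = n → constTerm n _ x = 0) →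
      ∃ y : (koszulComplex w γ).X ((ComplexShape.up ℕ).prev q),
        ((koszulComplex w γ).d _ q).hom y = x := by
    intro q x hx hc
    rcases q with _ | q
    · exact ⟨0, (map_zero _).trans (koszul_exact_zero x hx fun h => hc h.symm).symm⟩
    · obtain ⟨y, hy⟩ := koszul_exact_succ q x hx hc
      rw [CochainComplex.prev_nat_succ]
      refine ⟨(-y : PolyTensor n _), ?_⟩
      rw [koszulComplex_d_apply, map_neg, neg_neg, hy]
  have hzero : ∀ q, n < q → Subsingleton (PolyTensor n (FormsIn (gkzLine w γ).Space n q)) :=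
    fun q hq => by
      have := subsingleton_exteriorPower hq
      have : Subsingleton (FormsIn (gkzLine w γ).Space n q) := inferInstance
      infer_instance
  refine exists_quasiIso_single (koszulComplex w γ) n ?_ _ (koszulAug w γ) ?_ ?_ ?_ ?_
  · have := hzero (n + 1) (Nat.lt_succ_self n)
    exact ModuleCat.isZero_of_subsingleton (ModuleCat.of (TotalOp n N)
      (Ind n (FormsIn (gkzLine w γ).Space n (n + 1))))
  · exact (gkzIso w γ).surjective.comp
      ((topForms (gkzLine w γ).Space).surjective.comp indConst_surjective)
  · intro q x
    by_cases hq : q + 1 = n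
    · subst hq
      refine (koszulAug_eq_zero_iff w γ _).mpr ?_
      refine (congrArg (constTerm (q + 1) _) (koszulComplex_d_apply w γ q x)).trans ?_
      rw [map_neg]
      exact neg_eq_zero.mpr (constTerm_koszulD q x)
    · rw [(koszulComplex w γ).shape q n hq]
      exact map_zero _
  · intro x hx
    have := hzero (n + 1) (Nat.lt_succ_self n)
    exact hex n x (Subsingleton.elim _ _) fun _ => (koszulAug_eq_zero_iff w γ x).mp hx
  · intro q hq x hx
    refine hex q x ?_ fun h => absurd h hq
    exact neg_eq_zero.mp ((koszulComplex_d_apply w γ q x).symm.trans hx)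

end DirectImage

end GKZ

theorem mainTheorem5 (n N : ℕ) (w : Matrix (Fin n) (Fin N) ℤ) (γ : Fin n → ℂ)
    [HasDerivedCategory.{w} (ModuleCat.{0} (GKZ.Weyl N))] :
    Nonempty (GKZ.hyp w γ ≅ (DerivedCategory.Q.obj (GKZ.twistedDeRham w γ))⟦(n : ℤ)⟧) := by
  obtain ⟨ε, hε⟩ := GKZ.exists_koszulComplex_quasiIso w γ
  obtain ⟨f⟩ := GKZ.nonempty_map_koszulComplex_iso w γ
  exact GKZ.nonempty_iso_shift_extend GKZ.delTList_pairwise (GKZ.transferFunctor n N)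
    (fun M => GKZ.toTransfer M) (fun _ => GKZ.toTransfer_surjective)
    (fun _ => GKZ.toTransfer_eq_zero_iff) (fun f => GKZ.ncMap_toTransfer f.hom)
    (fun M _ => GKZ.isRegularList_of_projective M)
    (projectiveResolution (GKZ.gkzConn w γ).toModuleCat) (GKZ.koszulComplex w γ) n
    (fun q hq => by
      have := GKZ.subsingleton_exteriorPower hq
      have : Subsingleton (GKZ.FormsIn (GKZ.gkzLine w γ).Space n q) := inferInstance
      have : Subsingleton (GKZ.Ind n (GKZ.FormsIn (GKZ.gkzLine w γ).Space n q)) := inferInstance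
      exact ModuleCat.isZero_of_subsingleton (ModuleCat.of (GKZ.TotalOp n N)
        (GKZ.Ind n (GKZ.FormsIn (GKZ.gkzLine w γ).Space n q))))
    (fun _ => GKZ.isRegularList_ind) ε (GKZ.twistedDeRhamNat w γ) f
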